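/- Let $F\in\mathbb{C}[y,p]$ be square-free with no non-constant factor in $\mathbb{C}[y]$ or in $\mathbb{C}[p]$, let $\mathbf{p}_0=(y_0,p_0)\in\mathbb{C}\times(\mathbb{C}\cup\{\infty\})$, and put $N=2(\deg_pF-1)\deg_yF+1$. Notation. $\mathrm{Sol}(\mathbf{p}_0)$ is the set of formal Puiseux series $y(x)\in\bigcup_{n\ge1}\mathbb{C}((x^{1/n}))$ with $F(y,y')=0$, $y(0)=y_0$ and $y'(0)=p_0$ (value $\infty$ meaning negative order). $\mathscr{C}(F)$ is the closure of the curve $F=0$ in $(\mathbb{C}\cup\{\infty\})^2$; $(y_0,\infty)\in\mathscr{C}(F)$ means that the leading coefficient of $F$ with respect to $p$ vanishes at $y_0$. A point of $\mathscr{C}(F)$ is critical if $p_0\in\{0,\infty\}$ or $\frac{\partial F}{\partial p}(\mathbf{p}_0)=0$. A formal parametrization at $\mathbf{p}_0$ is a pair $(a,b)\in\mathbb{C}((t))^2\setminus\mathbb{C}^2$ with $F(a,b)=0$ and $(a(0),b(0))=\mathbf{p}_0$; two of them are equivalent if they differ by a substitution $t\mapsto s(t)$, $s\in\mathbb{C}[[t]]$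 of order one; one is irreducible if it is not equivalent to a pair in $\mathbb{C}((t^m))^2$ with $m>1$; the classes of irreducible ones are the places at $\mathbf{p}_0$; a classical Puiseux parametrization is one of the form $(y_0+t^k,b(t))$ with $k\ge 1$. Algorithm PuiseuxSolve at $\mathbf{p}_0$ outputs the following set $\mathrm{ST}(\mathbf{p}_0)$ (empty if $\mathbf{p}_0\notin\mathscr{C}(F)$). If $\mathbf{p}_0\in\mathscr{C}(F)$ is not critical, the output is $y_0+p_0x$ alone. If $\mathbf{p}_0$ is critical, choose one classical Puiseux parametrization $(y_0+t^k,b(t))$ in every place at $\mathbf{p}_0$, and let $\hat a=y_0+t^k$ and let $\hat b$ consist of the first $N$ terms of $b=\sum_{i\ge r}b_it^i$, $r=\mathrm{ord}_t\,b$ (those with $r\le i<r+N$). Whenever $n:=k-r\geq 1$, for every power series $s(t)$ of order one with $\hat a'(s(t))\,s'(t)=n\,t^{n-1}\,\hat b(s(t))$ let $\hat s$ be the sum of its terms of degree at most $N$, and output $y_0$ plus the first $N$ terms of $\hat a(\hat s(x^{1/n}))-y_0$, i.e. those in $x^{j/n}$ with $k\le j<k+N$. If moreover $p_0=0$, also output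 the constant $y_0$. Claim. Such a choice of classical Puiseux parametrizations exists, and for every such choice $\mathrm{ST}(\mathbf{p}_0)$ is in one-to-one correspondence with $\mathrm{Sol}(\mathbf{p}_0)$ by truncation: for $y=y_0+\sum_{j\ge k}c_jx^{j/n}$ non-constant of ramification order $n$ with $c_k\neq0$, let $T(y)=y_0+\sum_{k\le j<k+M}c_jx^{j/n}$, where $M=N$ if $\mathbf{p}_0$ is critical and $M=1$ otherwise, and let $T(y_0)=y_0$ for the constant solution. Then $T$ is a bijection from $\mathrm{Sol}(\mathbf{p}_0)$ onto $\mathrm{ST}(\mathbf{p}_0)$, and it restricts to a bijection from the non-constant elements of $\mathrm{Sol}(\mathbf{p}_0)$ onto the non-constant elements of $\mathrm{ST}(\mathbf{p}_0)$. -/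

import Mathlib

open scoped Polynomial.Bivariate

namespace AutonomousODE

noncomputable section

/-! Bivariate polynomials `F(y, p)` are elements of `ℂ[X][Y]`: the inner variable is `y`, the outer
variable is `p`.  The extended line `ℂ ∪ {∞}` is `OnePoint ℂ`. -/

/-- The degree of `F` in `p`. -/
def degP (F : ℂ[X][Y]) : ℕ := F.natDegree

/-- The degree of `F` in `y`. -/
def degY (F : ℂ[X][Y]) : ℕ := F.support.sup fun i => (F.coeff i).natDegree

/-- The truncation order `N = 2 (deg_p F - 1) deg_y F + 1`. -/
def truncOrder (F : ℂ[X][Y]) : ℕ := 2 * (degP F - 1) * degY F + 1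

/-! ### Points of the curve -/

/-- The point `(y₀, p₀)` lies on the closure in `(ℂ ∪ {∞})²` of the curve `F = 0`.  At `p₀ = ∞` this
is the vanishing at `y₀` of the leading coefficient of `F` with respect to `p`. -/
def OnCurve (F : ℂ[X][Y]) (y₀ : ℂ) : OnePoint ℂ → Prop
  | none => F.leadingCoeff.eval y₀ = 0
  | some q => F.evalEval y₀ q = 0

/-- A critical curve point: `p₀ ∈ {0, ∞}` or `∂F/∂p` vanishes there. -/
def IsCritical (F : ℂ[X][Y]) (y₀ : ℂ) (p₀ : OnePoint ℂ) : Prop :=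
  OnCurve F y₀ p₀ ∧
    (p₀ = OnePoint.infty ∨
      ∃ q : ℂ, p₀ = (q : OnePoint ℂ) ∧ (q = 0 ∨ (Polynomial.derivative F).evalEval y₀ q = 0))

/-- The value at `0` of a formal series, in `ℂ ∪ {∞}`: it is `∞` if a negative exponent occurs, and
the constant coefficient otherwise. -/
def valueAtZero {Γ : Type} [LinearOrder Γ] [Zero Γ] (f : HahnSeries Γ ℂ) : OnePoint ℂ :=
  open Classical in
  if ∃ q, q < 0 ∧ f.coeff q ≠ 0 then OnePoint.infty else ((f.coeff 0 : ℂ) : OnePoint ℂ)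

/-! ### Formal Puiseux series and solutions of `F(y, y') = 0` -/

/-- All exponents of `φ` lie in `(1/n) ℤ`, i.e. `φ ∈ ℂ((x^{1/n}))`. -/
def HasDenominator (φ : HahnSeries ℚ ℂ) (n : ℕ) : Prop :=
  ∀ q ∈ φ.support, ∃ j : ℤ, q * n = j

/-- `φ` is a formal Puiseux series expanded around zero. -/
def IsPuiseux (φ : HahnSeries ℚ ℂ) : Prop := ∃ n : ℕ, 0 < n ∧ HasDenominator φ n

/-- The ramification order: the minimal `n ≥ 1` with `φ ∈ ℂ((x^{1/n}))`. -/
def ramificationOrder (φ : HahnSeries ℚ ℂ) : ℕ := sInf {n : ℕ | 0 < n ∧ HasDenominator φ n}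

/-- The derivative with respect to `x` of a series with rational exponents. -/
def puiseuxDeriv (φ : HahnSeries ℚ ℂ) : HahnSeries ℚ ℂ where
  coeff q := ((q + 1 : ℚ) : ℂ) * φ.coeff (q + 1)
  isPWO_support' := by
    have h : ((fun q : ℚ => q - 1) '' φ.support).IsPWO :=
      φ.isPWO_support.image_of_monotone fun a b hab => by simpa using hab
    refine h.mono fun q hq => ⟨q + 1, ?_, by ring⟩
    exact right_ne_zero_of_mul hq

/-- The formal Puiseux series `y` with `F(y, y') = 0` and `y(0) = y₀`, `y'(0) = p₀`. -/
def solutions (F : ℂ[X][Y]) (y₀ : ℂ) (p₀ : OnePoint ℂ) : Set (HahnSeries ℚ ℂ) :=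
  {y | IsPuiseux y ∧ Polynomial.aevalAeval y (puiseuxDeriv y) F = 0 ∧
    valueAtZero y = (y₀ : OnePoint ℂ) ∧ valueAtZero (puiseuxDeriv y) = p₀}

/-- The constant series. -/
def constants : Set (HahnSeries ℚ ℂ) := Set.range (HahnSeries.C : ℂ →+* HahnSeries ℚ ℂ)

/-- For `y = y₀ + ∑_{j ≥ k} c_j x^{j/n}` with `n` the ramification order and `c_k ≠ 0`, the series
`y₀` plus the first `M` terms, i.e. those with `k ≤ j < k + M`.  Constants are unchanged
if `M > 0`. -/
def firstTermsOfSolution (M : ℕ) (y : HahnSeries ℚ ℂ) : HahnSeries ℚ ℂ :=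
  HahnSeries.truncLT
    ((y - HahnSeries.C (y.coeff 0)).order + (M : ℚ) / (ramificationOrder y : ℚ)) y

/-- The truncation of solutions: `N` terms at critical curve points, one term elsewhere. -/
def solutionTruncation (F : ℂ[X][Y]) (y₀ : ℂ) (p₀ : OnePoint ℂ) (y : HahnSeries ℚ ℂ) :
    HahnSeries ℚ ℂ :=
  open Classical in
  firstTermsOfSolution (if IsCritical F y₀ p₀ then truncOrder F else 1) y

/-! ### Formal parametrizations and places -/

/-- The substitution `f(s(t))` of a power series `s` of order one into a Laurent series `f`:
writing `f = t^d g(t)` with `d = ord f`, it is `s^d g(s)`. -/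
def laurentSubst (f : LaurentSeries ℂ) (s : PowerSeries ℂ) : LaurentSeries ℂ :=
  (HahnSeries.ofPowerSeries ℤ ℂ s) ^ f.order *
    HahnSeries.ofPowerSeries ℤ ℂ (f.powerSeriesPart.subst s)

/-- `A ∈ ℂ((t))² \ ℂ²` is a formal parametrization of `F = 0` centered at `(y₀, p₀)`. -/
def IsParametrization (F : ℂ[X][Y]) (y₀ : ℂ) (p₀ : OnePoint ℂ)
    (A : LaurentSeries ℂ × LaurentSeries ℂ) : Prop :=
  (¬ ∃ c d : ℂ, A = (HahnSeries.C c, HahnSeries.C d)) ∧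
    Polynomial.aevalAeval A.1 A.2 F = 0 ∧
    valueAtZero A.1 = (y₀ : OnePoint ℂ) ∧ valueAtZero A.2 = p₀

/-- `A ∼ B`: there is a power series `s` of order one with `A(s(t)) = B(t)`. -/
def Equivalent (A B : LaurentSeries ℂ × LaurentSeries ℂ) : Prop :=
  ∃ s : PowerSeries ℂ, s.order = 1 ∧ laurentSubst A.1 s = B.1 ∧ laurentSubst A.2 s = B.2

/-- `A` is reducible if it is equivalent to a pair in `ℂ((t^m))²` for some `m > 1`. -/
def IsReducible (A : LaurentSeries ℂ × LaurentSeries ℂ) : Prop :=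
  ∃ m : ℕ, 1 < m ∧ ∃ B, Equivalent A B ∧
    (∀ j ∈ B.1.support, (m : ℤ) ∣ j) ∧ (∀ j ∈ B.2.support, (m : ℤ) ∣ j)

/-- The irreducible formal parametrizations centered at `(y₀, p₀)`; places are their classes. -/
def irreducibleParametrizations (F : ℂ[X][Y]) (y₀ : ℂ) (p₀ : OnePoint ℂ) :
    Set (LaurentSeries ℂ × LaurentSeries ℂ) :=
  {A | IsParametrization F y₀ p₀ A ∧ ¬ IsReducible A}

/-- `A = (y₀ + t^k, b(t))` with `k ≥ 1`. -/
def IsClassical (y₀ : ℂ) (A : LaurentSeries ℂ × LaurentSeries ℂ) : Prop :=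
  ∃ k : ℕ, 0 < k ∧ A.1 = HahnSeries.C y₀ + HahnSeries.single (k : ℤ) 1

/-- `R` consists of exactly one classical Puiseux parametrization from every place centered at
`(y₀, p₀)`. -/
def IsPlaceRepresentatives (F : ℂ[X][Y]) (y₀ : ℂ) (p₀ : OnePoint ℂ)
    (R : Set (LaurentSeries ℂ × LaurentSeries ℂ)) : Prop :=
  (∀ A ∈ R, A ∈ irreducibleParametrizations F y₀ p₀ ∧ IsClassical y₀ A) ∧
    ∀ A ∈ irreducibleParametrizations F y₀ p₀, ∃! B, B ∈ R ∧ Equivalent A B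

/-! ### Algorithm PuiseuxSolve at a given initial tuple -/

/-- The pair `(a, b̂)`, where `b̂` consists of the first `N` terms of `b`, counted from its order. -/
def truncateParametrization (N : ℕ) (A : LaurentSeries ℂ × LaurentSeries ℂ) :
    LaurentSeries ℂ × LaurentSeries ℂ :=
  (A.1, HahnSeries.truncLT (A.2.order + (N : ℤ)) A.2)

/-- The associated differential equation `a'(s(t)) s'(t) = n t^{n-1} b(s(t))`. -/
def AssociatedEquation (A : LaurentSeries ℂ × LaurentSeries ℂ) (n : ℕ) (s : PowerSeries ℂ) :
    Prop :=
  laurentSubst (LaurentSeries.derivative ℂ A.1) s *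
      HahnSeries.ofPowerSeries ℤ ℂ (PowerSeries.derivative ℂ s) =
    HahnSeries.C (n : ℂ) * HahnSeries.single ((n : ℤ) - 1) 1 * laurentSubst A.2 s

/-- The first `N` terms of `a(ŝ(x^{1/n}))`, where `a = y₀ + O(t^k)`: the constant term `y₀` and the
terms in `x^{j/n}` for `k ≤ j < k + N`. -/
def outputTerms (N k n : ℕ) (a : LaurentSeries ℂ) (shat : PowerSeries ℂ) : HahnSeries ℚ ℂ :=
  ∑ j ∈ Finset.range (k + N),
    HahnSeries.single ((j : ℚ) / (n : ℚ)) ((laurentSubst a shat).coeff (j : ℤ))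

/-- The truncations computed from one truncated parametrization `(â, b̂)` with
`k = ord_t (â - y₀)`: none unless `n = k - ord_t b̂ ≥ 1`, and in this case one for each solution `s`
of order one of the associated differential equation, from the first `N` terms of `s`. -/
def outputOfTruncation (N : ℕ) (y₀ : ℂ) (A : LaurentSeries ℂ × LaurentSeries ℂ) :
    Set (HahnSeries ℚ ℂ) :=
  {yhat | ∃ k n : ℕ, 0 < n ∧ (A.1 - HahnSeries.C y₀).order = (k : ℤ) ∧
    (n : ℤ) = (k : ℤ) - A.2.order ∧
    ∃ s : PowerSeries ℂ, s.order = 1 ∧ AssociatedEquation A n s ∧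
      yhat = outputTerms N k n A.1 (PowerSeries.trunc (N + 1) s : Polynomial ℂ)}

/-- The output of the algorithm with initial tuple `(y₀, p₀)`, where `R` is the system of classical
Puiseux parametrizations that it uses. -/
def puiseuxSolve (F : ℂ[X][Y]) (y₀ : ℂ) (p₀ : OnePoint ℂ)
    (R : Set (LaurentSeries ℂ × LaurentSeries ℂ)) : Set (HahnSeries ℚ ℂ) :=
  {yhat |
    (OnCurve F y₀ p₀ ∧ ¬ IsCritical F y₀ p₀ ∧ ∃ q : ℂ, p₀ = (q : OnePoint ℂ) ∧
        yhat = HahnSeries.C y₀ + HahnSeries.single (1 : ℚ) q) ∨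
    (IsCritical F y₀ p₀ ∧ p₀ = ((0 : ℂ) : OnePoint ℂ) ∧ yhat = HahnSeries.C y₀) ∨
    (IsCritical F y₀ p₀ ∧ ∃ A ∈ truncateParametrization (truncOrder F) '' R,
        yhat ∈ outputOfTruncation (truncOrder F) y₀ A)}

end

end AutonomousODE

open AutonomousODE

namespace PuiseuxTruncation

open PowerSeries

/-! ### Power series of order one: congruences, roots and compositional inverses -/

section PowerSeriesTools

variable {K : Type*} [Field K]

/-! Let y be a non-constant solution with denominator L, written y = Z(t) with x = t^L, and let Z =
y₀ + W^K with W of order one and compositional inverse S. In the coordinate τ = W(t) the pair (y,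
y') takes the classical form (y₀ + τ^K, P(τ)), where P is a root in ℂ((τ)) of F(y₀ + τ^K, p). Since
x = S(τ)^L, the chain rule reads (S^L)' · P = K τ^(K-1). Once the leading coefficient of W is fixed,
P therefore determines S, hence Z (`IsLocalInverse.ode`, `IsLocalInverse.eq_of_P_eq`). Solutions can
thus be separated by separating roots of a polynomial, which is measured by a discriminant.

Injectivity at critical points (`close_solutions_eq`). Take two different non-constant solutions of
ramification orders n₁ ≤ n₂ with the same truncation, and put L = n₁n₂. The truncations force a
common K, divisible by n₁, and Z₁ ≡ Z₂ modulo t^(K + N n₁). Hence P₁ and P₂, after their poles are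
cleared, agree modulo τ^(N n₁). The same holds after τ ↦ ζτ for each K-th root of unity ζ. A
rotation fixing P₂ is a symmetry of Z₂ and so has order at most n₁; this gives K/n₁ distinct
conjugates of P₂, each close to a different root of the same polynomial. Then τ^(NK) divides the
discriminant of F(y₀ + τ^K, p), which is disc_p(F) evaluated at y₀ + τ^K (`prod_dvd_discr`,
`card_mul_le_of_close_roots`). As F is square-free this discriminant is non-zero, and disc_p(F) has
degree at most 2(deg_p F - 1) deg_y F, so N is at most that number: a contradiction. Summing over
conjugates is what removes the ramification from the bound.

Image at critical points. A solution in the variable x^(1/n), with n its ramification order, is an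
irreducible parametrization (`solution_mem_irreducibleParametrizations`), so it is equivalent to a
chosen (y₀ + t^k, b) by some s; that s solves the associated equation. Conversely a solution s of
this equation turns an irreducible parametrization into a solution with ramification order exactly
n. The equation separates: it says G(s) = t^n for a primitive G with G' = k t^(n-1)/u, where b = t^r
u. Changing u modulo t^N changes G modulo t^(n+N), its n-th root modulo t^(N+1), and so s modulo
t^(N+1) (`exists_close_associatedEquation`). Then y₀ + s^k is unchanged below t^(k+N), which is
exactly the output.

At a non-critical curve point F(y, p) = 0 has a simple non-zero root p, so there is exactly one
solution, y₀ + p₀x + ⋯. Off the curve both sets are empty. -/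

lemma order_eq_one_iff {s : PowerSeries K} :
    s.order = 1 ↔ constantCoeff s = 0 ∧ coeff 1 s ≠ 0 := by
  rw [show (1 : ℕ∞) = ((1 : ℕ) : ℕ∞) from rfl, order_eq_nat]
  constructor
  · rintro ⟨h1, h0⟩
    exact ⟨by simpa using h0 0 zero_lt_one, h1⟩
  · rintro ⟨h0, h1⟩
    refine ⟨h1, fun i hi => ?_⟩
    obtain rfl : i = 0 := by omega
    simpa using h0

lemma hasSubst_of_order_one {s : PowerSeries K} (hs : s.order = 1) : HasSubst s :=
  HasSubst.of_constantCoeff_zero' (order_eq_one_iff.1 hs).1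

lemma subst_one' {s : PowerSeries K} (hs : HasSubst s) : (1 : PowerSeries K).subst s = 1 := by
  rw [← coe_substAlgHom hs, map_one]

lemma subst_C' {s : PowerSeries K} (c : K) : (C c : PowerSeries K).subst s = C c := subst_C c

lemma X_dvd_of_order_one {s : PowerSeries K} (hs : s.order = 1) : (X : PowerSeries K) ∣ s :=
  X_dvd_iff.2 (order_eq_one_iff.1 hs).1

lemma constantCoeff_subst_of_zero {f s : PowerSeries K} (hs : constantCoeff s = 0) :
    constantCoeff (f.subst s) = constantCoeff f := by
  have hs' := HasSubst.of_constantCoeff_zero' hs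
  have h : f = C (constantCoeff f) + (f - C (constantCoeff f)) := by ring
  have h2 : (X : PowerSeries K) ∣ f - C (constantCoeff f) := X_dvd_iff.2 (by simp)
  obtain ⟨g, hg⟩ := h2
  rw [hg] at h
  conv_lhs => rw [h, subst_add hs', subst_mul hs', subst_X hs', subst_C']
  simp [hs]

lemma dvd_subst_sub_of_dvd_left {f g s : PowerSeries K} {m : ℕ} (hs : constantCoeff s = 0)
    (h : X ^ m ∣ f - g) : X ^ m ∣ f.subst s - g.subst s := by
  have hs' := HasSubst.of_constantCoeff_zero' hs
  obtain ⟨u, hu⟩ := h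
  rw [← subst_sub hs', hu, subst_mul hs', subst_pow hs', subst_X hs']
  exact Dvd.dvd.mul_right (pow_dvd_pow_of_dvd (X_dvd_iff.2 hs) m) _

lemma dvd_subst_sub_of_dvd_right {f s r : PowerSeries K} {m : ℕ} (hs : constantCoeff s = 0)
    (hr : constantCoeff r = 0) (h : X ^ m ∣ s - r) : X ^ m ∣ f.subst s - f.subst r := by
  have hs' := HasSubst.of_constantCoeff_zero' hs
  have hr' := HasSubst.of_constantCoeff_zero' hr
  rw [X_pow_dvd_iff]
  intro e he
  rw [map_sub, coeff_subst' hs', coeff_subst' hr', sub_eq_zero]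
  refine finsum_congr fun d => ?_
  have hd : X ^ m ∣ s ^ d - r ^ d := h.trans (sub_dvd_pow_sub_pow s r d)
  have := X_pow_dvd_iff.1 hd e he
  rw [map_sub, sub_eq_zero] at this
  rw [this]

lemma exists_subst_inverse {s : PowerSeries K} (hs : s.order = 1) :
    ∃ r : PowerSeries K, r.order = 1 ∧ coeff 1 r = (coeff 1 s)⁻¹ ∧ s.subst r = X ∧
      r.subst s = X := by
  obtain ⟨h0, h1⟩ := order_eq_one_iff.1 hs
  have hu : IsUnit (coeff 1 s) := isUnit_iff_ne_zero.2 h1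
  have hc : coeff 1 (s.substInvOfIsUnit hu) = (coeff 1 s)⁻¹ := by
    simp [coeff_one_substInvOfIsUnit]
  refine ⟨s.substInvOfIsUnit hu, order_eq_one_iff.2 ⟨by simp, ?_⟩, hc,
    subst_substInvOfIsUnit_right s h0 hu, subst_substInvOfIsUnit_left s h0 hu⟩
  rw [hc]; exact inv_ne_zero h1

lemma coeff_one_X_mul (w : PowerSeries K) : coeff 1 (X * w) = constantCoeff w := by
  simp

lemma order_one_subst {s r : PowerSeries K} (hs : s.order = 1) (hr : r.order = 1) :
    PowerSeries.order (s.subst r) = 1 ∧ coeff 1 (s.subst r) = coeff 1 s * coeff 1 r := by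
  obtain ⟨h0, h1⟩ := order_eq_one_iff.1 hs
  obtain ⟨k0, k1⟩ := order_eq_one_iff.1 hr
  have hc : coeff 1 (s.subst r) = coeff 1 s * coeff 1 r := by
    obtain ⟨u, rfl⟩ := X_dvd_iff.2 h0
    obtain ⟨v, hv⟩ := X_dvd_iff.2 k0
    have hr' := hasSubst_of_order_one hr
    rw [subst_mul hr', subst_X hr']
    have e : r * u.subst r = X * (v * u.subst r) := by
      rw [← mul_assoc, ← hv]
    rw [e]
    rw [coeff_one_X_mul, coeff_one_X_mul, map_mul, constantCoeff_subst_of_zero k0, hv,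
      coeff_one_X_mul, mul_comm]
  refine ⟨order_eq_one_iff.2 ⟨?_, ?_⟩, hc⟩
  · rw [constantCoeff_subst_of_zero k0, h0]
  · rw [hc]; exact mul_ne_zero h1 k1

lemma subst_subst {f s r : PowerSeries K} (hs : s.order = 1) (hr : r.order = 1) :
    PowerSeries.subst r (f.subst s) = f.subst (s.subst r : PowerSeries K) :=
  subst_comp_subst_apply (hasSubst_of_order_one hs) (hasSubst_of_order_one hr) f

/-- Compositional inverses of congruent series are congruent. -/
lemma inverse_congr {s₁ s₂ r₁ r₂ : PowerSeries K} {m : ℕ} (hs₁ : s₁.order = 1)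
    (hr₂ : r₂.order = 1) (h₁ : r₁.subst s₁ = X)
    (h₂ : s₂.subst r₂ = X) (h : X ^ m ∣ s₁ - s₂) : X ^ m ∣ r₁ - r₂ := by
  have a : X ^ m ∣ s₁.subst r₂ - X := by
    have := dvd_subst_sub_of_dvd_left (order_eq_one_iff.1 hr₂).1 h
    rwa [h₂] at this
  have b := dvd_subst_sub_of_dvd_right (f := r₁)
    (order_eq_one_iff.1 (order_one_subst hs₁ hr₂).1).1 (by simp) a
  rw [X_subst, ← subst_subst hs₁ hr₂, h₁, subst_X (hasSubst_of_order_one hr₂)] at b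
  exact (dvd_sub_comm).1 b

lemma eq_of_forall_X_pow_dvd_sub {u v : PowerSeries K} (h : ∀ A : ℕ, X ^ A ∣ u - v) : u = v := by
  ext i
  have := X_pow_dvd_iff.1 (h (i + 1)) i (Nat.lt_succ_self i)
  rwa [map_sub, sub_eq_zero] at this

/-! ### Characteristic zero: roots and primitives of power series. -/

variable [CharZero K]

/-- The cofactor of u - v in u^n - v^n has constant coefficient n · u(0)^(n-1), so it is a unit in
characteristic zero. -/
lemma dvd_sub_of_dvd_pow_sub_pow {u v : PowerSeries K} {n A : ℕ} (hn : 0 < n)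
    (hc : constantCoeff u = constantCoeff v) (h0 : constantCoeff u ≠ 0)
    (h : X ^ A ∣ u ^ n - v ^ n) : X ^ A ∣ u - v := by
  rw [← (Commute.all u v).geom_sum₂_mul] at h
  have hu : IsUnit (∑ i ∈ Finset.range n, u ^ i * v ^ (n - 1 - i)) := by
    rw [isUnit_iff_constantCoeff, isUnit_iff_ne_zero, map_sum]
    have : ∀ i ∈ Finset.range n, constantCoeff (u ^ i * v ^ (n - 1 - i))
        = constantCoeff u ^ (n - 1) := by
      intro i hi
      rw [Finset.mem_range] at hi
      rw [map_mul, map_pow, map_pow, ← hc, ← pow_add]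
      congr 1; omega
    rw [Finset.sum_congr rfl this, Finset.sum_const, Finset.card_range, nsmul_eq_mul]
    exact mul_ne_zero (by exact_mod_cast hn.ne') (pow_ne_zero _ h0)
  exact (hu.dvd_mul_left).1 h

/-- The power series with given `K`-th power and given leading coefficient are congruent if
their powers are. -/
lemma order_one_congr_of_pow_congr {s r : PowerSeries K} {n A : ℕ} (hn : 0 < n)
    (hs : s.order = 1) (hr : r.order = 1) (hc : coeff 1 s = coeff 1 r)
    (h : X ^ (n + A) ∣ s ^ n - r ^ n) : X ^ (A + 1) ∣ s - r := by
  obtain ⟨u, rfl⟩ := X_dvd_of_order_one hs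
  obtain ⟨v, rfl⟩ := X_dvd_of_order_one hr
  have h0 := (order_eq_one_iff.1 hs).2
  rw [coeff_one_X_mul] at h0
  rw [coeff_one_X_mul, coeff_one_X_mul] at hc
  -- Removing X from s and r costs n orders in the n-th powers; one order returns when X is put
  -- back.
  rw [mul_pow, mul_pow, ← mul_sub, pow_add] at h
  have := dvd_sub_of_dvd_pow_sub_pow hn hc h0
    ((mul_dvd_mul_iff_left (pow_ne_zero n X_ne_zero)).1 h)
  rw [← mul_sub, pow_succ']
  exact mul_dvd_mul_left _ this

lemma order_one_eq_of_pow_eq {s r : PowerSeries K} {n : ℕ} (hn : 0 < n)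
    (hs : s.order = 1) (hr : r.order = 1) (hc : coeff 1 s = coeff 1 r)
    (h : s ^ n = r ^ n) : s = r :=
  eq_of_forall_X_pow_dvd_sub fun A => (pow_dvd_pow X (Nat.le_succ A)).trans
    (order_one_congr_of_pow_congr (A := A) hn hs hr hc (by simp [h]))

/-- Roots of power series with nonzero constant coefficient. -/
lemma exists_pow_eq {u : PowerSeries K} {n : ℕ} (hn : 0 < n) {v : K}
    (hv : v ^ n = constantCoeff u) (h0 : v ≠ 0) :
    ∃ w : PowerSeries K, w ^ n = u ∧ constantCoeff w = v := by
  -- Hensel's lemma for T^n - u in the X-adically complete ring: v is a simple root modulo X,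
  -- because n v^(n-1) ≠ 0.
  have H := (IsAdicComplete.henselianRing (PowerSeries K) (Ideal.span {X})).is_henselian
    (Polynomial.X ^ n - Polynomial.C u) (Polynomial.monic_X_pow_sub_C u hn.ne') (C v)
    (by rw [Ideal.mem_span_singleton, X_dvd_iff]; simp [hv])
    (by
      refine IsUnit.map _ ?_
      rw [isUnit_iff_constantCoeff, isUnit_iff_ne_zero]
      simp [Polynomial.derivative_X_pow, hn.ne', h0])
  obtain ⟨w, hw, hc⟩ := H
  refine ⟨w, by simpa [Polynomial.IsRoot, sub_eq_zero] using hw, ?_⟩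
  rw [Ideal.mem_span_singleton, X_dvd_iff] at hc
  simpa [sub_eq_zero] using hc

/-- Prescribing γ selects one of the n branches of the root; two series can only be compared through
their roots on the same branch. -/
lemma exists_order_one_pow_eq {f : PowerSeries K} {n : ℕ} (hn : 0 < n) {γ : K} (hγ : γ ≠ 0)
    (hf : X ^ n ∣ f) (hc : γ ^ n = coeff n f) :
    ∃ s : PowerSeries K, s.order = 1 ∧ coeff 1 s = γ ∧ s ^ n = f := by
  obtain ⟨u, rfl⟩ := hf
  obtain ⟨w, hw, hwc⟩ := exists_pow_eq (u := u) hn (v := γ)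
    (by rw [hc]; simpa using coeff_X_pow_mul u n 0) hγ
  have h1 : coeff 1 (X * w) = γ := by rw [coeff_one_X_mul, hwc]
  refine ⟨X * w, order_eq_one_iff.2 ⟨by simp, h1 ▸ hγ⟩, h1, by rw [mul_pow, hw]⟩

/-- A series without constant term whose derivative is divisible by `X ^ m` is divisible by
`X ^ (m + 1)`. -/
lemma dvd_of_dvd_derivative {f : PowerSeries K} {m : ℕ} (h0 : constantCoeff f = 0)
    (h : X ^ m ∣ derivative K f) : X ^ (m + 1) ∣ f := by
  rw [X_pow_dvd_iff] at h ⊢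
  intro i hi
  cases i with
  | zero => simpa using h0
  | succ i =>
    have := h i (by omega)
    rw [coeff_derivative] at this
    exact (mul_eq_zero.1 this).resolve_right (by exact_mod_cast Nat.succ_ne_zero i)

lemma exists_derivative_eq (f : PowerSeries K) :
    ∃ g : PowerSeries K, derivative K g = f ∧ constantCoeff g = 0 := by
  refine ⟨mk fun i => coeff (i - 1) f / i, ?_, ?_⟩
  · ext i
    rw [coeff_derivative, coeff_mk]
    have : ((i : K) + 1) ≠ 0 := by exact_mod_cast Nat.succ_ne_zero i
    simp [this]
  · rw [← coeff_zero_eq_constantCoeff_apply, coeff_mk]; simp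

end PowerSeriesTools

end PuiseuxTruncation

namespace PuiseuxTruncation
open PowerSeries
noncomputable section

/-! ### Substitution into Laurent series -/

/-- Composition with a power series of order one, as a map into Laurent series. -/
def substToLaurent {s : PowerSeries ℂ} (hs : s.order = 1) :
    PowerSeries ℂ →+* LaurentSeries ℂ :=
  (HahnSeries.ofPowerSeries ℤ ℂ).comp
    (substAlgHom (R := ℂ) (hasSubst_of_order_one hs) : PowerSeries ℂ →+* PowerSeries ℂ)

lemma substToLaurent_apply {s : PowerSeries ℂ} (hs : s.order = 1) (f : PowerSeries ℂ) :
    substToLaurent hs f = HahnSeries.ofPowerSeries ℤ ℂ (f.subst s) := by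
  simp only [substToLaurent, RingHom.comp_apply, RingHom.coe_coe,
    coe_substAlgHom (hasSubst_of_order_one hs)]

lemma substToLaurent_injective {s : PowerSeries ℂ} (hs : s.order = 1) :
    Function.Injective (substToLaurent hs) := by
  obtain ⟨r, hr, -, h, -⟩ := exists_subst_inverse hs
  intro f g hfg
  rw [substToLaurent_apply, substToLaurent_apply] at hfg
  have := congrArg (PowerSeries.subst r) (HahnSeries.ofPowerSeries_injective hfg)
  rwa [subst_subst hs hr, subst_subst hs hr, h, X_subst, X_subst] at this

/-- The ring endomorphism `f ↦ f(s)` of the field of Laurent series, for `s` of order one. -/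
def laurentSubstRingHom {s : PowerSeries ℂ} (hs : s.order = 1) :
    LaurentSeries ℂ →+* LaurentSeries ℂ :=
  IsFractionRing.lift (substToLaurent_injective hs)

lemma laurentSubstRingHom_coe {s : PowerSeries ℂ} (hs : s.order = 1) (f : PowerSeries ℂ) :
    laurentSubstRingHom hs (HahnSeries.ofPowerSeries ℤ ℂ f) =
      HahnSeries.ofPowerSeries ℤ ℂ (f.subst s) := by
  rw [← substToLaurent_apply hs]
  exact IsFractionRing.lift_algebraMap (substToLaurent_injective hs) f

/-- Splitting off the order makes multiplicativity invisible; identification with the extension of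
composition to the fraction field makes substitution a field homomorphism. -/
lemma laurentSubst_eq {s : PowerSeries ℂ} (hs : s.order = 1) (f : LaurentSeries ℂ) :
    laurentSubst f s = laurentSubstRingHom hs f := by
  conv_rhs => rw [← LaurentSeries.single_order_mul_powerSeriesPart f]
  rw [map_mul, laurentSubstRingHom_coe, laurentSubst]
  congr 1
  rw [show HahnSeries.single f.order (1 : ℂ) = HahnSeries.single 1 1 ^ f.order from
    RatFunc.single_zpow f.order, map_zpow₀]
  congr 1
  rw [← PowerSeries.coe_X, laurentSubstRingHom_coe, subst_X (hasSubst_of_order_one hs)]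

lemma laurentSubstRingHom_C {s : PowerSeries ℂ} (hs : s.order = 1) (c : ℂ) :
    laurentSubstRingHom hs (HahnSeries.C c) = HahnSeries.C c := by
  rw [← HahnSeries.ofPowerSeries_C, laurentSubstRingHom_coe, subst_C']

lemma algebraMap_hahnSeries {Γ : Type*} [Semiring Γ] [PartialOrder Γ] [IsStrictOrderedRing Γ]
    (c : ℂ) : algebraMap ℂ (HahnSeries Γ ℂ) c = HahnSeries.C c := by
  rw [HahnSeries.algebraMap_apply']
  simp

/-- `f ↦ f(s)` as an algebra homomorphism. -/
def laurentSubstHom {s : PowerSeries ℂ} (hs : s.order = 1) :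
    LaurentSeries ℂ →ₐ[ℂ] LaurentSeries ℂ :=
  { laurentSubstRingHom hs with
    commutes' := fun c => by
      rw [algebraMap_hahnSeries]
      exact laurentSubstRingHom_C hs c }

lemma laurentSubst_eq_hom {s : PowerSeries ℂ} (hs : s.order = 1) (f : LaurentSeries ℂ) :
    laurentSubst f s = laurentSubstHom hs f := laurentSubst_eq hs f

lemma laurentSubst_coe {s : PowerSeries ℂ} (hs : s.order = 1) (f : PowerSeries ℂ) :
    laurentSubst (HahnSeries.ofPowerSeries ℤ ℂ f) s =
      HahnSeries.ofPowerSeries ℤ ℂ (f.subst s) := by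
  rw [laurentSubst_eq hs, laurentSubstRingHom_coe]

/-- Both sides are ring homomorphisms out of the fraction field of the power series ring, so
agreement on power series suffices. -/
lemma laurentSubst_laurentSubst {s r : PowerSeries ℂ} (hs : s.order = 1) (hr : r.order = 1)
    (f : LaurentSeries ℂ) :
    laurentSubst (laurentSubst f s) r = laurentSubst f (s.subst r : PowerSeries ℂ) := by
  have hsr := (order_one_subst hs hr).1
  rw [laurentSubst_eq hs, laurentSubst_eq hr, laurentSubst_eq hsr]
  have : (laurentSubstRingHom hr).comp (laurentSubstRingHom hs) = laurentSubstRingHom hsr := by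
    refine IsLocalization.ringHom_ext (nonZeroDivisors (PowerSeries ℂ)) (RingHom.ext fun g => ?_)
    change laurentSubstRingHom hr (laurentSubstRingHom hs (HahnSeries.ofPowerSeries ℤ ℂ g)) =
      laurentSubstRingHom hsr (HahnSeries.ofPowerSeries ℤ ℂ g)
    rw [laurentSubstRingHom_coe, laurentSubstRingHom_coe, laurentSubstRingHom_coe,
      subst_subst hs hr]
  exact RingHom.congr_fun this f

lemma laurentSubst_X (f : LaurentSeries ℂ) : laurentSubst f (X : PowerSeries ℂ) = f := by
  have hX : (X : PowerSeries ℂ).order = 1 := order_X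
  rw [laurentSubst_eq hX]
  have : laurentSubstRingHom hX = RingHom.id _ := by
    refine IsLocalization.ringHom_ext (nonZeroDivisors (PowerSeries ℂ)) (RingHom.ext fun g => ?_)
    change laurentSubstRingHom hX (HahnSeries.ofPowerSeries ℤ ℂ g) = HahnSeries.ofPowerSeries ℤ ℂ g
    rw [laurentSubstRingHom_coe, X_subst]
  exact RingHom.congr_fun this f

lemma laurentSubst_cancel {s r : PowerSeries ℂ} (hs : s.order = 1) (hr : r.order = 1)
    (h : s.subst r = (X : PowerSeries ℂ)) (f : LaurentSeries ℂ) :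
    laurentSubst (laurentSubst f s) r = f := by
  rw [laurentSubst_laurentSubst hs hr, h, laurentSubst_X]

/-! ### Values at zero -/

lemma coeff_ofPowerSeries_nat (f : PowerSeries ℂ) (n : ℕ) :
    (HahnSeries.ofPowerSeries ℤ ℂ f).coeff (n : ℤ) = coeff n f := by
  simp

lemma coeff_ofPowerSeries_neg (f : PowerSeries ℂ) {q : ℤ} (hq : q < 0) :
    (HahnSeries.ofPowerSeries ℤ ℂ f).coeff q = 0 := by
  have := PowerSeries.coeff_coe f q
  simpa [hq] using this

lemma valueAtZero_coe (f : PowerSeries ℂ) :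
    valueAtZero (HahnSeries.ofPowerSeries ℤ ℂ f) = ((constantCoeff f : ℂ) : OnePoint ℂ) := by
  rw [valueAtZero, if_neg]
  · have := coeff_ofPowerSeries_nat f 0
    simp only [Nat.cast_zero] at this
    rw [this, coeff_zero_eq_constantCoeff_apply]
  · rintro ⟨q, hq, h⟩
    exact h (coeff_ofPowerSeries_neg f hq)

lemma exists_coe_of_coeff_neg {f : LaurentSeries ℂ} (h : ∀ q < 0, f.coeff q = 0) :
    ∃ g : PowerSeries ℂ, HahnSeries.ofPowerSeries ℤ ℂ g = f := by
  refine ⟨PowerSeries.mk fun n => f.coeff n, ?_⟩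
  ext q
  rcases lt_or_ge q 0 with hq | hq
  · rw [coeff_ofPowerSeries_neg _ hq, h q hq]
  · lift q to ℕ using hq
    rw [coeff_ofPowerSeries_nat, coeff_mk]

lemma exists_coe_of_valueAtZero {f : LaurentSeries ℂ} {c : ℂ}
    (h : valueAtZero f = (c : OnePoint ℂ)) :
    ∃ g : PowerSeries ℂ, HahnSeries.ofPowerSeries ℤ ℂ g = f ∧ constantCoeff g = c := by
  have h' : ∀ q < 0, f.coeff q = 0 := by
    by_contra! hq
    rw [valueAtZero, if_pos hq] at h
    exact OnePoint.infty_ne_coe c h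
  obtain ⟨g, rfl⟩ := exists_coe_of_coeff_neg h'
  refine ⟨g, rfl, ?_⟩
  rw [valueAtZero_coe] at h
  exact OnePoint.coe_injective h

lemma valueAtZero_eq_infty_iff {f : LaurentSeries ℂ} :
    valueAtZero f = OnePoint.infty ↔ ¬ ∃ g : PowerSeries ℂ, HahnSeries.ofPowerSeries ℤ ℂ g = f := by
  constructor
  · rintro h ⟨g, rfl⟩
    rw [valueAtZero_coe] at h
    exact OnePoint.coe_ne_infty _ h
  · intro h
    by_contra hne
    obtain ⟨c, hc⟩ := OnePoint.ne_infty_iff_exists.1 hne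
    obtain ⟨g, hg, -⟩ := exists_coe_of_valueAtZero hc.symm
    exact h ⟨g, hg⟩

lemma valueAtZero_laurentSubst {s : PowerSeries ℂ} (hs : s.order = 1) (f : LaurentSeries ℂ) :
    valueAtZero (laurentSubst f s) = valueAtZero f := by
  by_cases h : ∃ g : PowerSeries ℂ, HahnSeries.ofPowerSeries ℤ ℂ g = f
  · obtain ⟨g, rfl⟩ := h
    rw [laurentSubst_coe hs, valueAtZero_coe, valueAtZero_coe,
      constantCoeff_subst_of_zero (order_eq_one_iff.1 hs).1]
  · rw [valueAtZero_eq_infty_iff.2 h, valueAtZero_eq_infty_iff]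
    rintro ⟨g, hg⟩
    obtain ⟨r, hr, -, h1, -⟩ := exists_subst_inverse hs
    refine h ⟨g.subst r, ?_⟩
    rw [← laurentSubst_coe hr, hg, laurentSubst_cancel hs hr h1]

/-! ### Puiseux series with bounded denominator as Laurent series in `x^{1/n}` -/

/-- The inclusion `ℤ → (1/n) ℤ ⊆ ℚ`. -/
def divNat (n : ℕ) : ℤ →+ ℚ where
  toFun j := (j : ℚ) / n
  map_zero' := by simp
  map_add' a b := by push_cast; ring

lemma divNat_apply (n : ℕ) (j : ℤ) : divNat n j = (j : ℚ) / n := rfl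

lemma divNat_le_iff {n : ℕ} (hn : 0 < n) (a b : ℤ) : divNat n a ≤ divNat n b ↔ a ≤ b := by
  have : (0 : ℚ) < n := by exact_mod_cast hn
  rw [divNat_apply, divNat_apply, div_le_div_iff_of_pos_right this, Int.cast_le]

lemma divNat_injective {n : ℕ} (hn : 0 < n) : Function.Injective (divNat n) := fun a b h =>
  le_antisymm ((divNat_le_iff hn a b).1 h.le) ((divNat_le_iff hn b a).1 h.ge)

/-- The embedding of `ℂ((t))` into Puiseux series with `t ↦ x^{1/n}`. -/
def ramify {n : ℕ} (hn : 0 < n) : LaurentSeries ℂ →ₐ[ℂ] HahnSeries ℚ ℂ :=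
  { HahnSeries.embDomainRingHom (divNat n) (divNat_injective hn) (divNat_le_iff hn) with
    commutes' := fun c => by
      rw [algebraMap_hahnSeries, algebraMap_hahnSeries]
      exact HahnSeries.embDomainRingHom_C }

lemma ramify_coeff {n : ℕ} (hn : 0 < n) (Z : LaurentSeries ℂ) (j : ℤ) :
    (ramify hn Z).coeff ((j : ℚ) / n) = Z.coeff j :=
  HahnSeries.embDomain_coeff (f := ⟨⟨divNat n, divNat_injective hn⟩, divNat_le_iff hn _ _⟩)

lemma ramify_coeff_of_not {n : ℕ} (hn : 0 < n) (Z : LaurentSeries ℂ) {q : ℚ}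
    (hq : ¬ ∃ j : ℤ, q * n = j) : (ramify hn Z).coeff q = 0 := by
  refine HahnSeries.embDomain_of_notMem_range
    (f := ⟨⟨divNat n, divNat_injective hn⟩, divNat_le_iff hn _ _⟩) ?_
  rintro ⟨j, rfl⟩
  refine hq ⟨j, ?_⟩
  have : (n : ℚ) ≠ 0 := by exact_mod_cast hn.ne'
  change (j : ℚ) / n * n = j
  field_simp

lemma ramify_injective {n : ℕ} (hn : 0 < n) : Function.Injective (ramify hn) := by
  intro a b h
  ext j
  rw [← ramify_coeff hn, h, ramify_coeff]

lemma eq_div_of_mul_eq {n : ℕ} (hn : 0 < n) {q : ℚ} {j : ℤ} (h : q * n = j) : q = (j : ℚ) / n := by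
  have : (n : ℚ) ≠ 0 := by exact_mod_cast hn.ne'
  rw [← h]; field_simp

lemma ramify_ext {n : ℕ} (hn : 0 < n) {Z : LaurentSeries ℂ} {y : HahnSeries ℚ ℂ}
    (hy : HasDenominator y n) (h : ∀ j : ℤ, y.coeff ((j : ℚ) / n) = Z.coeff j) :
    ramify hn Z = y := by
  ext q
  by_cases hq : ∃ j : ℤ, q * n = j
  · obtain ⟨j, hj⟩ := hq
    rw [eq_div_of_mul_eq hn hj, ramify_coeff, h]
  · rw [ramify_coeff_of_not hn Z hq]
    by_contra hne
    exact hq (hy q (Ne.symm hne))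

lemma hasDenominator_ramify {n : ℕ} (hn : 0 < n) (Z : LaurentSeries ℂ) :
    HasDenominator (ramify hn Z) n := by
  intro q hq
  by_contra h
  exact hq (ramify_coeff_of_not hn Z h)

lemma exists_ramify_eq {n : ℕ} (hn : 0 < n) {y : HahnSeries ℚ ℂ} (hy : HasDenominator y n) :
    ∃ Z, ramify hn Z = y := by
  refine ⟨⟨fun j => y.coeff ((j : ℚ) / n), ?_⟩, ramify_ext hn hy fun j => rfl⟩
  -- A sequence of exponents j gives a sequence j/n in the support of y; the order embedding
  -- reflects its increasing pair back.
  have := y.isPWO_support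
  intro f
  obtain ⟨i, j, hij, hl⟩ := this fun i => ⟨divNat n (f i), (f i).2⟩
  exact ⟨i, j, hij, (divNat_le_iff hn _ _).1 hl⟩

lemma valueAtZero_ramify {n : ℕ} (hn : 0 < n) (Z : LaurentSeries ℂ) :
    valueAtZero (ramify hn Z) = valueAtZero Z := by
  have h0 : (ramify hn Z).coeff 0 = Z.coeff 0 := by simpa using ramify_coeff hn Z 0
  have hn' : (0 : ℚ) < n := by exact_mod_cast hn
  rw [valueAtZero, valueAtZero, h0]
  congr 1
  apply propext
  constructor
  · rintro ⟨q, hq, h⟩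
    obtain ⟨j, hj⟩ := hasDenominator_ramify hn Z q h
    rw [eq_div_of_mul_eq hn hj, ramify_coeff] at h
    refine ⟨j, ?_, h⟩
    have : (j : ℚ) < 0 := hj ▸ mul_neg_of_neg_of_pos hq hn'
    exact_mod_cast this
  · rintro ⟨j, hj, h⟩
    refine ⟨(j : ℚ) / n, div_neg_of_neg_of_pos (by exact_mod_cast hj) hn', ?_⟩
    rwa [ramify_coeff]

lemma ramify_C {n : ℕ} (hn : 0 < n) (c : ℂ) : ramify hn (HahnSeries.C c) = HahnSeries.C c :=
  HahnSeries.embDomainRingHom_C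

/-- The derivation `d/dx` in the variable `t = x^{1/n}`, i.e. `(1/n) t^{1-n} d/dt`. -/
def ramifiedDeriv (n : ℕ) (Z : LaurentSeries ℂ) : LaurentSeries ℂ :=
  HahnSeries.single (1 - (n : ℤ)) ((n : ℂ)⁻¹) * LaurentSeries.derivative ℂ Z

lemma derivative_coeff (Z : LaurentSeries ℂ) (j : ℤ) :
    (LaurentSeries.derivative ℂ Z).coeff j = ((j : ℂ) + 1) * Z.coeff (j + 1) := by
  rw [LaurentSeries.derivative_apply, LaurentSeries.hasseDeriv_coeff]
  simp

lemma derivative_coe' (f : PowerSeries ℂ) :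
    LaurentSeries.derivative ℂ (HahnSeries.ofPowerSeries ℤ ℂ f) =
      HahnSeries.ofPowerSeries ℤ ℂ (derivative ℂ f) := by
  ext j
  rw [derivative_coeff]
  rcases lt_or_ge j 0 with hj | hj
  · rw [coeff_ofPowerSeries_neg _ hj]
    rcases eq_or_ne j (-1) with rfl | h
    · simp
    · rw [coeff_ofPowerSeries_neg _ (by omega), mul_zero]
  · lift j to ℕ using hj
    rw [coeff_ofPowerSeries_nat, coeff_derivative, ← coeff_ofPowerSeries_nat]
    push_cast; ring

lemma coeff_single_mul' (a : ℤ) (c : ℂ) (Z : LaurentSeries ℂ) (j : ℤ) :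
    (HahnSeries.single a c * Z).coeff j = c * Z.coeff (j - a) := by
  have := HahnSeries.coeff_single_mul_add (r := c) (x := Z) (a := j - a) (b := a)
  rwa [sub_add_cancel] at this

lemma puiseuxDeriv_ramify {n : ℕ} (hn : 0 < n) (Z : LaurentSeries ℂ) :
    puiseuxDeriv (ramify hn Z) = ramify hn (ramifiedDeriv n Z) := by
  have hn' : (n : ℚ) ≠ 0 := by exact_mod_cast hn.ne'
  have hn'' : (n : ℂ) ≠ 0 := by exact_mod_cast hn.ne'
  symm
  refine ramify_ext hn ?_ ?_
  · intro q hq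
    have hq' : (ramify hn Z).coeff (q + 1) ≠ 0 := right_ne_zero_of_mul hq
    obtain ⟨j, hj⟩ := hasDenominator_ramify hn Z _ hq'
    refine ⟨j - n, ?_⟩
    push_cast
    rw [← hj]; ring
  · intro j
    change (((j : ℚ) / n + 1 : ℚ) : ℂ) * (ramify hn Z).coeff ((j : ℚ) / n + 1) = _
    have : (j : ℚ) / n + 1 = ((j + n : ℤ) : ℚ) / n := by push_cast; field_simp
    rw [this, ramify_coeff, ramifiedDeriv, coeff_single_mul', derivative_coeff]
    have e : j - (1 - (n : ℤ)) + 1 = j + n := by ring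
    rw [e]
    push_cast
    field_simp
    ring

end
end PuiseuxTruncation

namespace PuiseuxTruncation
noncomputable section

/-! ### Linear factors and the discriminant -/

section Discriminant

open Polynomial

variable {R : Type*} [CommRing R]

lemma natDegree_linear_factor {α : R} (hα : α ≠ 0) (β : R) :
    (C α * X - C β : R[X]).natDegree = 1 := by
  rw [natDegree_sub_C]; exact natDegree_C_mul_X α hα

lemma leadingCoeff_linear_factor {α : R} (hα : α ≠ 0) (β : R) :
    (C α * X - C β : R[X]).leadingCoeff = α := by
  rw [leadingCoeff, natDegree_linear_factor hα]
  simp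

lemma linear_factor_ne_zero {α : R} (hα : α ≠ 0) (β : R) : (C α * X - C β : R[X]) ≠ 0 := by
  rw [← leadingCoeff_ne_zero, leadingCoeff_linear_factor hα]; exact hα

lemma dvd_resultant_linear_linear (α β β' : R) :
    α * (β - β') ∣ resultant (C α * X - C β) (C α * X - C β') 1 1 := by
  rw [resultant, show (sylvester (C α * X - C β) (C α * X - C β') 1 1) = !![-β', -β; α, α] by
    ext i j
    fin_cases i <;> fin_cases j <;> simp [sylvester, Fin.addCases], Matrix.det_fin_two_of]
  exact dvd_of_eq (by ring)

/-- The degree is preserved, so φ commutes with Res(f, f') = ± lc(f) · disc(f), and φ(lc f) cancels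
in the domain. -/
lemma discr_map_of_leadingCoeff_ne_zero {S : Type*} [CommRing S] [IsDomain S] (φ : R →+* S) {f : R[X]}
    (hf : 0 < f.natDegree) (hlc : φ f.leadingCoeff ≠ 0) : discr (f.map φ) = φ (discr f) := by
  have hd : (f.map φ).natDegree = f.natDegree := natDegree_map_of_leadingCoeff_ne_zero φ hlc
  have hl : (f.map φ).leadingCoeff = φ f.leadingCoeff := leadingCoeff_map_of_leadingCoeff_ne_zero φ hlc
  have h1 := resultant_deriv (natDegree_pos_iff_degree_pos.1 hf)
  have h2 := resultant_deriv (f := f.map φ) (natDegree_pos_iff_degree_pos.1 (hd ▸ hf))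
  rw [derivative_map, hd, resultant_map_map, h1, hl] at h2
  simp only [map_mul, map_pow, map_neg, map_one] at h2
  rw [mul_assoc, mul_assoc] at h2
  exact (mul_left_cancel₀ hlc (mul_left_cancel₀ (pow_ne_zero _ (by simp)) h2)).symm

lemma discr_ne_zero_of_separable [CharZero R] {K : Type*} [Field K] [Algebra R K]
    [IsFractionRing R K] {f : R[X]} (hd : 0 < f.natDegree)
    (h : (f.map (algebraMap R K)).Separable) : discr f ≠ 0 := by
  have hinj := IsFractionRing.injective R K
  have : CharZero K := charZero_of_injective_algebraMap hinj
  intro h0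
  have h1 := resultant_deriv (natDegree_pos_iff_degree_pos.1 hd)
  rw [h0, mul_zero] at h1
  have h2 := congrArg (algebraMap R K) h1
  rw [← resultant_map_map, map_zero, ← derivative_map] at h2
  have hd' : (f.map (algebraMap R K)).natDegree = f.natDegree := natDegree_map_eq_of_injective hinj f
  have := resultant_ne_zero _ _ h
  rw [natDegree_derivative, hd'] at this
  exact this h2

variable [IsDomain R]

/-- The contribution of one pair of linear factors to the resultant of `f` and `f'`. -/
lemma dvd_resultant_linear_derivative {α : R} (hα : α ≠ 0) (β β' : R) {f : R[X]} (hf : f ≠ 0)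
    (h : (C α * X - C β) * (C α * X - C β') ∣ f) :
    α * (α * (β - β')) ∣ resultant (C α * X - C β) (derivative f) 1 (f.natDegree - 1) := by
  obtain ⟨g, rfl⟩ := h
  have hg : g ≠ 0 := right_ne_zero_of_mul hf
  have h1 := linear_factor_ne_zero hα β
  have h2 := linear_factor_ne_zero hα β'
  have d1 := natDegree_linear_factor hα β
  have d2 := natDegree_linear_factor hα β'
  set l := (C α * X - C β : R[X]) with hl
  set l' := (C α * X - C β' : R[X]) with hl'
  have d3 : (l' * g).natDegree = 1 + g.natDegree := by rw [natDegree_mul h2 hg, d2]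
  have d4 : (l * l' * g).natDegree - 1 = 1 + g.natDegree := by
    rw [mul_assoc, natDegree_mul h1 (mul_ne_zero h2 hg), d1, d3]; omega
  -- Modulo l the derivative is α l' g. The scalar gives one factor α, and Res(l, l') gives α(β -
  -- β').
  have e : derivative (l * l' * g) = C α * (l' * g) + l * derivative (l' * g) := by
    have : derivative l = C α := by simp [hl]
    rw [mul_assoc, derivative_mul, this]
  rw [d4, e, resultant_add_mul_right _ _ _ _ _ _ d1.le, resultant_C_mul_right, pow_one]
  · refine mul_dvd_mul_left _ ?_
    have := resultant_mul_right l l' g 1 d1.le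
    rw [d2] at this
    rw [this]
    exact Dvd.dvd.mul_right (dvd_resultant_linear_linear α β β') _
  · have := natDegree_derivative_le (l' * g)
    omega

/-- Modulo h the derivative of l h is l h', so the resultant contains Res(h, h') = ± lc(h) ·
disc(h). This lc(h) later pays for its share of the leading coefficient separating resultant and
discriminant. For constant h the resultant is a positive power of h. -/
lemma leadingCoeff_dvd_resultant_derivative [CharZero R] {l h : R[X]} (hl : 1 ≤ l.natDegree)
    (hd : 2 ≤ (l * h).natDegree) (h0 : h ≠ 0) :
    h.leadingCoeff ∣ resultant h (derivative (l * h)) h.natDegree ((l * h).natDegree - 1) := by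
  have l0 : l ≠ 0 := by rintro rfl; simp at hl
  have dm := natDegree_mul l0 h0
  rcases Nat.eq_zero_or_pos h.natDegree with hz | hz
  · rw [hz, resultant_zero_left_deg, leadingCoeff, hz]
    exact dvd_pow_self _ (by omega)
  · have e : derivative (l * h) = l * derivative h + h * derivative l := by
      rw [derivative_mul]; ring
    have dh : (derivative h).natDegree = h.natDegree - 1 :=
      natDegree_derivative _
    have dl := natDegree_derivative_le l
    rw [e, resultant_add_mul_right _ _ _ _ _ (by omega) le_rfl,
      show (l * h).natDegree - 1 = l.natDegree + (derivative h).natDegree by omega,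
      resultant_mul_right _ _ _ _ le_rfl, dh,
      resultant_deriv (natDegree_pos_iff_degree_pos.1 hz)]
    exact Dvd.intro_left ((resultant h l h.natDegree) * (-1) ^ (h.natDegree * (h.natDegree - 1) / 2)
      * h.discr) (by ring)

/-- If `f` is divisible by pairwise distinct linear factors `α p - β i`, each of which is close to
another linear factor of `f`, then the discriminant of `f` is highly divisible. -/
lemma prod_dvd_discr [CharZero R] {ι : Type*} (s : Finset ι) (hs : s.Nonempty) {α : R}
    (hα : α ≠ 0) (β β' : ι → R) {f : R[X]} (hf : f ≠ 0)
    (h1 : ∏ i ∈ s, (C α * X - C (β i)) ∣ f)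
    (h2 : ∀ i ∈ s, (C α * X - C (β i)) * (C α * X - C (β' i)) ∣ f) :
    ∏ i ∈ s, α * (β i - β' i) ∣ discr f := by
  have hdeg : 2 ≤ f.natDegree := by
    obtain ⟨i, hi⟩ := hs
    have := natDegree_le_of_dvd (h2 i hi) hf
    rwa [natDegree_mul (linear_factor_ne_zero hα _) (linear_factor_ne_zero hα _),
      natDegree_linear_factor hα, natDegree_linear_factor hα] at this
  have hpos : 0 < f.degree := natDegree_pos_iff_degree_pos.1 (by omega)
  have hR := resultant_deriv hpos
  have hlc : f.leadingCoeff ≠ 0 := leadingCoeff_ne_zero.2 hf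
  obtain ⟨h, hh⟩ := h1
  set l := ∏ i ∈ s, (C α * X - C (β i)) with hl
  have hl0 : l ≠ 0 := Finset.prod_ne_zero_iff.2 fun i _ => linear_factor_ne_zero hα _
  have hh0 : h ≠ 0 := by rintro rfl; exact hf (by rw [hh, mul_zero])
  have hld : l.natDegree = s.card := by
    rw [hl, natDegree_prod _ _ fun i _ => linear_factor_ne_zero hα _]
    simp [natDegree_linear_factor hα]
  have hllc : l.leadingCoeff = ∏ _i ∈ s, α := by
    rw [hl, leadingCoeff_prod]
    exact Finset.prod_congr rfl fun i _ => leadingCoeff_linear_factor hα _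
  have r1 : ∀ i ∈ s, α * (α * (β i - β' i)) ∣
      resultant (C α * X - C (β i)) (derivative f) 1 (f.natDegree - 1) := fun i hi =>
    dvd_resultant_linear_derivative hα _ _ hf (h2 i hi)
  have r2 : h.leadingCoeff ∣ resultant h (derivative f) h.natDegree (f.natDegree - 1) := by
    rw [hh]
    refine leadingCoeff_dvd_resultant_derivative ?_ (hh ▸ hdeg) hh0
    rw [hld]; exact hs.card_pos
  have r3 : resultant f (derivative f) f.natDegree (f.natDegree - 1) =
      (∏ i ∈ s, resultant (C α * X - C (β i)) (derivative f) 1 (f.natDegree - 1)) *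
        resultant h (derivative f) h.natDegree (f.natDegree - 1) := by
    have a := resultant_mul_left l h (derivative f) (f.natDegree - 1) (natDegree_derivative_le f)
    rw [← natDegree_mul hl0 hh0, ← hh] at a
    rw [a, hl, resultant_prod_left _ _ _ _ _ (natDegree_derivative_le f)]
    · simp only [natDegree_linear_factor hα]
    · rw [← leadingCoeff_prod]; exact leadingCoeff_ne_zero.2 hl0
  -- The extra α of each linear factor, together with lc(h), makes up lc(f), which cancels in Res(f,
  -- f') = ± lc(f) disc(f). Each i is charged to its own factor of Res(l, f'), so the β' may repeat
  -- or occur among the β.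
  have r4 : f.leadingCoeff * ∏ i ∈ s, α * (β i - β' i) ∣
      resultant f (derivative f) f.natDegree (f.natDegree - 1) := by
    rw [r3, hh, leadingCoeff_mul, hllc, ← hh, mul_right_comm, ← Finset.prod_mul_distrib]
    exact mul_dvd_mul (Finset.prod_dvd_prod_of_dvd _ _ r1) r2
  rw [hR, mul_assoc, mul_comm ((-1) ^ _), mul_assoc] at r4
  have r5 := (mul_dvd_mul_iff_left hlc).1 r4
  exact (IsUnit.dvd_mul_right ((isUnit_one.neg).pow _)).1 r5

end Discriminant

/-! ### The discriminant of F along y = y₀ + τ^k. -/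

section CurveDiscriminant

open Polynomial

/-- Every term of the Leibniz formula takes one factor from the constant row and n - 1 factors of
degree at most D. -/
lemma natDegree_det_le_of_const_row {n : ℕ} (M : Matrix (Fin n) (Fin n) ℂ[X]) (r : Fin n) (D : ℕ)
    (h0 : ∀ j, (M r j).natDegree = 0) (hD : ∀ i j, (M i j).natDegree ≤ D) :
    M.det.natDegree ≤ (n - 1) * D := by
  rw [Matrix.det_apply]
  refine natDegree_sum_le_of_forall_le _ _ fun σ _ => ?_
  refine (natDegree_smul_le _ _).trans ((natDegree_prod_le _ _).trans ?_)
  have : ∀ i ∈ Finset.univ, (M (σ i) i).natDegree ≤ if i = σ.symm r then 0 else D := by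
    intro i _
    split_ifs with h
    · rw [h, Equiv.apply_symm_apply, h0]
    · exact hD _ _
  refine (Finset.sum_le_sum this).trans ?_
  rw [Finset.sum_ite]
  simp [Finset.filter_ne', Finset.card_erase_of_mem]

lemma natDegree_coeff_le_degY (F : ℂ[X][Y]) (i : ℕ) : (F.coeff i).natDegree ≤ degY F := by
  by_cases h : i ∈ F.support
  · exact Finset.le_sup (f := fun i => (F.coeff i).natDegree) h
  · rw [notMem_support_iff.1 h]; simp

/-- Up to sign the discriminant is the determinant of the Sylvester matrix of F and ∂F/∂p, of size 2
deg_p F - 1, with the leading coefficient divided out of the last row. That row is constant in y,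
and 2(deg_p F - 1) rows of degree at most deg_y F remain: this is the origin of N. -/
lemma natDegree_discr_le (F : ℂ[X][Y]) (hd : 0 < F.natDegree) :
    (discr F).natDegree ≤ 2 * (degP F - 1) * degY F := by
  have hs : (F.sylvesterDeriv.det).natDegree ≤ (F.natDegree - 1 + F.natDegree - 1) * degY F := by
    refine natDegree_det_le_of_const_row _ ⟨2 * F.natDegree - 2, by omega⟩ _ ?_ ?_
    · intro j
      rw [sylvesterDeriv, dif_neg hd.ne', Matrix.updateRow_self]
      split_ifs
      · simp
      · exact natDegree_natCast _
      · simp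
    · intro i j
      rw [sylvesterDeriv, dif_neg hd.ne', Matrix.updateRow_apply]
      split_ifs
      · simp
      · rw [natDegree_natCast]; exact Nat.zero_le _
      · simp
      · induction j using Fin.addCases with
        | left j =>
          simp only [sylvester, Matrix.of_apply, Fin.addCases_left]
          split_ifs
          · exact natDegree_coeff_le_degY F _
          · simp
        | right j =>
          simp only [sylvester, Matrix.of_apply, Fin.addCases_right]
          split_ifs
          · rw [coeff_derivative]
            refine (natDegree_mul_le).trans ?_
            rw [show ((↑(↑i - ↑j : ℕ) : ℂ[X]) + 1) = ((↑i - ↑j + 1 : ℕ) : ℂ[X]) by push_cast; rfl,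
              natDegree_natCast, add_zero]
            exact natDegree_coeff_le_degY F _
          · simp
  have e : (F.natDegree - 1 + F.natDegree - 1) = 2 * (degP F - 1) := by rw [degP]; omega
  rw [e] at hs
  rw [discr]
  refine (natDegree_mul_le).trans ?_
  have : ((-1 : ℂ[X]) ^ (F.natDegree * (F.natDegree - 1) / 2)).natDegree = 0 := by
    refine Nat.le_zero.1 ((natDegree_pow_le).trans ?_)
    simp
  rw [this, add_zero]
  exact hs

/-- Gauss's lemma: a repeated factor over the fraction field, cleared of denominators and made
primitive, is a repeated factor over R. -/
lemma squarefree_map_fractionRing {R K : Type*} [CommRing R] [IsDomain R]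
    [NormalizedGCDMonoid R] [Field K] [Algebra R K] [IsFractionRing R K] {F : R[X]}
    (hF : Squarefree F) : Squarefree (F.map (algebraMap R K)) := by
  have hinj := IsFractionRing.injective R K
  intro G hG
  have hG0 : G ≠ 0 := by
    rintro rfl
    rw [mul_zero, zero_dvd_iff, Polynomial.map_eq_zero_iff hinj] at hG
    exact hF.ne_zero hG
  set G₀ := (IsLocalization.integerNormalization (nonZeroDivisors R) G).primPart with hG₀
  obtain ⟨c, c0, hc⟩ := IsLocalization.integerNormalization_spec (nonZeroDivisors R) G
  have hdvd : G₀.map (algebraMap R K) ∣ G := by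
    have h := Polynomial.map_dvd (algebraMap R K)
      (IsLocalization.integerNormalization (nonZeroDivisors R) G).primPart_dvd
    rw [hc, Algebra.smul_def, Polynomial.algebraMap_apply] at h
    refine (IsUnit.dvd_mul_left ?_).1 h
    rw [isUnit_C, isUnit_iff_ne_zero]
    exact fun h0 => nonZeroDivisors.ne_zero c0 ((map_eq_zero_iff _ hinj).1 h0)
  have h2 : G₀ * G₀ ∣ F := by
    refine IsPrimitive.dvd_of_fraction_map_dvd_fraction_map (K := K)
      ((isPrimitive_primPart _).mul (isPrimitive_primPart _)) ?_
    rw [Polynomial.map_mul]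
    exact (mul_dvd_mul hdvd hdvd).trans hG
  exact isUnit_or_eq_zero_of_isUnit_integerNormalization_primPart hG0 (hF _ h2)

/-- Over ℂ(y), which is perfect, square-free means separable. -/
lemma discr_ne_zero_of_squarefree {F : ℂ[X][Y]} (hF : Squarefree F) (hd : 0 < F.natDegree) :
    discr F ≠ 0 := by
  let : NormalizedGCDMonoid ℂ[X] := Nonempty.some inferInstance
  refine discr_ne_zero_of_separable (K := FractionRing ℂ[X]) hd ?_
  have : CharZero (FractionRing ℂ[X]) :=
    charZero_of_injective_algebraMap (IsFractionRing.injective ℂ[X] _)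
  exact PerfectField.separable_iff_squarefree.2 (squarefree_map_fractionRing hF)

/-- The coordinate `y = y₀ + τ^K` as a ring homomorphism on polynomials in `y`. -/
def localCoord (y₀ : ℂ) (k : ℕ) : ℂ[X] →+* PowerSeries ℂ :=
  (Polynomial.coeToPowerSeries.ringHom).comp (compRingHom (C y₀ + X ^ k))

lemma localCoord_apply (y₀ : ℂ) (k : ℕ) (g : ℂ[X]) :
    localCoord y₀ k g = ((g.comp (C y₀ + X ^ k) : ℂ[X]) : PowerSeries ℂ) := rfl

lemma natDegree_C_add_X_pow (y₀ : ℂ) (k : ℕ) : (C y₀ + X ^ k : ℂ[X]).natDegree = k := by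
  rw [natDegree_C_add, natDegree_X_pow]

lemma comp_ne_zero {y₀ : ℂ} {k : ℕ} (hk : 0 < k) {g : ℂ[X]} (hg : g ≠ 0) :
    g.comp (C y₀ + X ^ k) ≠ 0 := by
  intro h
  rcases Polynomial.comp_eq_zero_iff.1 h with h | ⟨-, h⟩
  · exact hg h
  · have := natDegree_C_add_X_pow y₀ k
    rw [h, natDegree_C] at this
    omega

lemma localCoord_ne_zero {y₀ : ℂ} {k : ℕ} (hk : 0 < k) {g : ℂ[X]} (hg : g ≠ 0) :
    localCoord y₀ k g ≠ 0 := by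
  rw [localCoord_apply, Ne, Polynomial.coe_eq_zero_iff]
  exact comp_ne_zero hk hg

/-- The order at τ = 0 of the non-zero polynomial g(y₀ + τ^k) cannot exceed its degree k · deg g. -/
lemma le_of_X_pow_dvd_localCoord {y₀ : ℂ} {k e : ℕ} (hk : 0 < k) {g : ℂ[X]} (hg : g ≠ 0)
    (h : PowerSeries.X ^ e ∣ localCoord y₀ k g) : e ≤ g.natDegree * k := by
  by_contra! hlt
  rw [localCoord_apply, PowerSeries.X_pow_dvd_iff] at h
  have h1 := h (g.comp (C y₀ + X ^ k)).natDegree (by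
    rw [natDegree_comp, natDegree_C_add_X_pow]; exact hlt)
  rw [Polynomial.coeff_coe] at h1
  exact comp_ne_zero hk hg (leadingCoeff_eq_zero.1 h1)

/-- The curve polynomial in the local coordinate `y = y₀ + τ^K`. -/
def localCurve (F : ℂ[X][Y]) (y₀ : ℂ) (k : ℕ) : (PowerSeries ℂ)[X] := F.map (localCoord y₀ k)

lemma aevalAeval_eq_eval₂ {A : Type*} [CommRing A] [Algebra ℂ A] (x y : A) (F : ℂ[X][Y]) :
    aevalAeval x y F = eval₂ (aeval x : ℂ[X] →ₐ[ℂ] A).toRingHom y F := by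
  have : (aevalAeval x y : ℂ[X][Y] →ₐ[ℂ] A).toRingHom =
      eval₂RingHom (aeval x : ℂ[X] →ₐ[ℂ] A).toRingHom y := by
    ext <;> simp
  exact RingHom.congr_fun this F

lemma map_aevalAeval {A B : Type*} [CommRing A] [Algebra ℂ A] [CommRing B] [Algebra ℂ B]
    (φ : A →ₐ[ℂ] B) (x y : A) (F : ℂ[X][Y]) :
    φ (aevalAeval x y F) = aevalAeval (φ x) (φ y) F := by
  have : φ.comp (aevalAeval x y) = (aevalAeval (φ x) (φ y) : ℂ[X][Y] →ₐ[ℂ] B) := by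
    refine Polynomial.algHom_ext' (Polynomial.algHom_ext ?_) ?_
    · simp
    · simp
  exact AlgHom.congr_fun this F

/-- `y₀ + τ^K` as a power series. -/
def coordSeries (y₀ : ℂ) (k : ℕ) : PowerSeries ℂ := PowerSeries.C y₀ + PowerSeries.X ^ k

lemma eval_localCurve (F : ℂ[X][Y]) (y₀ : ℂ) (k : ℕ) (P : LaurentSeries ℂ) :
    eval P ((localCurve F y₀ k).map (algebraMap (PowerSeries ℂ) (LaurentSeries ℂ))) =
      aevalAeval (HahnSeries.ofPowerSeries ℤ ℂ (coordSeries y₀ k)) P F := by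
  rw [aevalAeval_eq_eval₂, localCurve, Polynomial.map_map, eval_map]
  congr 1
  ext
  · simp [localCoord_apply, coordSeries]
    rw [algebraMap_hahnSeries]
    rfl
  · simp [localCoord_apply, coordSeries]

/-- A root with a pole of exact order μ, or with no pole when μ = 0, gives a primitive linear
factor; primitivity is what carries divisibility from ℂ((τ)) down to ℂ⟦τ⟧. -/
lemma isPrimitive_linear_factor {μ : ℕ} {β : PowerSeries ℂ}
    (h : μ = 0 ∨ PowerSeries.constantCoeff β ≠ 0) :
    (C (PowerSeries.X ^ μ) * X - C β : (PowerSeries ℂ)[X]).IsPrimitive := by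
  intro r hr
  rw [C_dvd_iff_dvd_coeff] at hr
  rcases h with rfl | h
  · have := hr 1
    simp only [pow_zero, map_one, one_mul, coeff_sub, coeff_X_one, coeff_C_succ, sub_zero] at this
    exact isUnit_of_dvd_one this
  · have := hr 0
    simp only [coeff_sub, mul_coeff_zero, coeff_X_zero, mul_zero, coeff_C_zero, zero_sub,
      dvd_neg] at this
    refine isUnit_of_dvd_unit this ?_
    rw [PowerSeries.isUnit_iff_constantCoeff, isUnit_iff_ne_zero]
    exact h

lemma map_linear_factor {μ : ℕ} {β : PowerSeries ℂ} {P : LaurentSeries ℂ}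
    (h : HahnSeries.ofPowerSeries ℤ ℂ β = HahnSeries.ofPowerSeries ℤ ℂ (PowerSeries.X ^ μ) * P) :
    (C (PowerSeries.X ^ μ) * X - C β : (PowerSeries ℂ)[X]).map
      (algebraMap (PowerSeries ℂ) (LaurentSeries ℂ)) =
      C (HahnSeries.ofPowerSeries ℤ ℂ (PowerSeries.X ^ μ)) * (X - C P) := by
  rw [Polynomial.map_sub, Polynomial.map_mul, map_C, map_C, map_X,
    LaurentSeries.coe_algebraMap, h, map_mul]
  ring

lemma C_mul_dvd_of_dvd {L : Type*} [Field L] {a : L} (ha : a ≠ 0) {q f : L[X]} (h : q ∣ f) :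
    C a * q ∣ f :=
  (IsUnit.mul_left_dvd (isUnit_C.2 ha.isUnit)).2 h

/-- A bound for the number and the closeness of pairs of roots of `F(y₀ + τ^K, p)`. -/
lemma card_mul_le_of_close_roots {F : ℂ[X][Y]} (hF : Squarefree F) {y₀ : ℂ} {k : ℕ} (hk : 0 < k)
    {ι : Type*} (s : Finset ι) (hs : s.Nonempty) {μ A : ℕ} {β β' : ι → PowerSeries ℂ}
    {P Q : ι → LaurentSeries ℂ}
    (hβ : ∀ i, HahnSeries.ofPowerSeries ℤ ℂ (β i) =
      HahnSeries.ofPowerSeries ℤ ℂ (PowerSeries.X ^ μ) * P i)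
    (hβ' : ∀ i, HahnSeries.ofPowerSeries ℤ ℂ (β' i) =
      HahnSeries.ofPowerSeries ℤ ℂ (PowerSeries.X ^ μ) * Q i)
    (hprim : ∀ i, μ = 0 ∨ PowerSeries.constantCoeff (β i) ≠ 0)
    (hprim' : ∀ i, μ = 0 ∨ PowerSeries.constantCoeff (β' i) ≠ 0)
    (hP : ∀ i, aevalAeval (HahnSeries.ofPowerSeries ℤ ℂ (coordSeries y₀ k)) (P i) F = 0)
    (hQ : ∀ i, aevalAeval (HahnSeries.ofPowerSeries ℤ ℂ (coordSeries y₀ k)) (Q i) F = 0)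
    (hinj : Set.InjOn P s) (hne : ∀ i, P i ≠ Q i)
    (hA : ∀ i, PowerSeries.X ^ A ∣ β i - β' i) :
    s.card * A ≤ 2 * (degP F - 1) * degY F * k := by
  let : NormalizedGCDMonoid (PowerSeries ℂ) := Nonempty.some inferInstance
  have : CharZero (PowerSeries ℂ) :=
    charZero_of_injective_ringHom (f := PowerSeries.C (R := ℂ)) PowerSeries.C_injective
  have hF0 : F ≠ 0 := hF.ne_zero
  -- If F were free of p, the root condition would say that a non-zero polynomial in y vanishes at
  -- y₀ + τ^k.
  have hd : 0 < F.natDegree := by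
    by_contra! h
    obtain ⟨i, hi⟩ := hs
    have h1 := hP i
    rw [eq_C_of_natDegree_le_zero h, ← eval_localCurve, localCurve, map_C, map_C, eval_C,
      LaurentSeries.coe_algebraMap, map_eq_zero_iff _ HahnSeries.ofPowerSeries_injective] at h1
    refine localCoord_ne_zero hk ?_ h1
    rintro h2
    exact hF0 (by rw [eq_C_of_natDegree_le_zero h, h2, C_0])
  have hlc : localCoord y₀ k F.leadingCoeff ≠ 0 :=
    localCoord_ne_zero hk (leadingCoeff_ne_zero.2 hF0)
  have hα : (PowerSeries.X ^ μ : PowerSeries ℂ) ≠ 0 := pow_ne_zero _ PowerSeries.X_ne_zero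
  have hα' : HahnSeries.ofPowerSeries ℤ ℂ (PowerSeries.X ^ μ) ≠ 0 := by
    rwa [Ne, map_eq_zero_iff _ HahnSeries.ofPowerSeries_injective]
  set f := localCurve F y₀ k with hf
  have hf0 : f ≠ 0 := by
    intro h
    have := leadingCoeff_map_of_leadingCoeff_ne_zero (localCoord y₀ k) hlc
    rw [← localCurve, ← hf, h, leadingCoeff_zero] at this
    exact hlc this.symm
  set ψ := algebraMap (PowerSeries ℂ) (LaurentSeries ℂ) with hψ
  have hu : IsUnit (C (HahnSeries.ofPowerSeries ℤ ℂ (PowerSeries.X ^ μ)) :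
      (LaurentSeries ℂ)[X]) := isUnit_C.2 (isUnit_iff_ne_zero.2 hα')
  have hrP : ∀ i, X - C (P i) ∣ f.map ψ := fun i => by
    rw [dvd_iff_isRoot, IsRoot, hf, hψ, eval_localCurve, hP i]
  have hrQ : ∀ i, X - C (Q i) ∣ f.map ψ := fun i => by
    rw [dvd_iff_isRoot, IsRoot, hf, hψ, eval_localCurve, hQ i]
  have hlP : ∀ i, (C (HahnSeries.ofPowerSeries ℤ ℂ (PowerSeries.X ^ μ)) : (LaurentSeries ℂ)[X]) *
      (X - C (P i)) ∣ f.map ψ :=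
    fun i => C_mul_dvd_of_dvd hα' (hrP i)
  have hlQ : ∀ i, (C (HahnSeries.ofPowerSeries ℤ ℂ (PowerSeries.X ^ μ)) : (LaurentSeries ℂ)[X]) *
      (X - C (Q i)) ∣ f.map ψ :=
    fun i => C_mul_dvd_of_dvd hα' (hrQ i)
  -- Distinct roots give coprime factors over ℂ((τ)); Gauss's lemma brings the divisibility back to
  -- ℂ⟦τ⟧.
  have h1 : ∏ i ∈ s, (C (PowerSeries.X ^ μ) * X - C (β i)) ∣ f := by
    have hp : (∏ i ∈ s, (C (PowerSeries.X ^ μ) * X - C (β i)) : (PowerSeries ℂ)[X]).IsPrimitive := by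
      refine Finset.prod_induction _ IsPrimitive (fun _ _ => IsPrimitive.mul) isPrimitive_one ?_
      exact fun i _ => isPrimitive_linear_factor (hprim i)
    refine hp.dvd_of_fraction_map_dvd_fraction_map (K := LaurentSeries ℂ) ?_
    rw [Polynomial.map_prod]
    refine Finset.prod_dvd_of_coprime ?_ ?_
    · intro i hi j hj hij
      have : IsCoprime (X - C (P i)) (X - C (P j)) :=
        pairwise_coprime_X_sub_C (s := fun x : s => P x) (fun a b hab =>
          Subtype.ext (hinj a.2 b.2 hab)) (i := ⟨i, hi⟩) (j := ⟨j, hj⟩)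
          (fun h => hij (congrArg Subtype.val h))
      simp only [Function.onFun]
      rw [map_linear_factor (hβ i), map_linear_factor (hβ j)]
      exact (isCoprime_mul_unit_left hu _ _).2 this
    · intro i hi
      rw [map_linear_factor (hβ i)]
      exact hlP i
  have h2 : ∀ i ∈ s, (C (PowerSeries.X ^ μ) * X - C (β i)) *
      (C (PowerSeries.X ^ μ) * X - C (β' i)) ∣ f := by
    intro i _
    refine ((isPrimitive_linear_factor (hprim i)).mul
      (isPrimitive_linear_factor (hprim' i))).dvd_of_fraction_map_dvd_fraction_map
      (K := LaurentSeries ℂ) ?_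
    rw [Polynomial.map_mul, map_linear_factor (hβ i), map_linear_factor (hβ' i)]
    have : IsCoprime (X - C (P i)) (X - C (Q i)) :=
      isCoprime_X_sub_C_of_isUnit_sub (sub_ne_zero.2 (hne i)).isUnit
    exact ((isCoprime_mul_unit_left hu _ _).2 this).mul_dvd (hlP i) (hlQ i)
  have h3 := prod_dvd_discr s hs hα β β' hf0 h1 h2
  -- The leading coefficient survives the substitution y = y₀ + τ^k, so the discriminant commutes
  -- with it and becomes a polynomial in τ^k, whose order is bounded by its degree.
  have h4 : PowerSeries.X ^ (s.card * A) ∣ localCoord y₀ k (discr F) := by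
    rw [← discr_map_of_leadingCoeff_ne_zero _ hd hlc]
    refine dvd_trans ?_ h3
    rw [mul_comm, pow_mul, ← Finset.prod_const]
    exact Finset.prod_dvd_prod_of_dvd _ _ fun i _ => Dvd.dvd.mul_left (hA i) _
  refine (le_of_X_pow_dvd_localCoord hk (discr_ne_zero_of_squarefree hF hd) h4).trans ?_
  exact Nat.mul_le_mul_right _ (natDegree_discr_le F hd)

end CurveDiscriminant

end
end PuiseuxTruncation

namespace PuiseuxTruncation
open PowerSeries
noncomputable section

/-! ### Rotations `t ↦ ζ t` -/

/-- The series `ζ t`. -/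
def rot (ζ : ℂ) : PowerSeries ℂ := ζ • X

lemma rot_order {ζ : ℂ} (hζ : ζ ≠ 0) : (rot ζ).order = 1 := by
  rw [order_eq_one_iff]; simp [rot, hζ]

lemma coeff_one_rot (ζ : ℂ) : coeff 1 (rot ζ) = ζ := by simp [rot]

lemma rot_eq (ζ : ℂ) : rot ζ = C ζ * X := by rw [rot, smul_eq_C_mul]

lemma coeff_subst_rot (ζ : ℂ) (f : PowerSeries ℂ) (n : ℕ) :
    coeff n (f.subst (rot ζ)) = ζ ^ n * coeff n f := by
  rw [rot, ← rescale_eq_subst, coeff_rescale]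

lemma subst_rot_rot {ζ η : ℂ} (hη : η ≠ 0) : (rot ζ).subst (rot η) = rot (ζ * η) := by
  rw [rot_eq ζ, subst_mul (hasSubst_of_order_one (rot_order hη)), subst_C',
    subst_X (hasSubst_of_order_one (rot_order hη)), rot_eq, rot_eq, map_mul, mul_assoc]

lemma rot_one : rot 1 = X := by simp [rot]

lemma dvd_of_subst_rot_eq {ζ : ℂ} {f : PowerSeries ℂ} (h : f.subst (rot ζ) = f) {j : ℕ}
    (hj : coeff j f ≠ 0) : orderOf ζ ∣ j := by
  have := congrArg (coeff j) h
  rw [coeff_subst_rot] at this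
  exact orderOf_dvd_of_pow_eq_one (mul_right_cancel₀ hj (by rw [this, one_mul]))

/-! ### Local inverses of ramified solutions -/

/-- `Z = y₀ + W^K` with `W` of order one and leading coefficient `γ`, `S` is the compositional
inverse of `W`, and `P` is the derivative `dy/dx` (where `x = t^L`) in the coordinate
`τ = W(t)`. -/
structure IsLocalInverse (y₀ : ℂ) (L K : ℕ) (γ : ℂ) (Z W S : PowerSeries ℂ)
    (P : LaurentSeries ℂ) : Prop where
  pow_eq : W ^ K = Z - C y₀
  order_W : W.order = 1
  coeff_W : coeff 1 W = γ
  order_S : S.order = 1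
  coeff_S : coeff 1 S = γ⁻¹
  W_S : W.subst S = (X : PowerSeries ℂ)
  S_W : S.subst W = (X : PowerSeries ℂ)
  P_eq : P = laurentSubst (ramifiedDeriv L (HahnSeries.ofPowerSeries ℤ ℂ Z)) S

lemma exists_isLocalInverse {y₀ : ℂ} {L K : ℕ} (hK : 0 < K) {γ : ℂ} (hγ : γ ≠ 0)
    {Z : PowerSeries ℂ} (hZ : X ^ K ∣ Z - C y₀) (hc : γ ^ K = coeff K (Z - C y₀)) :
    ∃ W S P, IsLocalInverse y₀ L K γ Z W S P := by
  obtain ⟨W, hW, hWc, hWp⟩ := exists_order_one_pow_eq hK hγ hZ hc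
  obtain ⟨S, hS, hSc, h1, h2⟩ := exists_subst_inverse hW
  exact ⟨W, S, _, hWp, hW, hWc, hS, by rw [hSc, hWc], h1, h2, rfl⟩

/-- The chain rule dy/dt = L t^(L-1) · dy/dx for x = t^L, with the pole cleared. -/
lemma ramifiedDeriv_spec {L : ℕ} (hL : 0 < L) (Z : PowerSeries ℂ) :
    HahnSeries.ofPowerSeries ℤ ℂ (C (L : ℂ) * X ^ (L - 1)) *
      ramifiedDeriv L (HahnSeries.ofPowerSeries ℤ ℂ Z) =
      HahnSeries.ofPowerSeries ℤ ℂ (derivative ℂ Z) := by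
  have hL' : (L : ℂ) ≠ 0 := by exact_mod_cast hL.ne'
  rw [ramifiedDeriv, derivative_coe', ← mul_assoc, map_mul, HahnSeries.ofPowerSeries_C,
    HahnSeries.ofPowerSeries_X_pow, HahnSeries.C_apply, HahnSeries.single_mul_single,
    HahnSeries.single_mul_single]
  have : (0 : ℤ) + ((L - 1 : ℕ) : ℤ) + (1 - (L : ℤ)) = 0 := by omega
  rw [this, mul_one, mul_inv_cancel₀ hL', HahnSeries.single_zero_one, one_mul]

lemma derivative_coordSeries (y₀ : ℂ) (K : ℕ) :
    derivative ℂ (coordSeries y₀ K) = C (K : ℂ) * X ^ (K - 1) := by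
  rw [coordSeries, map_add, derivative_C, zero_add, derivative_pow, derivative_X, mul_one]
  simp

/-! ### The differential equation in the coordinate τ. -/

namespace IsLocalInverse

variable {y₀ : ℂ} {L K : ℕ} {γ : ℂ} {Z W S : PowerSeries ℂ} {P : LaurentSeries ℂ}

lemma eq_coord (h : IsLocalInverse y₀ L K γ Z W S P) : Z = C y₀ + W ^ K := by
  rw [h.pow_eq]; ring

lemma subst_S (h : IsLocalInverse y₀ L K γ Z W S P) : Z.subst S = coordSeries y₀ K := by
  have hs := hasSubst_of_order_one h.order_S
  rw [h.eq_coord, subst_add hs, subst_pow hs, h.W_S, subst_C']; rfl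

lemma root (h : IsLocalInverse y₀ L K γ Z W S P) {F : ℂ[X][Y]}
    (hF : Polynomial.aevalAeval (HahnSeries.ofPowerSeries ℤ ℂ Z)
      (ramifiedDeriv L (HahnSeries.ofPowerSeries ℤ ℂ Z)) F = 0) :
    Polynomial.aevalAeval (HahnSeries.ofPowerSeries ℤ ℂ (coordSeries y₀ K)) P F = 0 := by
  have := congrArg (laurentSubstHom h.order_S) hF
  rw [map_aevalAeval, map_zero, ← laurentSubst_eq_hom, ← laurentSubst_eq_hom,
    laurentSubst_coe h.order_S, h.subst_S, ← h.P_eq] at this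
  exact this

/-- With x = S(τ)^L and y = y₀ + τ^K this is dx/dτ · dy/dx = dy/dτ. -/
lemma ode (h : IsLocalInverse y₀ L K γ Z W S P) (hL : 0 < L) :
    HahnSeries.ofPowerSeries ℤ ℂ (derivative ℂ (S ^ L)) * P =
      HahnSeries.ofPowerSeries ℤ ℂ (C (K : ℂ) * X ^ (K - 1)) := by
  have hs := hasSubst_of_order_one h.order_S
  have h1 := congrArg (laurentSubstHom h.order_S) (ramifiedDeriv_spec hL Z)
  rw [map_mul, ← laurentSubst_eq_hom, ← laurentSubst_eq_hom, ← laurentSubst_eq_hom,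
    laurentSubst_coe h.order_S, laurentSubst_coe h.order_S, ← h.P_eq, subst_mul hs, subst_pow hs,
    subst_C', subst_X hs] at h1
  have h2 := derivative_subst (f := Z) hs
  rw [h.subst_S, derivative_coordSeries] at h2
  rw [h2, map_mul, ← h1, derivative_pow, mul_right_comm]
  simp only [map_mul, map_natCast]
  ring

/-- The derivative of `S^L` is `τ^{L-1}` times a unit. -/
lemma exists_derivative_pow_eq (h : IsLocalInverse y₀ L K γ Z W S P) (hL : 0 < L)
    (hγ : γ ≠ 0) : ∃ e : PowerSeries ℂ, derivative ℂ (S ^ L) = X ^ (L - 1) * e ∧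
      constantCoeff e ≠ 0 := by
  obtain ⟨u, hu⟩ := X_dvd_of_order_one h.order_S
  have hc : constantCoeff u = γ⁻¹ := by rw [← h.coeff_S, hu, coeff_one_X_mul]
  refine ⟨C (L : ℂ) * u ^ (L - 1) * derivative ℂ S, ?_, ?_⟩
  · rw [derivative_pow]
    conv_lhs => rw [hu, ← hu, hu, mul_pow]
    rw [← hu]
    simp only [map_natCast]
    ring
  · have h1 : constantCoeff (derivative ℂ S) = γ⁻¹ := by
      rw [← h.coeff_S, ← coeff_zero_eq_constantCoeff_apply, coeff_derivative]; simp
    rw [map_mul, map_mul, map_pow, h1, hc, constantCoeff_C]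
    exact mul_ne_zero (mul_ne_zero (by exact_mod_cast hL.ne') (pow_ne_zero _ (inv_ne_zero hγ)))
      (inv_ne_zero hγ)

lemma P_ne_zero (h : IsLocalInverse y₀ L K γ Z W S P) (hL : 0 < L) (hK : 0 < K) : P ≠ 0 := by
  rintro rfl
  have := h.ode hL
  rw [mul_zero, eq_comm, map_eq_zero_iff _ HahnSeries.ofPowerSeries_injective] at this
  refine mul_ne_zero ?_ (pow_ne_zero _ X_ne_zero) this
  rw [Ne, map_eq_zero_iff _ C_injective]
  exact_mod_cast hK.ne'

lemma pow_eq_of_derivative_mul_eq {S₁ S₂ : PowerSeries ℂ}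
    (h₁ : S₁.order = 1) (h₂ : S₂.order = 1) (hP : P ≠ 0)
    (h : HahnSeries.ofPowerSeries ℤ ℂ (derivative ℂ (S₁ ^ L)) * P =
      HahnSeries.ofPowerSeries ℤ ℂ (derivative ℂ (S₂ ^ L)) * P) : S₁ ^ L = S₂ ^ L := by
  refine derivative.ext (HahnSeries.ofPowerSeries_injective (mul_right_cancel₀ hP h)) ?_
  rw [map_pow, map_pow, (order_eq_one_iff.1 h₁).1, (order_eq_one_iff.1 h₂).1]

/-- A solution is determined by its derivative as a function on the curve. -/
lemma eq_of_P_eq {Z₂ W₂ S₂ : PowerSeries ℂ} (h : IsLocalInverse y₀ L K γ Z W S P)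
    (h₂ : IsLocalInverse y₀ L K γ Z₂ W₂ S₂ P) (hL : 0 < L) (hK : 0 < K) : Z = Z₂ := by
  -- P fixes the derivative of S^L, hence S^L; the common leading coefficient γ⁻¹ then selects the
  -- same L-th root.
  have e : S ^ L = S₂ ^ L := pow_eq_of_derivative_mul_eq h.order_S h₂.order_S
    (h.P_ne_zero hL hK) ((h.ode hL).trans (h₂.ode hL).symm)
  have hS : S = S₂ := order_one_eq_of_pow_eq hL h.order_S h₂.order_S
    (h.coeff_S.trans h₂.coeff_S.symm) e
  subst hS
  have hW : W = W₂ := by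
    have := congrArg (PowerSeries.subst W) h₂.W_S
    rw [subst_subst h.order_S h.order_W, h.S_W, X_subst,
      subst_X (hasSubst_of_order_one h.order_W)] at this
    exact this.symm
  rw [h.eq_coord, h₂.eq_coord, hW]

/-- Both P and K τ^(K-1) dτ are invariant under τ ↦ ζτ, so S(ζτ)^L = S(τ)^L. Leading coefficients
give ζ^L = 1, hence S(ζτ) = ζ S(τ) and W(ζt) = ζ W(t), and ζ disappears from W^K. A stabilizer of
the root P thus acts as a symmetry of the solution. -/
lemma subst_rot_eq_of_P_eq (h : IsLocalInverse y₀ L K γ Z W S P) (hL : 0 < L) (hK : 0 < K)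
    (hγ : γ ≠ 0) {ζ : ℂ} (hζ : ζ ^ K = 1) (hP : laurentSubst P (rot ζ) = P) :
    ζ ^ L = 1 ∧ Z.subst (rot ζ) = Z := by
  have hζ0 : ζ ≠ 0 := by rintro rfl; rw [zero_pow hK.ne'] at hζ; exact zero_ne_one hζ
  have hz := rot_order hζ0
  have hzs := hasSubst_of_order_one hz
  set S' : PowerSeries ℂ := S.subst (rot ζ) with hS'
  obtain ⟨hS'o, hS'c⟩ := order_one_subst h.order_S hz
  rw [coeff_one_rot, h.coeff_S] at hS'c
  have h1 := congrArg (laurentSubstHom hz) (h.ode hL)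
  rw [map_mul, ← laurentSubst_eq_hom, ← laurentSubst_eq_hom, ← laurentSubst_eq_hom, hP,
    laurentSubst_coe hz, laurentSubst_coe hz] at h1
  have h2 : derivative ℂ (S' ^ L) = (derivative ℂ (S ^ L)).subst (rot ζ) * C ζ := by
    rw [hS', ← subst_pow hzs, derivative_subst hzs]
    congr 1
    rw [rot, Derivation.map_smul, derivative_X, smul_eq_C_mul, mul_one]
  have h3 : (C (K : ℂ) * X ^ (K - 1) : PowerSeries ℂ).subst (rot ζ) * C ζ =
      C (K : ℂ) * X ^ (K - 1) := by
    rw [subst_mul hzs, subst_pow hzs, subst_X hzs, subst_C', rot_eq, mul_pow,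
      show (C (K : ℂ) * (C ζ ^ (K - 1) * X ^ (K - 1)) * C ζ : PowerSeries ℂ) =
        (C ζ ^ (K - 1) * C ζ) * (C (K : ℂ) * X ^ (K - 1)) by ring, ← pow_succ,
      Nat.sub_add_cancel hK, ← map_pow, hζ, map_one, one_mul]
  have h4 : S' ^ L = S ^ L := by
    refine pow_eq_of_derivative_mul_eq hS'o h.order_S (h.P_ne_zero hL hK) ?_
    rw [h2, map_mul, mul_right_comm, h1, ← map_mul, h3, h.ode hL]
  have h5 : ζ ^ L = 1 := by
    have e := congrArg (coeff L) h4
    rw [hS', ← subst_pow hzs, coeff_subst_rot] at e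
    have hne : coeff L (S ^ L) ≠ 0 := by
      obtain ⟨u, hu⟩ := X_dvd_of_order_one h.order_S
      have hc : constantCoeff u = γ⁻¹ := by rw [← h.coeff_S, hu, coeff_one_X_mul]
      rw [hu, mul_pow]
      have := coeff_X_pow_mul (u ^ L) L 0
      rw [zero_add] at this
      rw [this, coeff_zero_eq_constantCoeff_apply, map_pow, hc]
      exact pow_ne_zero _ (inv_ne_zero hγ)
    exact mul_right_cancel₀ hne (by rw [e, one_mul])
  refine ⟨h5, ?_⟩
  obtain ⟨hzSo, hzSc⟩ := order_one_subst hz h.order_S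
  have h6 : S' = (rot ζ).subst S := by
    refine order_one_eq_of_pow_eq hL hS'o hzSo ?_ ?_
    · rw [hS'c, hzSc, coeff_one_rot, h.coeff_S, mul_comm]
    · rw [h4, rot_eq, subst_mul (hasSubst_of_order_one h.order_S),
        subst_X (hasSubst_of_order_one h.order_S), subst_C', mul_pow, ← map_pow, h5, map_one,
        one_mul]
  have h7 : W.subst (rot ζ) = (rot ζ).subst W := by
    have a : PowerSeries.subst W (W.subst ((rot ζ).subst S : PowerSeries ℂ) : PowerSeries ℂ) =
        (rot ζ).subst W := by
      rw [← h6, hS', ← subst_subst h.order_S hz, h.W_S, subst_X hzs]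
    rw [← a, subst_subst hzSo h.order_W,
      subst_subst h.order_S h.order_W, h.S_W, X_subst]
  rw [h.eq_coord, subst_add hzs, subst_C', subst_pow hzs, h7, rot_eq,
    subst_mul (hasSubst_of_order_one h.order_W), subst_X (hasSubst_of_order_one h.order_W),
    subst_C', mul_pow, ← map_pow, hζ, map_one, one_mul]

end IsLocalInverse


/-! ### Ramification orders -/

lemma ramificationOrder_spec {y : HahnSeries ℚ ℂ} (hy : IsPuiseux y) :
    0 < ramificationOrder y ∧ HasDenominator y (ramificationOrder y) := by
  obtain ⟨n, hn⟩ := hy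
  exact Nat.sInf_mem (s := {n : ℕ | 0 < n ∧ HasDenominator y n}) ⟨n, hn⟩

lemma ramificationOrder_le {y : HahnSeries ℚ ℂ} {n : ℕ} (hn : 0 < n) (h : HasDenominator y n) :
    ramificationOrder y ≤ n := Nat.sInf_le ⟨hn, h⟩

lemma hasDenominator_mul {y : HahnSeries ℚ ℂ} {n : ℕ} (h : HasDenominator y n) (c : ℕ) :
    HasDenominator y (n * c) := by
  intro q hq
  obtain ⟨j, hj⟩ := h q hq
  exact ⟨j * c, by push_cast; rw [← mul_assoc, hj]⟩

lemma hasDenominator_of_dvd {L m : ℕ} (hL : 0 < L) (hm : m ∣ L) {Z : LaurentSeries ℂ}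
    (h : ∀ j, Z.coeff j ≠ 0 → (m : ℤ) ∣ j) : HasDenominator (ramify hL Z) (L / m) := by
  intro q hq
  obtain ⟨j, hj⟩ := hasDenominator_ramify hL Z q hq
  have hq' : (ramify hL Z).coeff q ≠ 0 := hq
  rw [eq_div_of_mul_eq hL hj, ramify_coeff] at hq'
  obtain ⟨i, hi⟩ := h j hq'
  obtain ⟨c, hc⟩ := hm
  have hm0 : 0 < m := Nat.pos_of_ne_zero (by rintro rfl; simp at hc; omega)
  refine ⟨i, ?_⟩
  have hmq : (m : ℚ) ≠ 0 := by exact_mod_cast hm0.ne'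
  rw [hc, Nat.mul_div_cancel_left c hm0]
  rw [hc, hi] at hj
  push_cast at hj
  apply mul_left_cancel₀ hmq
  rw [← hj]; ring

/-! ### Solutions as ramified power series -/

/-- The data of a solution in the coordinate `t = x^{1/L}`. -/
structure IsRamifiedSolution (F : ℂ[X][Y]) (y₀ : ℂ) (p₀ : OnePoint ℂ) (L : ℕ)
    (Z : PowerSeries ℂ) : Prop where
  constantCoeff_eq : constantCoeff Z = y₀
  eval_eq : Polynomial.aevalAeval (HahnSeries.ofPowerSeries ℤ ℂ Z)
      (ramifiedDeriv L (HahnSeries.ofPowerSeries ℤ ℂ Z)) F = 0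
  value_eq : valueAtZero (ramifiedDeriv L (HahnSeries.ofPowerSeries ℤ ℂ Z)) = p₀

lemma exists_isRamifiedSolution {F : ℂ[X][Y]} {y₀ : ℂ} {p₀ : OnePoint ℂ} {y : HahnSeries ℚ ℂ}
    (hy : y ∈ solutions F y₀ p₀) {L : ℕ} (hL : 0 < L) (hd : HasDenominator y L) :
    ∃ Z, ramify hL (HahnSeries.ofPowerSeries ℤ ℂ Z) = y ∧ IsRamifiedSolution F y₀ p₀ L Z := by
  obtain ⟨A, rfl⟩ := exists_ramify_eq hL hd
  obtain ⟨-, h1, h2, h3⟩ := hy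
  rw [valueAtZero_ramify] at h2
  obtain ⟨Z, rfl, hZ⟩ := exists_coe_of_valueAtZero h2
  rw [puiseuxDeriv_ramify, ← map_aevalAeval, map_eq_zero_iff _ (ramify_injective hL)] at h1
  rw [puiseuxDeriv_ramify, valueAtZero_ramify] at h3
  exact ⟨Z, rfl, hZ, h1, h3⟩

lemma IsRamifiedSolution.mem_solutions {F : ℂ[X][Y]} {y₀ : ℂ} {p₀ : OnePoint ℂ} {L : ℕ}
    (hL : 0 < L) {Z : PowerSeries ℂ} (h : IsRamifiedSolution F y₀ p₀ L Z) :
    ramify hL (HahnSeries.ofPowerSeries ℤ ℂ Z) ∈ solutions F y₀ p₀ := by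
  refine ⟨⟨L, hL, hasDenominator_ramify hL _⟩, ?_, ?_, ?_⟩
  · rw [puiseuxDeriv_ramify, ← map_aevalAeval, h.eval_eq, map_zero]
  · rw [valueAtZero_ramify, valueAtZero_coe, h.constantCoeff_eq]
  · rw [puiseuxDeriv_ramify, valueAtZero_ramify, h.value_eq]

lemma ramify_coe_coeff {L : ℕ} (hL : 0 < L) (Z : PowerSeries ℂ) (j : ℕ) :
    (ramify hL (HahnSeries.ofPowerSeries ℤ ℂ Z)).coeff ((j : ℚ) / L) = coeff j Z := by
  rw [← coeff_ofPowerSeries_nat, ← ramify_coeff hL, Int.cast_natCast]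

lemma ramify_coe_mem_constants_iff {L : ℕ} (hL : 0 < L) (Z : PowerSeries ℂ) :
    ramify hL (HahnSeries.ofPowerSeries ℤ ℂ Z) ∈ constants ↔ Z = C (constantCoeff Z) := by
  constructor
  · rintro ⟨c, hc⟩
    rw [← ramify_C hL, ← HahnSeries.ofPowerSeries_C] at hc
    have := HahnSeries.ofPowerSeries_injective (ramify_injective hL hc)
    rw [← this]; simp
  · intro h
    rw [h, HahnSeries.ofPowerSeries_C, ramify_C]
    exact ⟨_, rfl⟩

/-- A nonconstant power series has a leading term. -/
lemma exists_leading_term {Z : PowerSeries ℂ} {y₀ : ℂ} (h0 : constantCoeff Z = y₀)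
    (h : Z ≠ C y₀) : ∃ K : ℕ, 0 < K ∧ X ^ K ∣ Z - C y₀ ∧ coeff K (Z - C y₀) ≠ 0 := by
  have hne : Z - C y₀ ≠ 0 := sub_ne_zero.2 h
  refine ⟨(Z - C y₀).order.toNat, ?_, X_pow_order_dvd, coeff_order hne⟩
  rw [Nat.pos_iff_ne_zero]
  intro hz
  have := coeff_order hne
  rw [hz, coeff_zero_eq_constantCoeff_apply, map_sub, h0, constantCoeff_C, sub_self] at this
  exact this rfl

lemma order_ramify_sub {L : ℕ} (hL : 0 < L) {Z : PowerSeries ℂ} {y₀ : ℂ} {K : ℕ}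
    (h1 : X ^ K ∣ Z - C y₀) (h2 : coeff K (Z - C y₀) ≠ 0) :
    (ramify hL (HahnSeries.ofPowerSeries ℤ ℂ Z) - HahnSeries.C y₀).order = (K : ℚ) / L := by
  have hL' : (0 : ℚ) < L := by exact_mod_cast hL
  rw [← ramify_C hL, ← HahnSeries.ofPowerSeries_C, ← map_sub, ← map_sub]
  have hc := ramify_coe_coeff hL (Z - C y₀) K
  refine le_antisymm (HahnSeries.order_le_of_coeff_ne_zero (by rw [hc]; exact h2)) ?_
  by_contra! hlt
  have hne : ramify hL (HahnSeries.ofPowerSeries ℤ ℂ (Z - C y₀)) ≠ 0 := by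
    intro h; rw [h] at hc; exact h2 hc.symm
  have h3 := HahnSeries.coeff_order_eq_zero.not.2 hne
  set q := (ramify hL (HahnSeries.ofPowerSeries ℤ ℂ (Z - C y₀))).order
  obtain ⟨j, hj⟩ := hasDenominator_ramify hL _ q h3
  have hq := eq_div_of_mul_eq hL hj
  rw [hq, ramify_coeff] at h3
  rw [hq, div_lt_div_iff_of_pos_right hL'] at hlt
  rcases lt_or_ge j 0 with hj0 | hj0
  · exact h3 (coeff_ofPowerSeries_neg _ hj0)
  · lift j to ℕ using hj0
    rw [coeff_ofPowerSeries_nat] at h3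
    exact h3 (X_pow_dvd_iff.1 h1 j (by exact_mod_cast hlt))

/-! ### Close solutions are equal -/

/-- The derivative on the curve in normal form: `τ^{L-K} P = K τ^{K-L} / e` (with truncated
subtractions). -/
lemma IsLocalInverse.exists_normal_form {y₀ : ℂ} {L K : ℕ} {γ : ℂ} {Z W S : PowerSeries ℂ}
    {P : LaurentSeries ℂ} (h : IsLocalInverse y₀ L K γ Z W S P) (hL : 0 < L) (hK : 0 < K)
    {e : PowerSeries ℂ} (he : derivative ℂ (S ^ L) = X ^ (L - 1) * e)
    (he0 : constantCoeff e ≠ 0) :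
    HahnSeries.ofPowerSeries ℤ ℂ (C (K : ℂ) * X ^ (K - L) * e⁻¹) =
      HahnSeries.ofPowerSeries ℤ ℂ (X ^ (L - K)) * P := by
  have h1 := h.ode hL
  have hne : HahnSeries.ofPowerSeries ℤ ℂ (X ^ (L - 1) * e) ≠ 0 := by
    rw [Ne, map_eq_zero_iff _ HahnSeries.ofPowerSeries_injective]
    exact mul_ne_zero (pow_ne_zero _ X_ne_zero) (by rintro rfl; simp at he0)
  apply mul_left_cancel₀ hne
  rw [he] at h1
  rw [mul_left_comm _ _ P, h1, ← map_mul, ← map_mul]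
  congr 1
  have e1 : (X ^ (L - 1) * X ^ (K - L) : PowerSeries ℂ) = X ^ (L - K) * X ^ (K - 1) := by
    rw [← pow_add, ← pow_add]; congr 1; omega
  calc X ^ (L - 1) * e * (C (K : ℂ) * X ^ (K - L) * e⁻¹)
      = C (K : ℂ) * (X ^ (L - 1) * X ^ (K - L)) * (e * e⁻¹) := by ring
    _ = X ^ (L - K) * (C (K : ℂ) * X ^ (K - 1)) := by
      rw [PowerSeries.mul_inv_cancel e he0, e1]; ring

lemma dvd_inv_sub_inv {e₁ e₂ : PowerSeries ℂ} {A : ℕ} (h₁ : constantCoeff e₁ ≠ 0)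
    (h₂ : constantCoeff e₂ ≠ 0) (h : X ^ A ∣ e₁ - e₂) : X ^ A ∣ e₁⁻¹ - e₂⁻¹ := by
  have : e₁⁻¹ - e₂⁻¹ = -(e₁ - e₂) * (e₁⁻¹ * e₂⁻¹) := by
    calc e₁⁻¹ - e₂⁻¹ = e₁⁻¹ * (e₂ * e₂⁻¹) - e₂⁻¹ * (e₁ * e₁⁻¹) := by
          rw [PowerSeries.mul_inv_cancel e₁ h₁, PowerSeries.mul_inv_cancel e₂ h₂]; ring
      _ = _ := by ring
  rw [this]
  exact Dvd.dvd.mul_right ((dvd_neg).2 h) _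

lemma dvd_derivative_of_dvd {f : PowerSeries ℂ} {m : ℕ} (h : X ^ (m + 1) ∣ f) :
    X ^ m ∣ derivative ℂ f := by
  rw [X_pow_dvd_iff] at h ⊢
  intro i hi
  rw [coeff_derivative, h (i + 1) (by omega), zero_mul]

lemma pow_congr_of_order_one_congr {s r : PowerSeries ℂ} {n A : ℕ}
    (hs : s.order = 1) (hr : r.order = 1) (h : X ^ (A + 1) ∣ s - r) :
    X ^ (n + A) ∣ s ^ n - r ^ n := by
  obtain ⟨u, rfl⟩ := X_dvd_of_order_one hs
  obtain ⟨v, rfl⟩ := X_dvd_of_order_one hr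
  rw [← mul_sub, pow_succ'] at h
  have h' := (mul_dvd_mul_iff_left X_ne_zero).1 h
  rw [mul_pow, mul_pow, ← mul_sub, pow_add]
  exact mul_dvd_mul_left _ (h'.trans (sub_dvd_pow_sub_pow u v n))

lemma laurentSubst_X_pow_mul {η : ℂ} (hη : η ≠ 0) {μ : ℕ} {β : PowerSeries ℂ}
    {P : LaurentSeries ℂ}
    (h : HahnSeries.ofPowerSeries ℤ ℂ β = HahnSeries.ofPowerSeries ℤ ℂ (X ^ μ) * P) :
    HahnSeries.ofPowerSeries ℤ ℂ (C ((η ^ μ)⁻¹) * β.subst (rot η)) =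
      HahnSeries.ofPowerSeries ℤ ℂ (X ^ μ) * laurentSubst P (rot η) := by
  have hz := rot_order hη
  have hzs := hasSubst_of_order_one hz
  have h1 := congrArg (laurentSubstHom hz) h
  rw [map_mul, ← laurentSubst_eq_hom, ← laurentSubst_eq_hom, ← laurentSubst_eq_hom,
    laurentSubst_coe hz, laurentSubst_coe hz, subst_pow hzs, subst_X hzs] at h1
  rw [map_mul, h1, ← mul_assoc, ← map_mul]
  congr 2
  rw [rot_eq, mul_pow, ← mul_assoc, ← map_pow, ← map_mul, inv_mul_cancel₀ (pow_ne_zero _ hη),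
    map_one, one_mul]

lemma aevalAeval_rot {F : ℂ[X][Y]} {y₀ η : ℂ} {K : ℕ} (hK : 0 < K) (hη : η ^ K = 1)
    {P : LaurentSeries ℂ}
    (h : Polynomial.aevalAeval (HahnSeries.ofPowerSeries ℤ ℂ (coordSeries y₀ K)) P F = 0) :
    Polynomial.aevalAeval (HahnSeries.ofPowerSeries ℤ ℂ (coordSeries y₀ K))
      (laurentSubst P (rot η)) F = 0 := by
  have hη0 : η ≠ 0 := by rintro rfl; rw [zero_pow hK.ne'] at hη; exact zero_ne_one hη
  have hz := rot_order hη0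
  have hzs := hasSubst_of_order_one hz
  have h1 := congrArg (laurentSubstHom hz) h
  rw [map_zero, map_aevalAeval, ← laurentSubst_eq_hom, ← laurentSubst_eq_hom,
    laurentSubst_coe hz] at h1
  rwa [show (coordSeries y₀ K).subst (rot η) = coordSeries y₀ K by
    rw [coordSeries, subst_add hzs, subst_pow hzs, subst_X hzs, subst_C', rot_eq, mul_pow,
      ← map_pow, hη, map_one, one_mul]] at h1

/-- The conjugates P₂(ζτ) are at least K/n₁ = k in number, each agrees with P₁(ζτ) to order N n₁
after clearing poles, and k · N n₁ = N K exceeds what the discriminant permits. The condition `hmin`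
bounds the rotational symmetry of Z₂; it encodes that n₂ is the ramification order of the second
solution. -/
lemma close_solutions_eq {F : ℂ[X][Y]} (hF : Squarefree F) {y₀ : ℂ} {p₁ p₂ : OnePoint ℂ}
    {n₁ n₂ L K k N : ℕ} (hn₁ : 0 < n₁) (hL : 0 < L) (hLn : L = n₁ * n₂) (hK : 0 < K)
    (hKk : K = k * n₁) (hN : 2 * (degP F - 1) * degY F < N)
    {Z₁ Z₂ : PowerSeries ℂ} (hZ₁ : IsRamifiedSolution F y₀ p₁ L Z₁)
    (hZ₂ : IsRamifiedSolution F y₀ p₂ L Z₂)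
    (hmin : ∀ m : ℕ, m ∣ L → (∀ j, coeff j Z₂ ≠ 0 → m ∣ j) → m ≤ n₁)
    (h₁ : X ^ K ∣ Z₁ - C y₀) (h₂ : X ^ K ∣ Z₂ - C y₀) (hc : coeff K (Z₁ - C y₀) ≠ 0)
    (hcc : coeff K (Z₁ - C y₀) = coeff K (Z₂ - C y₀))
    (hclose : X ^ (K + N * n₁) ∣ Z₁ - Z₂) : Z₁ = Z₂ := by
  obtain ⟨γ, hγ⟩ := IsAlgClosed.exists_pow_nat_eq (coeff K (Z₁ - C y₀)) hK
  have hγ0 : γ ≠ 0 := by rintro rfl; rw [zero_pow hK.ne'] at hγ; exact hc hγ.symm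
  obtain ⟨W₁, S₁, P₁, I₁⟩ := exists_isLocalInverse (L := L) hK hγ0 h₁ hγ
  -- The same γ serves both solutions because their leading coefficients agree; closeness passes to
  -- W, S and P only on a common branch.
  obtain ⟨W₂, S₂, P₂, I₂⟩ := exists_isLocalInverse (L := L) hK hγ0 h₂ (hγ.trans hcc)
  by_contra hne
  have hP : P₂ ≠ P₁ := by
    rintro rfl
    exact hne (I₁.eq_of_P_eq I₂ hL hK)
  set A := N * n₁ with hA
  have cW : X ^ (A + 1) ∣ W₁ - W₂ := by
    refine order_one_congr_of_pow_congr hK I₁.order_W I₂.order_W (I₁.coeff_W.trans I₂.coeff_W.symm) ?_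
    rw [I₁.pow_eq, I₂.pow_eq]
    simpa using hclose
  have cS : X ^ (A + 1) ∣ S₁ - S₂ := inverse_congr I₁.order_W I₂.order_S I₁.S_W I₂.W_S cW
  obtain ⟨e₁, he₁, hu₁⟩ := I₁.exists_derivative_pow_eq hL hγ0
  obtain ⟨e₂, he₂, hu₂⟩ := I₂.exists_derivative_pow_eq hL hγ0
  -- S is known modulo τ^(A+1), so S^L modulo τ^(L+A) and its derivative modulo τ^(L-1+A); dividing
  -- by τ^(L-1) leaves A.
  have ce : X ^ A ∣ e₁ - e₂ := by
    have a := pow_congr_of_order_one_congr (n := L) I₁.order_S I₂.order_S cS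
    rw [show L + A = (L - 1 + A) + 1 by omega] at a
    have b := dvd_derivative_of_dvd a
    rw [map_sub, he₁, he₂, ← mul_sub, pow_add] at b
    exact (mul_dvd_mul_iff_left (pow_ne_zero _ X_ne_zero)).1 b
  have N₁ := I₁.exists_normal_form hL hK he₁ hu₁
  have N₂ := I₂.exists_normal_form hL hK he₂ hu₂
  set β₁ := C (K : ℂ) * X ^ (K - L) * e₁⁻¹ with hβ₁
  set β₂ := C (K : ℂ) * X ^ (K - L) * e₂⁻¹ with hβ₂
  have cβ : X ^ A ∣ β₂ - β₁ := by
    rw [hβ₁, hβ₂, ← mul_sub]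
    exact Dvd.dvd.mul_left (dvd_inv_sub_inv hu₂ hu₁ ((dvd_sub_comm).1 ce)) _
  -- Truncated subtraction separates the cases: for L > K the derivative has a pole of exact order L
  -- - K and β is a unit, otherwise the denominator is 1.
  have hprim : ∀ e : PowerSeries ℂ, constantCoeff e ≠ 0 → L - K = 0 ∨
      constantCoeff (C (K : ℂ) * X ^ (K - L) * e⁻¹) ≠ 0 := by
    intro e he
    rcases Nat.eq_zero_or_pos (L - K) with h | h
    · exact Or.inl h
    · right
      rw [show K - L = 0 by omega, pow_zero, mul_one, map_mul, constantCoeff_C,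
        PowerSeries.constantCoeff_inv]
      exact mul_ne_zero (by exact_mod_cast hK.ne') (inv_ne_zero he)
  obtain ⟨ζ, hζ⟩ : ∃ ζ : ℂ, IsPrimitiveRoot ζ K := ⟨_, Complex.isPrimitiveRoot_exp K hK.ne'⟩
  have hζ0 : ζ ≠ 0 := hζ.ne_zero hK.ne'
  have hζi : ∀ i : ℕ, ζ ^ i ≠ 0 := fun i => pow_ne_zero i hζ0
  have hζK : ∀ i : ℕ, (ζ ^ i) ^ K = 1 := fun i => by
    rw [← pow_mul, mul_comm, pow_mul, hζ.pow_eq_one, one_pow]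
  have hk : 0 < k := Nat.pos_of_ne_zero (by rintro rfl; simp at hKk; omega)
  have hconst : ∀ (β : PowerSeries ℂ) (i : ℕ), (L - K = 0 ∨ constantCoeff β ≠ 0) → L - K = 0 ∨
      constantCoeff (C (((ζ ^ i) ^ (L - K))⁻¹) * β.subst (rot (ζ ^ i)) : PowerSeries ℂ) ≠ 0 := by
    intro β i h
    refine h.imp_right fun h => ?_
    rw [map_mul, constantCoeff_C, constantCoeff_subst_of_zero (by simp [rot])]
    exact mul_ne_zero (inv_ne_zero (pow_ne_zero _ (hζi i))) h
  have hroti : ∀ i j : ℕ, i < j → laurentSubst P₂ (rot (ζ ^ i)) = laurentSubst P₂ (rot (ζ ^ j)) →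
      laurentSubst P₂ (rot (ζ ^ (j - i))) = P₂ := by
    intro i j hij h
    have hinv : (ζ ^ i)⁻¹ ≠ 0 := inv_ne_zero (hζi i)
    have := congrArg (fun f => laurentSubst f (rot (ζ ^ i)⁻¹)) h
    rw [laurentSubst_laurentSubst (rot_order (hζi i)) (rot_order hinv),
      laurentSubst_laurentSubst (rot_order (hζi j)) (rot_order hinv),
      subst_rot_rot hinv, subst_rot_rot hinv, mul_inv_cancel₀ (hζi i), rot_one,
      laurentSubst_X, ← pow_sub₀ ζ hζ0 hij.le] at this
    exact this.symm
  -- A coincidence makes ζ^(j-i) a symmetry of Z₂, of order at most n₁; but K divides (j-i) times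
  -- this order, and (j-i) n₁ < k n₁ = K.
  have hlt : ∀ i j : ℕ, i < j → j < k →
      laurentSubst P₂ (rot (ζ ^ i)) ≠ laurentSubst P₂ (rot (ζ ^ j)) := by
    intro i j hij hj h
    obtain ⟨hηL, hηZ⟩ := I₂.subst_rot_eq_of_P_eq hL hK hγ0 (hζK (j - i)) (hroti i j hij h)
    have hm := hmin (orderOf (ζ ^ (j - i))) (orderOf_dvd_of_pow_eq_one hηL)
      fun l hl => dvd_of_subst_rot_eq hηZ hl
    have h1 := pow_orderOf_eq_one (ζ ^ (j - i))
    rw [← pow_mul] at h1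
    have h2 := hζ.dvd_of_pow_eq_one _ h1
    have hpos : 0 < orderOf (ζ ^ (j - i)) := by
      rw [orderOf_pos_iff, isOfFinOrder_iff_pow_eq_one]
      exact ⟨K, hK, hζK _⟩
    have h3 := Nat.le_of_dvd (Nat.mul_pos (by omega) hpos) h2
    have h4 : (j - i) * orderOf (ζ ^ (j - i)) ≤ (j - i) * n₁ := Nat.mul_le_mul_left _ hm
    have h5 : (j - i) * n₁ < k * n₁ := Nat.mul_lt_mul_of_pos_right (by omega) hn₁
    omega
  have main := card_mul_le_of_close_roots hF (y₀ := y₀) hK (Finset.range k)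
    (by simpa using hk.ne') (μ := L - K) (A := A)
    (β := fun i => C (((ζ ^ i) ^ (L - K))⁻¹) * β₂.subst (rot (ζ ^ i)))
    (β' := fun i => C (((ζ ^ i) ^ (L - K))⁻¹) * β₁.subst (rot (ζ ^ i)))
    (P := fun i => laurentSubst P₂ (rot (ζ ^ i))) (Q := fun i => laurentSubst P₁ (rot (ζ ^ i)))
    (fun i => laurentSubst_X_pow_mul (hζi i) N₂) (fun i => laurentSubst_X_pow_mul (hζi i) N₁)
    (fun i => hconst _ i (hprim e₂ hu₂)) (fun i => hconst _ i (hprim e₁ hu₁))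
    (fun i => aevalAeval_rot hK (hζK i) (I₂.root hZ₂.eval_eq))
    (fun i => aevalAeval_rot hK (hζK i) (I₁.root hZ₁.eval_eq))
    (by
      intro i hi j hj hij
      simp only [Finset.coe_range, Set.mem_Iio] at hi hj
      rcases lt_trichotomy i j with h | h | h
      · exact absurd hij (hlt i j h hj)
      · exact h
      · exact absurd hij.symm (hlt j i h hi))
    (by
      intro i h
      simp only [laurentSubst_eq_hom (rot_order (hζi i))] at h
      exact hP ((laurentSubstHom (rot_order (hζi i))).toRingHom.injective h))
    (by
      intro i
      simp only [← mul_sub]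
      exact Dvd.dvd.mul_left (dvd_subst_sub_of_dvd_left (by simp [rot]) cβ) _)
  rw [Finset.card_range, hA, mul_left_comm, ← hKk] at main
  exact absurd (Nat.le_of_mul_le_mul_right main hK) (by omega)


/-! ### Truncations of solutions -/

lemma firstTermsOfSolution_ramify {L : ℕ} (hL : 0 < L) {Z : PowerSeries ℂ} {y₀ : ℂ} {K : ℕ}
    (h0 : constantCoeff Z = y₀) (h1 : X ^ K ∣ Z - C y₀) (h2 : coeff K (Z - C y₀) ≠ 0) (M : ℕ) :
    firstTermsOfSolution M (ramify hL (HahnSeries.ofPowerSeries ℤ ℂ Z)) =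
      HahnSeries.truncLT ((K : ℚ) / L +
        (M : ℚ) / (ramificationOrder (ramify hL (HahnSeries.ofPowerSeries ℤ ℂ Z)) : ℚ))
        (ramify hL (HahnSeries.ofPowerSeries ℤ ℂ Z)) := by
  have : (ramify hL (HahnSeries.ofPowerSeries ℤ ℂ Z)).coeff 0 = y₀ := by
    have := ramify_coe_coeff hL Z 0
    rw [← h0, ← coeff_zero_eq_constantCoeff_apply, ← this]; simp
  rw [firstTermsOfSolution, this, order_ramify_sub hL h1 h2]

lemma hasDenominator_C (c : ℂ) : HasDenominator (HahnSeries.C c) 1 := by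
  rw [← ramify_C one_pos]; exact hasDenominator_ramify _ _

lemma firstTermsOfSolution_C {M : ℕ} (hM : 0 < M) (c : ℂ) :
    firstTermsOfSolution M (HahnSeries.C c) = HahnSeries.C c := by
  have hr := (ramificationOrder_spec ⟨1, one_pos, hasDenominator_C c⟩).1
  have hpos : (0 : ℚ) < (M : ℚ) / (ramificationOrder (HahnSeries.C c) : ℚ) :=
    div_pos (by exact_mod_cast hM) (by exact_mod_cast hr)
  rw [firstTermsOfSolution]
  have : (HahnSeries.C c : HahnSeries ℚ ℂ).coeff 0 = c := by simp
  -- The zero series has order 0 by convention, so the cut-off is positive and the constant term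
  -- survives.
  rw [this, sub_self, HahnSeries.order_zero, zero_add]
  ext q
  rcases lt_or_ge q ((M : ℚ) / (ramificationOrder (HahnSeries.C c) : ℚ)) with h | h
  · rw [HahnSeries.coeff_truncLT_of_lt h]
  · rw [HahnSeries.coeff_truncLT_of_le h, HahnSeries.C_apply,
      HahnSeries.coeff_single_of_ne (hpos.trans_le h).ne']

lemma C_mem_constants (c : ℂ) : (HahnSeries.C c : HahnSeries ℚ ℂ) ∈ constants := ⟨c, rfl⟩

lemma coeff_eq_zero_of_mem_constants {y : HahnSeries ℚ ℂ} (hy : y ∈ constants) {q : ℚ}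
    (hq : q ≠ 0) : y.coeff q = 0 := by
  obtain ⟨c, rfl⟩ := hy
  rw [HahnSeries.C_apply, HahnSeries.coeff_single_of_ne hq]

/-- A nonconstant solution in the coordinate `x^{1/L}`, with its leading term. -/
lemma exists_leading_data {F : ℂ[X][Y]} {y₀ : ℂ} {p₀ : OnePoint ℂ} {y : HahnSeries ℚ ℂ}
    (hy : y ∈ solutions F y₀ p₀) (hc : y ∉ constants) {L : ℕ} (hL : 0 < L)
    (hd : HasDenominator y L) :
    ∃ (Z : PowerSeries ℂ) (K : ℕ), ramify hL (HahnSeries.ofPowerSeries ℤ ℂ Z) = y ∧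
      IsRamifiedSolution F y₀ p₀ L Z ∧ 0 < K ∧ X ^ K ∣ Z - C y₀ ∧ coeff K (Z - C y₀) ≠ 0 := by
  obtain ⟨Z, rfl, hZ⟩ := exists_isRamifiedSolution hy hL hd
  rw [ramify_coe_mem_constants_iff, hZ.constantCoeff_eq] at hc
  obtain ⟨K, hK, h1, h2⟩ := exists_leading_term hZ.constantCoeff_eq hc
  exact ⟨Z, K, rfl, hZ, hK, h1, h2⟩

lemma coeff_sub_C_of_pos {Z : PowerSeries ℂ} {y₀ : ℂ} {K : ℕ} (hK : 0 < K) :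
    coeff K (Z - C y₀) = coeff K Z := by
  rw [map_sub, coeff_C, if_neg hK.ne', sub_zero]

lemma firstTermsOfSolution_notMem_constants {F : ℂ[X][Y]} {y₀ : ℂ} {p₀ : OnePoint ℂ}
    {y : HahnSeries ℚ ℂ} (hy : y ∈ solutions F y₀ p₀) (hc : y ∉ constants) {M : ℕ} (hM : 0 < M) :
    firstTermsOfSolution M y ∉ constants := by
  obtain ⟨hn, hd⟩ := ramificationOrder_spec hy.1
  obtain ⟨Z, K, hZy, hZ, hK, h1, h2⟩ := exists_leading_data hy hc hn hd
  intro h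
  have hq : (K : ℚ) / ramificationOrder y ≠ 0 :=
    div_ne_zero (by exact_mod_cast hK.ne') (by exact_mod_cast hn.ne')
  have h3 := coeff_eq_zero_of_mem_constants h hq
  have hT := firstTermsOfSolution_ramify hn hZ.constantCoeff_eq h1 h2 M
  rw [hZy] at hT
  rw [hT, HahnSeries.coeff_truncLT_of_lt (lt_add_of_pos_right _
    (div_pos (by exact_mod_cast hM) (by exact_mod_cast hn)))] at h3
  have h4 := ramify_coe_coeff hn Z K
  rw [hZy, h3] at h4
  rw [coeff_sub_C_of_pos hK] at h2
  exact h2 h4.symm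

/-- Nonconstant solutions with the same truncation are equal. -/
lemma firstTermsOfSolution_injOn {F : ℂ[X][Y]} (hF : Squarefree F) {y₀ : ℂ} {p₁ p₂ : OnePoint ℂ}
    {N : ℕ} (hN : 2 * (degP F - 1) * degY F < N) {y₁ y₂ : HahnSeries ℚ ℂ}
    (hy₁ : y₁ ∈ solutions F y₀ p₁) (hy₂ : y₂ ∈ solutions F y₀ p₂) (hc₁ : y₁ ∉ constants)
    (hc₂ : y₂ ∉ constants) (h : firstTermsOfSolution N y₁ = firstTermsOfSolution N y₂) :
    y₁ = y₂ := by
  wlog hle : ramificationOrder y₁ ≤ ramificationOrder y₂ generalizing y₁ y₂ p₁ p₂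
  · exact (this hy₂ hy₁ hc₂ hc₁ h.symm (by omega)).symm
  obtain ⟨hn₁, hd₁⟩ := ramificationOrder_spec hy₁.1
  obtain ⟨hn₂, hd₂⟩ := ramificationOrder_spec hy₂.1
  set n₁ := ramificationOrder y₁ with hn₁d
  set n₂ := ramificationOrder y₂ with hn₂d
  have hL : 0 < n₁ * n₂ := Nat.mul_pos hn₁ hn₂
  have hn₁q : (0 : ℚ) < n₁ := by exact_mod_cast hn₁
  have hn₂q : (0 : ℚ) < n₂ := by exact_mod_cast hn₂
  have hNq : (0 : ℚ) < N := by exact_mod_cast (by omega : 0 < N)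
  have hLq : (0 : ℚ) < ((n₁ * n₂ : ℕ) : ℚ) := by exact_mod_cast hL
  obtain ⟨Z₁, K₁, hZy₁, hZ₁, hK₁, a₁, b₁⟩ := exists_leading_data hy₁ hc₁ hL (hasDenominator_mul hd₁ n₂)
  obtain ⟨Z₂, K₂, hZy₂, hZ₂, hK₂, a₂, b₂⟩ := exists_leading_data hy₂ hc₂ hL
    (by rw [mul_comm]; exact hasDenominator_mul hd₂ n₁)
  have T₁ := firstTermsOfSolution_ramify hL hZ₁.constantCoeff_eq a₁ b₁ N
  have T₂ := firstTermsOfSolution_ramify hL hZ₂.constantCoeff_eq a₂ b₂ N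
  rw [hZy₁, ← hn₁d] at T₁
  rw [hZy₂, ← hn₂d] at T₂
  rw [T₁, T₂] at h
  have c₁ : ∀ j : ℕ, y₁.coeff ((j : ℚ) / ((n₁ * n₂ : ℕ) : ℚ)) = coeff j Z₁ := fun j => by
    rw [← hZy₁]; exact ramify_coe_coeff hL Z₁ j
  have c₂ : ∀ j : ℕ, y₂.coeff ((j : ℚ) / ((n₁ * n₂ : ℕ) : ℚ)) = coeff j Z₂ := fun j => by
    rw [← hZy₂]; exact ramify_coe_coeff hL Z₂ j
  have hle' : (N : ℚ) / n₂ ≤ (N : ℚ) / n₁ :=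
    div_le_div_of_nonneg_left hNq.le hn₁q (by exact_mod_cast hle)
  -- The leading term of one series survives its truncation and must occur in the other; used in
  -- both directions, this equates the leading exponents.
  have key : ∀ {K K' : ℕ} {a b : ℚ} {u v : HahnSeries ℚ ℂ} {Z Z' : PowerSeries ℂ}, 0 < a → 0 < K →
      (∀ j : ℕ, u.coeff ((j : ℚ) / ((n₁ * n₂ : ℕ) : ℚ)) = coeff j Z) →
      (∀ j : ℕ, v.coeff ((j : ℚ) / ((n₁ * n₂ : ℕ) : ℚ)) = coeff j Z') →
      HahnSeries.truncLT ((K : ℚ) / ((n₁ * n₂ : ℕ) : ℚ) + a) u = HahnSeries.truncLT b v →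
      coeff K (Z - C y₀) ≠ 0 → X ^ K' ∣ Z' - C y₀ → K' ≤ K := by
    intro K K' a b u v Z Z' ha hK hu hv huv hZ hZ'
    by_contra! hlt
    have e := congrArg (fun f => f.coeff ((K : ℚ) / ((n₁ * n₂ : ℕ) : ℚ))) huv
    rw [HahnSeries.coeff_truncLT_of_lt (lt_add_of_pos_right _ ha), hu] at e
    have hZ'0 := X_pow_dvd_iff.1 hZ' K hlt
    rw [coeff_sub_C_of_pos hK] at hZ hZ'0
    rcases lt_or_ge ((K : ℚ) / ((n₁ * n₂ : ℕ) : ℚ)) b with hb | hb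
    · rw [HahnSeries.coeff_truncLT_of_lt hb, hv, hZ'0] at e
      exact hZ e
    · rw [HahnSeries.coeff_truncLT_of_le hb] at e
      exact hZ e
  have hKK : K₁ = K₂ := le_antisymm
    (key (div_pos hNq hn₂q) hK₂ c₂ c₁ h.symm b₂ a₁) (key (div_pos hNq hn₁q) hK₁ c₁ c₂ h b₁ a₂)
  subst hKK
  -- As n₁ ≤ n₂, the smaller cut-off is K₁/L + N/n₂ = (K₁ + N n₁)/L with L = n₁n₂.
  have hagree : ∀ j : ℕ, j < K₁ + N * n₁ → coeff j Z₁ = coeff j Z₂ := by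
    intro j hj
    have hj2 : (j : ℚ) / ((n₁ * n₂ : ℕ) : ℚ) < (K₁ : ℚ) / ((n₁ * n₂ : ℕ) : ℚ) + (N : ℚ) / n₂ := by
      have : (N : ℚ) / n₂ = ((N * n₁ : ℕ) : ℚ) / ((n₁ * n₂ : ℕ) : ℚ) := by
        push_cast; field_simp
      rw [this, ← add_div, div_lt_div_iff_of_pos_right hLq]
      exact_mod_cast hj
    have e := congrArg (fun f => f.coeff ((j : ℚ) / ((n₁ * n₂ : ℕ) : ℚ))) h
    rwa [HahnSeries.coeff_truncLT_of_lt hj2,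
      HahnSeries.coeff_truncLT_of_lt (hj2.trans_le (add_le_add_right hle' _)), c₁, c₂] at e
  -- The exponent K₁/(n₁n₂) occurs in y₂, so it lies in (1/n₂)ℤ.
  have hKn : ∃ k, K₁ = k * n₁ := by
    rw [coeff_sub_C_of_pos hK₁, ← c₂] at b₂
    obtain ⟨i, hi⟩ := hd₂ _ b₂
    have : (K₁ : ℚ) = i * n₁ := by
      rw [← hi]; push_cast; field_simp
    have hi' : (K₁ : ℤ) = i * n₁ := by exact_mod_cast this
    have hi0 : 0 ≤ i := by
      by_contra! hneg
      have : (0 : ℤ) < K₁ := by exact_mod_cast hK₁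
      nlinarith
    lift i to ℕ using hi0
    exact ⟨i, by exact_mod_cast hi'⟩
  obtain ⟨k, hk⟩ := hKn
  have hZZ : Z₁ = Z₂ := by
    refine close_solutions_eq hF hn₁ hL rfl hK₁ hk hN hZ₁ hZ₂ ?_ a₁ a₂ b₁ ?_ ?_
    -- If Z₂ is a series in t^m, then y₂ has denominator L/m, so n₂ ≤ n₁n₂/m.
    · intro m hm hj
      have hm0 : 0 < m := Nat.pos_of_dvd_of_pos hm hL
      have := ramificationOrder_le (Nat.div_pos (Nat.le_of_dvd hL hm) hm0)
        (hasDenominator_of_dvd hL hm (Z := HahnSeries.ofPowerSeries ℤ ℂ Z₂) (by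
          intro j hjne
          rcases lt_or_ge j 0 with hj0 | hj0
          · exact absurd (coeff_ofPowerSeries_neg _ hj0) hjne
          · lift j to ℕ using hj0
            rw [coeff_ofPowerSeries_nat] at hjne
            exact_mod_cast hj j hjne))
      rw [hZy₂, ← hn₂d, Nat.le_div_iff_mul_le hm0, mul_comm n₁] at this
      exact Nat.le_of_mul_le_mul_left this hn₂
    · rw [coeff_sub_C_of_pos hK₁, coeff_sub_C_of_pos hK₁]
      exact hagree _ (Nat.lt_add_of_pos_right (Nat.mul_pos (by omega) hn₁))
    · rw [X_pow_dvd_iff]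
      intro j hj
      rw [map_sub, hagree j hj, sub_self]
  rw [← hZy₁, ← hZy₂, hZZ]


/-! ### Equivalence of parametrizations -/

lemma equivalent_symm {A B : LaurentSeries ℂ × LaurentSeries ℂ} (h : Equivalent A B) :
    Equivalent B A := by
  obtain ⟨s, hs, h1, h2⟩ := h
  obtain ⟨r, hr, -, hsr, -⟩ := exists_subst_inverse hs
  exact ⟨r, hr, by rw [← h1, laurentSubst_cancel hs hr hsr],
    by rw [← h2, laurentSubst_cancel hs hr hsr]⟩

lemma equivalent_trans {A B D : LaurentSeries ℂ × LaurentSeries ℂ} (h : Equivalent A B)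
    (h' : Equivalent B D) : Equivalent A D := by
  obtain ⟨s, hs, h1, h2⟩ := h
  obtain ⟨r, hr, h3, h4⟩ := h'
  exact ⟨s.subst r, (order_one_subst hs hr).1,
    by rw [← laurentSubst_laurentSubst hs hr, h1, h3],
    by rw [← laurentSubst_laurentSubst hs hr, h2, h4]⟩

lemma laurentSubst_C {s : PowerSeries ℂ} (hs : s.order = 1) (c : ℂ) :
    laurentSubst (HahnSeries.C c) s = HahnSeries.C c := by
  rw [laurentSubst_eq hs, laurentSubstRingHom_C]

lemma isParametrization_of_equivalent {F : ℂ[X][Y]} {y₀ : ℂ} {p₀ : OnePoint ℂ}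
    {A B : LaurentSeries ℂ × LaurentSeries ℂ} (hA : IsParametrization F y₀ p₀ A)
    (h : Equivalent A B) : IsParametrization F y₀ p₀ B := by
  obtain ⟨s, hs, h1, h2⟩ := h
  obtain ⟨hc, hF, hy, hp⟩ := hA
  refine ⟨?_, ?_, ?_, ?_⟩
  · rintro ⟨c, d, hB⟩
    obtain ⟨r, hr, -, hsr, -⟩ := exists_subst_inverse hs
    refine hc ⟨c, d, Prod.ext ?_ ?_⟩
    · rw [← laurentSubst_cancel hs hr hsr A.1, h1, hB, laurentSubst_C hr]
    · rw [← laurentSubst_cancel hs hr hsr A.2, h2, hB, laurentSubst_C hr]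
  · rw [← h1, ← h2, laurentSubst_eq_hom hs, laurentSubst_eq_hom hs, ← map_aevalAeval, hF, map_zero]
  · rw [← h1, valueAtZero_laurentSubst hs, hy]
  · rw [← h2, valueAtZero_laurentSubst hs, hp]

lemma irreducible_of_equivalent {F : ℂ[X][Y]} {y₀ : ℂ} {p₀ : OnePoint ℂ}
    {A B : LaurentSeries ℂ × LaurentSeries ℂ} (hA : A ∈ irreducibleParametrizations F y₀ p₀)
    (h : Equivalent A B) : B ∈ irreducibleParametrizations F y₀ p₀ := by
  refine ⟨isParametrization_of_equivalent hA.1 h, fun hB => hA.2 ?_⟩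
  obtain ⟨m, hm, D, hD, h1⟩ := hB
  exact ⟨m, hm, D, equivalent_trans h hD, h1⟩

/-! ### Classical Puiseux parametrizations -/

lemma exists_C_of_isAlgebraic {b : LaurentSeries ℂ} (hb : IsAlgebraic ℂ b) :
    ∃ c, b = HahnSeries.C c := by
  have := minpoly.mem_range_of_degree_eq_one ℂ b
    (IsAlgClosed.degree_eq_one_of_irreducible ℂ (minpoly.irreducible hb.isIntegral))
  obtain ⟨c, hc⟩ := this
  exact ⟨c, by rw [← hc, algebraMap_hahnSeries]⟩

lemma aevalAeval_C {F : ℂ[X][Y]} (y₀ : ℂ) (b : LaurentSeries ℂ) :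
    Polynomial.aevalAeval (HahnSeries.C y₀) b F =
      Polynomial.aeval b (F.map (Polynomial.evalRingHom y₀)) := by
  rw [aevalAeval_eq_eval₂, Polynomial.aeval_def, Polynomial.eval₂_map]
  congr 1
  ext
  · simp [algebraMap_hahnSeries]
  · simp [algebraMap_hahnSeries]

lemma map_evalRingHom_ne_zero {F : ℂ[X][Y]}
    (hy : ∀ g : Polynomial ℂ, Polynomial.C g ∣ F → IsUnit g) (y₀ : ℂ) :
    F.map (Polynomial.evalRingHom y₀) ≠ 0 := by
  intro h
  have hd : Polynomial.C (Polynomial.X - Polynomial.C y₀) ∣ F := by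
    rw [Polynomial.C_dvd_iff_dvd_coeff]
    intro i
    rw [Polynomial.dvd_iff_isRoot]
    have := congrArg (fun g => Polynomial.coeff g i) h
    simpa using this
  exact Polynomial.not_isUnit_X_sub_C y₀ (hy _ hd)

/-- If the first component were c, the polynomial F(c, p) would be non-zero, as y - c does not
divide F; the second component would be algebraic over ℂ, hence constant too. -/
lemma parametrization_fst_ne_C {F : ℂ[X][Y]}
    (hy : ∀ g : Polynomial ℂ, Polynomial.C g ∣ F → IsUnit g) {y₀ : ℂ} {p₀ : OnePoint ℂ}
    {A : LaurentSeries ℂ × LaurentSeries ℂ} (hA : IsParametrization F y₀ p₀ A) (c : ℂ) :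
    A.1 ≠ HahnSeries.C c := by
  intro h
  have h1 := hA.2.1
  rw [h, aevalAeval_C] at h1
  obtain ⟨d, hd⟩ := exists_C_of_isAlgebraic ⟨_, map_evalRingHom_ne_zero hy c, h1⟩
  exact hA.1 ⟨c, d, Prod.ext h hd⟩

lemma coe_coordSeries (y₀ : ℂ) (k : ℕ) : HahnSeries.ofPowerSeries ℤ ℂ (coordSeries y₀ k) =
    HahnSeries.C y₀ + HahnSeries.single (k : ℤ) 1 := by
  rw [coordSeries, map_add, HahnSeries.ofPowerSeries_C, HahnSeries.ofPowerSeries_X_pow]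

lemma exists_classical_equivalent {F : ℂ[X][Y]}
    (hy : ∀ g : Polynomial ℂ, Polynomial.C g ∣ F → IsUnit g) {y₀ : ℂ} {p₀ : OnePoint ℂ}
    {A : LaurentSeries ℂ × LaurentSeries ℂ} (hA : IsParametrization F y₀ p₀ A) :
    ∃ B, Equivalent A B ∧ IsClassical y₀ B := by
  obtain ⟨Z, hZ, h0⟩ := exists_coe_of_valueAtZero hA.2.2.1
  have hne : Z ≠ C y₀ := by
    intro h
    apply parametrization_fst_ne_C hy hA y₀
    rw [← hZ, h, HahnSeries.ofPowerSeries_C]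
  obtain ⟨K, hK, h1, h2⟩ := exists_leading_term h0 hne
  obtain ⟨γ, hγ⟩ := IsAlgClosed.exists_pow_nat_eq (coeff K (Z - C y₀)) hK
  have hγ0 : γ ≠ 0 := by rintro rfl; rw [zero_pow hK.ne'] at hγ; exact h2 hγ.symm
  -- Only the reparametrization S is used, so the value of L is immaterial.
  obtain ⟨W, S, P, I⟩ := exists_isLocalInverse (L := 1) hK hγ0 h1 hγ
  refine ⟨(laurentSubst A.1 S, laurentSubst A.2 S), ⟨S, I.order_S, rfl, rfl⟩, K, hK, ?_⟩
  rw [← hZ, laurentSubst_coe I.order_S, I.subst_S, coe_coordSeries]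

/-- Every place contains a classical Puiseux parametrization, so representatives exist. -/
lemma exists_placeRepresentatives {F : ℂ[X][Y]}
    (hy : ∀ g : Polynomial ℂ, Polynomial.C g ∣ F → IsUnit g) (y₀ : ℂ) (p₀ : OnePoint ℂ) :
    ∃ R, IsPlaceRepresentatives F y₀ p₀ R := by
  classical
  -- The choice depends only on the predicate, which is the same for equivalent A; this yields one
  -- representative per class.
  let rep : LaurentSeries ℂ × LaurentSeries ℂ → LaurentSeries ℂ × LaurentSeries ℂ := fun A =>
    Classical.epsilon fun B => Equivalent A B ∧ IsClassical y₀ B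
  have hrep : ∀ A ∈ irreducibleParametrizations F y₀ p₀,
      Equivalent A (rep A) ∧ IsClassical y₀ (rep A) := fun A hA =>
    Classical.epsilon_spec (exists_classical_equivalent hy hA.1)
  have hcongr : ∀ A B, Equivalent A B → rep A = rep B := by
    intro A B hAB
    have : (fun D => Equivalent A D ∧ IsClassical y₀ D) =
        fun D => Equivalent B D ∧ IsClassical y₀ D := by
      funext D
      exact propext ⟨fun h => ⟨equivalent_trans (equivalent_symm hAB) h.1, h.2⟩,
        fun h => ⟨equivalent_trans hAB h.1, h.2⟩⟩
    simp only [rep, this]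
  refine ⟨rep '' irreducibleParametrizations F y₀ p₀, ?_, ?_⟩
  · rintro _ ⟨A, hA, rfl⟩
    exact ⟨irreducible_of_equivalent hA (hrep A hA).1, (hrep A hA).2⟩
  · intro A hA
    refine ⟨rep A, ⟨⟨A, hA, rfl⟩, (hrep A hA).1⟩, ?_⟩
    rintro _ ⟨⟨B, hB, rfl⟩, hAB⟩
    exact hcongr _ _ (equivalent_trans (hrep B hB).1 (equivalent_symm hAB))

/-! ### Nonconstant solutions give irreducible parametrizations -/

lemma ofPowerSeries_rot (ζ : ℂ) :
    HahnSeries.ofPowerSeries ℤ ℂ (rot ζ) = HahnSeries.single 1 ζ := by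
  rw [rot_eq, map_mul, HahnSeries.ofPowerSeries_C, HahnSeries.ofPowerSeries_X,
    HahnSeries.C_apply, HahnSeries.single_mul_single, zero_add, mul_one]

lemma single_one_zpow (ζ : ℂ) (d : ℤ) :
    (HahnSeries.single (1 : ℤ) ζ : LaurentSeries ℂ) ^ d = HahnSeries.single d (ζ ^ d) := by
  have h1 : (HahnSeries.single (1 : ℤ) ζ : LaurentSeries ℂ) =
      HahnSeries.C ζ * HahnSeries.single 1 1 := by
    rw [HahnSeries.C_apply, HahnSeries.single_mul_single, zero_add, mul_one]
  rw [h1, mul_zpow, ← map_zpow₀, ← RatFunc.single_zpow, HahnSeries.C_apply,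
    HahnSeries.single_mul_single, zero_add, mul_one]

lemma coeff_laurentSubst_rot {ζ : ℂ} (hζ : ζ ≠ 0) (f : LaurentSeries ℂ) (j : ℤ) :
    (laurentSubst f (rot ζ)).coeff j = ζ ^ j * f.coeff j := by
  have hf := LaurentSeries.single_order_mul_powerSeriesPart f
  conv_rhs => rw [← hf]
  rw [laurentSubst, ofPowerSeries_rot, single_one_zpow, coeff_single_mul', coeff_single_mul']
  rcases lt_or_ge (j - f.order) 0 with h | h
  · rw [coeff_ofPowerSeries_neg _ h, coeff_ofPowerSeries_neg _ h]; simp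
  · obtain ⟨i, hi⟩ := Int.eq_ofNat_of_zero_le h
    rw [hi, coeff_ofPowerSeries_nat, coeff_ofPowerSeries_nat, coeff_subst_rot,
      show j = f.order + i by omega, zpow_add₀ hζ, zpow_natCast]
    ring

lemma coeff_pow_of_order_one {s : PowerSeries ℂ} (hs : s.order = 1) (n : ℕ) :
    coeff n (s ^ n) = coeff 1 s ^ n := by
  obtain ⟨u, rfl⟩ := X_dvd_of_order_one hs
  have := coeff_X_pow_mul (u ^ n) n 0
  rw [zero_add] at this
  rw [mul_pow, this, coeff_zero_eq_constantCoeff_apply, map_pow, coeff_one_X_mul]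

/-- A symmetry of a solution and its derivative is a rotation of the ramification. -/
lemma eq_rot_of_fix {L : ℕ} (hL : 0 < L) {Z w : PowerSeries ℂ} (hw : w.order = 1)
    (hZ : Z.subst w = Z)
    (hD0 : ramifiedDeriv L (HahnSeries.ofPowerSeries ℤ ℂ Z) ≠ 0)
    (hD : laurentSubst (ramifiedDeriv L (HahnSeries.ofPowerSeries ℤ ℂ Z)) w =
      ramifiedDeriv L (HahnSeries.ofPowerSeries ℤ ℂ Z)) :
    w = rot (coeff 1 w) ∧ coeff 1 w ^ L = 1 := by
  have hws := hasSubst_of_order_one hw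
  have hspec := ramifiedDeriv_spec hL Z
  set D := ramifiedDeriv L (HahnSeries.ofPowerSeries ℤ ℂ Z)
  have h1 := congrArg (laurentSubstHom hw) hspec
  rw [map_mul, ← laurentSubst_eq_hom, ← laurentSubst_eq_hom, ← laurentSubst_eq_hom, hD,
    laurentSubst_coe hw, laurentSubst_coe hw, subst_mul hws, subst_C', subst_pow hws,
    subst_X hws] at h1
  have h2 := derivative_subst (f := Z) hws
  rw [hZ] at h2
  -- Composing L t^(L-1) D = Z' with w and multiplying by w' gives (w^L)' D = Z' = (t^L)' D.
  have h3 : w ^ L = (X : PowerSeries ℂ) ^ L := by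
    refine IsLocalInverse.pow_eq_of_derivative_mul_eq hw order_X hD0 ?_
    rw [derivative_pow, derivative_pow, derivative_X, mul_one]
    have e1 : (C (L : ℂ) : PowerSeries ℂ) = (L : PowerSeries ℂ) := by simp
    rw [e1] at hspec h1
    rw [hspec, h2, map_mul _ _ (derivative ℂ w), map_mul _ _ (derivative ℂ w), ← h1]
    ring
  have h4 : coeff 1 w ^ L = 1 := by
    rw [← coeff_pow_of_order_one hw, h3]; simp
  refine ⟨?_, h4⟩
  refine order_one_eq_of_pow_eq hL hw (rot_order (order_eq_one_iff.1 hw).2) ?_ ?_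
  · rw [coeff_one_rot]
  · rw [h3, rot_eq, mul_pow, ← map_pow, h4, map_one, one_mul]

lemma ramifiedDeriv_ne_zero {L : ℕ} (hL : 0 < L) {Z : PowerSeries ℂ} {y₀ : ℂ}
    (h0 : constantCoeff Z = y₀) (hc : Z ≠ C y₀) :
    ramifiedDeriv L (HahnSeries.ofPowerSeries ℤ ℂ Z) ≠ 0 := by
  intro h
  have := ramifiedDeriv_spec hL Z
  rw [h, mul_zero, eq_comm, map_eq_zero_iff _ HahnSeries.ofPowerSeries_injective] at this
  apply hc
  refine derivative.ext (by rw [this, derivative_C]) ?_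
  rw [h0, constantCoeff_C]

/-- If a substitution s brought the pair into ℂ((t^m))², the rotation by a primitive m-th root of
unity ζ, conjugated by s, would fix both the series and its derivative. By `eq_rot_of_fix` this
conjugate is itself t ↦ ζt with ζ^n = 1, so m divides n and n/m is a smaller denominator. -/
lemma solution_mem_irreducibleParametrizations {F : ℂ[X][Y]} {y₀ : ℂ} {p₀ : OnePoint ℂ} {n : ℕ}
    (hn : 0 < n) {Z : PowerSeries ℂ} (hZ : IsRamifiedSolution F y₀ p₀ n Z) (hc : Z ≠ C y₀)
    (hr : ramificationOrder (ramify hn (HahnSeries.ofPowerSeries ℤ ℂ Z)) = n) :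
    (HahnSeries.ofPowerSeries ℤ ℂ Z, ramifiedDeriv n (HahnSeries.ofPowerSeries ℤ ℂ Z)) ∈
      irreducibleParametrizations F y₀ p₀ := by
  refine ⟨⟨?_, hZ.eval_eq, by rw [valueAtZero_coe, hZ.constantCoeff_eq], hZ.value_eq⟩, ?_⟩
  · rintro ⟨c, d, h⟩
    have h1 : HahnSeries.ofPowerSeries ℤ ℂ Z = HahnSeries.C c := congrArg Prod.fst h
    rw [← HahnSeries.ofPowerSeries_C] at h1
    have h2 := HahnSeries.ofPowerSeries_injective h1
    apply hc
    rw [← hZ.constantCoeff_eq, h2, constantCoeff_C]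
  · rintro ⟨m, hm, B, ⟨s, hs, h1, h2⟩, hB1, hB2⟩
    have hm0 : m ≠ 0 := by omega
    obtain ⟨ζ, hζ⟩ : ∃ ζ : ℂ, IsPrimitiveRoot ζ m := ⟨_, Complex.isPrimitiveRoot_exp m hm0⟩
    have hζ0 : ζ ≠ 0 := hζ.ne_zero hm0
    have hfix : ∀ f : LaurentSeries ℂ, (∀ j ∈ f.support, (m : ℤ) ∣ j) →
        laurentSubst f (rot ζ) = f := by
      intro f hf
      ext j
      rw [coeff_laurentSubst_rot hζ0]
      by_cases hj : f.coeff j = 0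
      · rw [hj, mul_zero]
      · obtain ⟨i, rfl⟩ := hf j hj
        rw [zpow_mul, zpow_natCast, hζ.pow_eq_one, one_zpow, one_mul]
    obtain ⟨r, hro, hrc, hsr, hrs⟩ := exists_subst_inverse hs
    have hz := rot_order hζ0
    obtain ⟨hzr, hzrc⟩ := order_one_subst hz hro
    obtain ⟨hw, hwc⟩ := order_one_subst hs hzr
    set w : PowerSeries ℂ := s.subst ((rot ζ).subst r : PowerSeries ℂ) with hwd
    have hwζ : coeff 1 w = ζ := by
      rw [hwc, hzrc, coeff_one_rot, hrc]
      have := (order_eq_one_iff.1 hs).2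
      field_simp
    have hfix2 : ∀ f g : LaurentSeries ℂ, laurentSubst f s = g → (∀ j ∈ g.support, (m : ℤ) ∣ j) →
        laurentSubst f w = f := by
      intro f g hfg hg
      rw [hwd, ← laurentSubst_laurentSubst hs hzr, hfg, ← laurentSubst_laurentSubst hz hro,
        hfix g hg, ← hfg, laurentSubst_cancel hs hro hsr]
    have hZw := hfix2 _ _ h1 hB1
    simp only at hZw
    rw [laurentSubst_coe hw] at hZw
    have hZw' := HahnSeries.ofPowerSeries_injective hZw
    obtain ⟨hrot, hpow⟩ := eq_rot_of_fix hn hw hZw'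
      (ramifiedDeriv_ne_zero hn hZ.constantCoeff_eq hc) (hfix2 _ _ h2 hB2)
    rw [hwζ] at hrot hpow
    rw [hrot] at hZw'
    have hmn : m ∣ n := hζ.dvd_of_pow_eq_one _ hpow
    have hden := hasDenominator_of_dvd hn hmn (Z := HahnSeries.ofPowerSeries ℤ ℂ Z) (by
      intro j hj
      rcases lt_or_ge j 0 with hj0 | hj0
      · exact absurd (coeff_ofPowerSeries_neg _ hj0) hj
      · lift j to ℕ using hj0
        rw [coeff_ofPowerSeries_nat] at hj
        have := dvd_of_subst_rot_eq hZw' hj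
        rw [← hζ.eq_orderOf] at this
        exact_mod_cast this)
    have hle := ramificationOrder_le (Nat.div_pos (Nat.le_of_dvd hn hmn) (by omega)) hden
    rw [hr] at hle
    exact absurd hle (not_le.2 (Nat.div_lt_self hn hm))


/-! ### The associated differential equation -/

/-- The associated equation says that `b(s)` is the derivative of the candidate solution. -/
lemma associatedEquation_iff {y₀ : ℂ} {k n : ℕ} (hn : 0 < n) {b : LaurentSeries ℂ}
    {s : PowerSeries ℂ} (hs : s.order = 1) :
    AssociatedEquation (HahnSeries.ofPowerSeries ℤ ℂ (coordSeries y₀ k), b) n s ↔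
      ramifiedDeriv n (HahnSeries.ofPowerSeries ℤ ℂ ((coordSeries y₀ k).subst s)) =
        laurentSubst b s := by
  have hss := hasSubst_of_order_one hs
  have hspec := ramifiedDeriv_spec hn ((coordSeries y₀ k).subst s)
  rw [derivative_subst hss, map_mul, map_mul, HahnSeries.ofPowerSeries_C,
    HahnSeries.ofPowerSeries_X_pow] at hspec
  have hne : (HahnSeries.C (n : ℂ) * HahnSeries.single ((n - 1 : ℕ) : ℤ) 1 : LaurentSeries ℂ) ≠ 0 := by
    rw [HahnSeries.C_apply, HahnSeries.single_mul_single]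
    refine HahnSeries.single_ne_zero ?_
    rw [mul_one]; exact_mod_cast hn.ne'
  rw [AssociatedEquation]
  simp only
  rw [derivative_coe', laurentSubst_coe hs, ← hspec,
    show ((n : ℤ) - 1) = ((n - 1 : ℕ) : ℤ) by omega]
  exact ⟨fun h => mul_left_cancel₀ hne h, fun h => by rw [h]⟩

lemma laurentSubst_single_mul {s : PowerSeries ℂ} (hs : s.order = 1) (r : ℤ) (u : PowerSeries ℂ) :
    laurentSubst (HahnSeries.single r 1 * HahnSeries.ofPowerSeries ℤ ℂ u) s =
      HahnSeries.ofPowerSeries ℤ ℂ s ^ r * HahnSeries.ofPowerSeries ℤ ℂ (u.subst s) := by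
  rw [laurentSubst_eq hs, map_mul, laurentSubstRingHom_coe,
    show (HahnSeries.single r 1 : LaurentSeries ℂ) = HahnSeries.single 1 1 ^ r from
      RatFunc.single_zpow r, map_zpow₀, ← PowerSeries.coe_X, laurentSubstRingHom_coe,
    subst_X (hasSubst_of_order_one hs)]

/-- Separation of variables in the associated equation. -/
lemma associatedEquation_iff_subst_eq {y₀ : ℂ} {k n : ℕ} (hn : 0 < n) {r : ℤ}
    (hr : (n : ℤ) = (k : ℤ) - r) {u G : PowerSeries ℂ} (hu : constantCoeff u ≠ 0)
    (hG : derivative ℂ G = C (k : ℂ) * X ^ (n - 1) * u⁻¹) (hG0 : constantCoeff G = 0)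
    (hk : 0 < k) {s : PowerSeries ℂ} (hs : s.order = 1) :
    AssociatedEquation (HahnSeries.ofPowerSeries ℤ ℂ (coordSeries y₀ k),
      HahnSeries.single r 1 * HahnSeries.ofPowerSeries ℤ ℂ u) n s ↔ G.subst s = X ^ n := by
  have hss := hasSubst_of_order_one hs
  have hs0 : HahnSeries.ofPowerSeries ℤ ℂ s ≠ 0 := by
    rw [Ne, map_eq_zero_iff _ HahnSeries.ofPowerSeries_injective]
    rintro rfl
    rw [order_zero] at hs
    exact absurd hs (by decide)
  have hus : constantCoeff (u.subst s) ≠ 0 := by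
    rwa [constantCoeff_subst_of_zero (order_eq_one_iff.1 hs).1]
  rw [AssociatedEquation]
  simp only
  rw [derivative_coe', laurentSubst_coe hs, derivative_coordSeries, laurentSubst_single_mul hs,
    subst_mul hss, subst_pow hss, subst_X hss, subst_C']
  -- Since k - 1 = r + (n - 1), a factor s^r cancels on both sides, leaving an equation of power
  -- series even for r < 0.
  have e1 : HahnSeries.ofPowerSeries ℤ ℂ (C (k : ℂ) * s ^ (k - 1)) =
      HahnSeries.ofPowerSeries ℤ ℂ s ^ r *
        HahnSeries.ofPowerSeries ℤ ℂ (C (k : ℂ) * s ^ (n - 1)) := by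
    rw [map_mul, map_mul, map_pow, map_pow, mul_left_comm, ← zpow_natCast, ← zpow_natCast,
      ← zpow_add₀ hs0]
    congr 2; omega
  have e2 : (HahnSeries.C (n : ℂ) * HahnSeries.single ((n : ℤ) - 1) 1 : LaurentSeries ℂ) =
      HahnSeries.ofPowerSeries ℤ ℂ (C (n : ℂ) * X ^ (n - 1)) := by
    rw [map_mul, HahnSeries.ofPowerSeries_C, HahnSeries.ofPowerSeries_X_pow,
      show ((n : ℤ) - 1) = ((n - 1 : ℕ) : ℤ) by omega]
  rw [e1, e2, mul_left_comm, mul_assoc, (mul_right_injective₀ (zpow_ne_zero r hs0)).eq_iff,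
    ← map_mul, ← map_mul, HahnSeries.ofPowerSeries_injective.eq_iff]
  have e3 : derivative ℂ (G.subst s) =
      C (k : ℂ) * s ^ (n - 1) * (u.subst s)⁻¹ * derivative ℂ s := by
    rw [derivative_subst hss, hG, subst_mul hss, subst_mul hss, subst_pow hss, subst_X hss,
      subst_C']
    congr 2
    have : (u⁻¹ : PowerSeries ℂ).subst s * u.subst s = 1 := by
      rw [← subst_mul hss, PowerSeries.inv_mul_cancel u hu, subst_one' hss]
    calc (u⁻¹ : PowerSeries ℂ).subst s
        = (u⁻¹ : PowerSeries ℂ).subst s * (u.subst s * (u.subst s : PowerSeries ℂ)⁻¹) := by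
          rw [PowerSeries.mul_inv_cancel _ hus, mul_one]
      _ = (u.subst s : PowerSeries ℂ)⁻¹ := by rw [← mul_assoc, this, one_mul]
  have e4 : derivative ℂ (X ^ n : PowerSeries ℂ) = C (n : ℂ) * X ^ (n - 1) := by
    rw [derivative_pow, derivative_X, mul_one]; simp
  constructor
  · intro h
    refine derivative.ext ?_ ?_
    · rw [e3, e4]
      calc C (k : ℂ) * s ^ (n - 1) * (u.subst s : PowerSeries ℂ)⁻¹ * derivative ℂ s
          = (C (k : ℂ) * s ^ (n - 1) * derivative ℂ s) * (u.subst s : PowerSeries ℂ)⁻¹ := by ring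
        _ = _ := by rw [h, mul_assoc, PowerSeries.mul_inv_cancel _ hus, mul_one]
    · rw [constantCoeff_subst_of_zero (order_eq_one_iff.1 hs).1, hG0, map_pow, constantCoeff_X,
        zero_pow hn.ne']
  · intro h
    have h1 := congrArg (derivative ℂ) h
    rw [e3, e4] at h1
    rw [← h1]
    calc C (k : ℂ) * s ^ (n - 1) * derivative ℂ s
        = C (k : ℂ) * s ^ (n - 1) * derivative ℂ s *
            ((u.subst s : PowerSeries ℂ)⁻¹ * u.subst s) := by
          rw [PowerSeries.inv_mul_cancel _ hus, mul_one]
      _ = _ := by ring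

/-- The primitive used for separation of variables, and its `n`-th root. -/
lemma exists_primitive_root {k n : ℕ} (hn : 0 < n) (hk : 0 < k) {u : PowerSeries ℂ}
    (hu : constantCoeff u ≠ 0) {v : ℂ} (hv : v ^ n = (k : ℂ) / (n * constantCoeff u)) :
    ∃ G V : PowerSeries ℂ, derivative ℂ G = C (k : ℂ) * X ^ (n - 1) * u⁻¹ ∧
      constantCoeff G = 0 ∧ V.order = 1 ∧ coeff 1 V = v ∧ V ^ n = G := by
  obtain ⟨G, hG, hG0⟩ := exists_derivative_eq (C (k : ℂ) * X ^ (n - 1) * u⁻¹)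
  have hn' : (n : ℂ) ≠ 0 := by exact_mod_cast hn.ne'
  have hk' : (k : ℂ) ≠ 0 := by exact_mod_cast hk.ne'
  have hv0 : v ≠ 0 := by
    rintro rfl
    rw [zero_pow hn.ne', eq_comm] at hv
    exact div_ne_zero hk' (mul_ne_zero hn' hu) hv
  have hd : X ^ n ∣ G := by
    have := dvd_of_dvd_derivative hG0 (m := n - 1) (by
      rw [hG, mul_right_comm]; exact dvd_mul_left _ _)
    rwa [Nat.sub_add_cancel hn] at this
  have hc : coeff n G = (k : ℂ) / (n * constantCoeff u) := by
    have h1 := congrArg (coeff (n - 1)) hG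
    rw [coeff_derivative, Nat.sub_add_cancel hn, mul_assoc, coeff_C_mul] at h1
    have h2 := coeff_X_pow_mul (u⁻¹) (n - 1) 0
    rw [zero_add] at h2
    rw [h2, coeff_zero_eq_constantCoeff_apply, PowerSeries.constantCoeff_inv] at h1
    have h3 : ((n - 1 : ℕ) : ℂ) + 1 = n := by
      rw [← Nat.cast_succ, Nat.succ_eq_add_one, Nat.sub_add_cancel hn]
    rw [h3] at h1
    field_simp
    field_simp at h1
    linear_combination h1
  obtain ⟨V, hV, hV1, hVn⟩ := exists_order_one_pow_eq hn hv0 hd (hv.trans hc.symm)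
  exact ⟨G, V, hG, hG0, hV, hV1, hVn⟩

/-- The associated equation is solvable. -/
lemma exists_associatedEquation {y₀ : ℂ} {k n : ℕ} (hn : 0 < n) (hk : 0 < k) {r : ℤ}
    (hr : (n : ℤ) = (k : ℤ) - r) {u : PowerSeries ℂ} (hu : constantCoeff u ≠ 0) :
    ∃ s : PowerSeries ℂ, s.order = 1 ∧
      AssociatedEquation (HahnSeries.ofPowerSeries ℤ ℂ (coordSeries y₀ k),
        HahnSeries.single r 1 * HahnSeries.ofPowerSeries ℤ ℂ u) n s := by
  obtain ⟨v, hv⟩ := IsAlgClosed.exists_pow_nat_eq ((k : ℂ) / (n * constantCoeff u)) hn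
  obtain ⟨G, V, hG, hG0, hV, hV1, hVn⟩ := exists_primitive_root hn hk hu hv
  obtain ⟨s, hs, -, hVs, -⟩ := exists_subst_inverse hV
  refine ⟨s, hs, (associatedEquation_iff_subst_eq hn hr hu hG hG0 hk hs).2 ?_⟩
  rw [← hVn, subst_pow (hasSubst_of_order_one hs), hVs]

/-- Solutions of the associated equation depend on the right hand side up to the same relative
precision. -/
lemma exists_close_associatedEquation {y₀ : ℂ} {k n N : ℕ} (hn : 0 < n) (hk : 0 < k) (hN : 0 < N)
    {r : ℤ} (hr : (n : ℤ) = (k : ℤ) - r) {u₁ u₂ : PowerSeries ℂ} (hu : constantCoeff u₁ ≠ 0)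
    (huu : X ^ N ∣ u₁ - u₂) {s₁ : PowerSeries ℂ} (hs₁ : s₁.order = 1)
    (h : AssociatedEquation (HahnSeries.ofPowerSeries ℤ ℂ (coordSeries y₀ k),
        HahnSeries.single r 1 * HahnSeries.ofPowerSeries ℤ ℂ u₁) n s₁) :
    ∃ s₂ : PowerSeries ℂ, s₂.order = 1 ∧ X ^ (N + 1) ∣ s₁ - s₂ ∧
      AssociatedEquation (HahnSeries.ofPowerSeries ℤ ℂ (coordSeries y₀ k),
        HahnSeries.single r 1 * HahnSeries.ofPowerSeries ℤ ℂ u₂) n s₂ := by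
  have huc : constantCoeff u₁ = constantCoeff u₂ := by
    have := X_dvd_iff.1 ((dvd_pow_self X hN.ne').trans huu)
    rwa [map_sub, sub_eq_zero] at this
  have hu₂ : constantCoeff u₂ ≠ 0 := huc ▸ hu
  obtain ⟨v, hv⟩ := IsAlgClosed.exists_pow_nat_eq ((k : ℂ) / (n * constantCoeff u₁)) hn
  obtain ⟨G₁, V₁, hG₁, hG0₁, hV₁, hVc₁, hVn₁⟩ := exists_primitive_root hn hk hu hv
  -- The same v is admissible because N > 0 makes the constant coefficients of u₁ and u₂ equal.
  obtain ⟨G₂, V₂, hG₂, hG0₂, hV₂, hVc₂, hVn₂⟩ := exists_primitive_root hn hk hu₂ (huc ▸ hv)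
  have cG : X ^ (n + N) ∣ G₁ - G₂ := by
    have := dvd_of_dvd_derivative (f := G₁ - G₂) (m := n - 1 + N) (by rw [map_sub, hG0₁, hG0₂, sub_self]) (by
      rw [map_sub, hG₁, hG₂, ← mul_sub, mul_assoc, pow_add]
      exact Dvd.dvd.mul_left (mul_dvd_mul_left _ (dvd_inv_sub_inv hu hu₂ huu)) _)
    rwa [show n - 1 + N + 1 = n + N by omega] at this
  have cV : X ^ (N + 1) ∣ V₁ - V₂ :=
    order_one_congr_of_pow_congr hn hV₁ hV₂ (hVc₁.trans hVc₂.symm) (by rwa [hVn₁, hVn₂])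
  obtain ⟨T₁, hT₁, -, hVT₁, hTV₁⟩ := exists_subst_inverse hV₁
  obtain ⟨T₂, hT₂, -, hVT₂, hTV₂⟩ := exists_subst_inverse hV₂
  have cT : X ^ (N + 1) ∣ T₁ - T₂ := inverse_congr hV₁ hT₂ hTV₁ hVT₂ cV
  obtain ⟨hω, -⟩ := order_one_subst hV₁ hs₁
  -- The equation says w^n = t^n, so w records which of the n solutions s₁ is; inserting the same w
  -- into the inverse of V₂ selects its partner.
  set w : PowerSeries ℂ := V₁.subst s₁ with hw
  have hwn : w ^ n = X ^ n := by
    rw [hw, ← subst_pow (hasSubst_of_order_one hs₁), hVn₁]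
    exact (associatedEquation_iff_subst_eq hn hr hu hG₁ hG0₁ hk hs₁).1 h
  have hs₁' : s₁ = T₁.subst w := by
    rw [hw, ← subst_subst hV₁ hs₁, hTV₁, subst_X (hasSubst_of_order_one hs₁)]
  obtain ⟨hs₂, -⟩ := order_one_subst hT₂ hω
  refine ⟨T₂.subst w, hs₂, ?_, ?_⟩
  · rw [hs₁']
    exact dvd_subst_sub_of_dvd_left (order_eq_one_iff.1 hω).1 cT
  · refine (associatedEquation_iff_subst_eq hn hr hu₂ hG₂ hG0₂ hk hs₂).2 ?_
    rw [← hVn₂, subst_pow (hasSubst_of_order_one hs₂), ← subst_subst hT₂ hω, hVT₂,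
      subst_X (hasSubst_of_order_one hω), hwn]

/-! ### Orders of Laurent series -/

lemma constantCoeff_powerSeriesPart {b : LaurentSeries ℂ} (hb : b ≠ 0) :
    constantCoeff b.powerSeriesPart ≠ 0 := by
  rw [← coeff_zero_eq_constantCoeff_apply, LaurentSeries.powerSeriesPart_coeff]
  simpa using HahnSeries.coeff_order_eq_zero.not.2 hb

lemma order_single_mul {r : ℤ} {u : PowerSeries ℂ} (hu : constantCoeff u ≠ 0) :
    (HahnSeries.single r 1 * HahnSeries.ofPowerSeries ℤ ℂ u).order = r := by
  have hc : (HahnSeries.single r 1 * HahnSeries.ofPowerSeries ℤ ℂ u).coeff r ≠ 0 := by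
    rw [coeff_single_mul', sub_self, one_mul]
    have := coeff_ofPowerSeries_nat u 0
    rw [Nat.cast_zero] at this
    rwa [this, coeff_zero_eq_constantCoeff_apply]
  refine le_antisymm (HahnSeries.order_le_of_coeff_ne_zero hc) ?_
  by_contra! hlt
  have hne : HahnSeries.single r 1 * HahnSeries.ofPowerSeries ℤ ℂ u ≠ 0 := by
    intro h; rw [h] at hc; exact hc rfl
  have := HahnSeries.coeff_order_eq_zero.not.2 hne
  rw [coeff_single_mul', coeff_ofPowerSeries_neg _ (by omega), mul_zero] at this
  exact this rfl

/-- Truncation after the first `N` terms, for a series written as `t^r u(t)`. -/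
lemma truncLT_eq_single_mul {b : LaurentSeries ℂ} {N : ℕ} :
    HahnSeries.truncLT (b.order + (N : ℤ)) b = HahnSeries.single b.order 1 *
      HahnSeries.ofPowerSeries ℤ ℂ ((trunc N b.powerSeriesPart : Polynomial ℂ) : PowerSeries ℂ) := by
  have hb := LaurentSeries.single_order_mul_powerSeriesPart b
  ext j
  rw [coeff_single_mul', one_mul]
  have hj : b.coeff j = (HahnSeries.ofPowerSeries ℤ ℂ b.powerSeriesPart).coeff (j - b.order) := by
    conv_lhs => rw [← hb]
    rw [coeff_single_mul', one_mul]
  rcases lt_or_ge (j - b.order) 0 with h | h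
  · rw [coeff_ofPowerSeries_neg _ h, HahnSeries.coeff_truncLT_of_lt (by omega), hj,
      coeff_ofPowerSeries_neg _ h]
  · obtain ⟨i, hi⟩ := Int.eq_ofNat_of_zero_le h
    rw [hi, coeff_ofPowerSeries_nat, Polynomial.coeff_coe, coeff_trunc]
    split_ifs with hiN
    · rw [HahnSeries.coeff_truncLT_of_lt (by omega), hj, hi, coeff_ofPowerSeries_nat]
    · rw [HahnSeries.coeff_truncLT_of_le (by omega)]

lemma dvd_sub_trunc (u : PowerSeries ℂ) (N : ℕ) :
    X ^ N ∣ u - ((trunc N u : Polynomial ℂ) : PowerSeries ℂ) := by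
  rw [X_pow_dvd_iff]
  intro i hi
  rw [map_sub, Polynomial.coeff_coe, coeff_trunc, if_pos hi, sub_self]

lemma order_one_of_dvd_sub {s r : PowerSeries ℂ} (hs : s.order = 1) {m : ℕ} (hm : 2 ≤ m)
    (h : X ^ m ∣ s - r) : r.order = 1 := by
  obtain ⟨h0, h1⟩ := order_eq_one_iff.1 hs
  rw [X_pow_dvd_iff] at h
  have e0 := h 0 (by omega)
  have e1 := h 1 (by omega)
  rw [map_sub, sub_eq_zero] at e0 e1
  refine order_eq_one_iff.2 ⟨?_, e1 ▸ h1⟩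
  rwa [← coeff_zero_eq_constantCoeff_apply, ← e0, coeff_zero_eq_constantCoeff_apply]


lemma exists_zpow_eq_single_mul {s : PowerSeries ℂ} (hs : s.order = 1) (r : ℤ) :
    ∃ v : PowerSeries ℂ, constantCoeff v ≠ 0 ∧ HahnSeries.ofPowerSeries ℤ ℂ s ^ r =
      HahnSeries.single r 1 * HahnSeries.ofPowerSeries ℤ ℂ v := by
  obtain ⟨u, hu⟩ := X_dvd_of_order_one hs
  have hu0 : constantCoeff u ≠ 0 := by
    rw [← coeff_one_X_mul, ← hu]; exact (order_eq_one_iff.1 hs).2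
  have e : HahnSeries.ofPowerSeries ℤ ℂ s ^ r =
      HahnSeries.single r 1 * HahnSeries.ofPowerSeries ℤ ℂ u ^ r := by
    rw [hu, map_mul, mul_zpow, HahnSeries.ofPowerSeries_X, ← RatFunc.single_zpow]
  rcases Int.le_total 0 r with hr | hr
  · lift r to ℕ using hr
    refine ⟨u ^ r, by rw [map_pow]; exact pow_ne_zero _ hu0, ?_⟩
    rw [e, map_pow, zpow_natCast]
  · obtain ⟨m, hm⟩ := Int.eq_ofNat_of_zero_le (neg_nonneg.2 hr)
    obtain rfl : r = -(m : ℤ) := by omega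
    refine ⟨u⁻¹ ^ m, ?_, ?_⟩
    · rw [map_pow, PowerSeries.constantCoeff_inv]; exact pow_ne_zero _ (inv_ne_zero hu0)
    · have h1 : HahnSeries.ofPowerSeries ℤ ℂ u⁻¹ * HahnSeries.ofPowerSeries ℤ ℂ u = 1 := by
        rw [← map_mul, PowerSeries.inv_mul_cancel u hu0, map_one]
      rw [e, map_pow, eq_inv_of_mul_eq_one_left h1, zpow_neg, zpow_natCast, inv_pow]

lemma order_laurentSubst {s : PowerSeries ℂ} (hs : s.order = 1) {b : LaurentSeries ℂ}
    (hb : b ≠ 0) : (laurentSubst b s).order = b.order := by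
  obtain ⟨v, hv, h⟩ := exists_zpow_eq_single_mul hs b.order
  rw [laurentSubst, h, mul_assoc, ← map_mul, order_single_mul]
  rw [map_mul, constantCoeff_subst_of_zero (order_eq_one_iff.1 hs).1]
  exact mul_ne_zero hv (constantCoeff_powerSeriesPart hb)

lemma coordSeries_subst {s : PowerSeries ℂ} (hs : s.order = 1) (y₀ : ℂ) (k : ℕ) :
    (coordSeries y₀ k).subst s = C y₀ + s ^ k := by
  have hss := hasSubst_of_order_one hs
  rw [coordSeries, subst_add hss, subst_pow hss, subst_X hss, subst_C']

lemma coordSeries_subst_leading {s : PowerSeries ℂ} (hs : s.order = 1) (y₀ : ℂ) {k : ℕ}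
    (hk : 0 < k) : constantCoeff ((coordSeries y₀ k).subst s) = y₀ ∧
      X ^ k ∣ (coordSeries y₀ k).subst s - C y₀ ∧
      coeff k ((coordSeries y₀ k).subst s - C y₀) ≠ 0 := by
  obtain ⟨h0, h1⟩ := order_eq_one_iff.1 hs
  rw [coordSeries_subst hs, add_sub_cancel_left, coeff_pow_of_order_one hs]
  refine ⟨?_, pow_dvd_pow_of_dvd (X_dvd_of_order_one hs) k, pow_ne_zero _ h1⟩
  rw [map_add, map_pow, h0, zero_pow hk.ne', constantCoeff_C, add_zero]

lemma coordSeries_subst_ne_C {s : PowerSeries ℂ} (hs : s.order = 1) (y₀ : ℂ) {k : ℕ}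
    (hk : 0 < k) : (coordSeries y₀ k).subst s ≠ C y₀ := by
  intro h
  have := (coordSeries_subst_leading hs y₀ hk).2.2
  rw [h, sub_self, map_zero] at this
  exact this rfl

/-- Forces n = k - ord b for a solution coming from (y₀ + t^k, b), the value of n used by the
algorithm. -/
lemma order_ramifiedDeriv {s : PowerSeries ℂ} (hs : s.order = 1) (y₀ : ℂ) {k n : ℕ} (hk : 0 < k)
    (hn : 0 < n) :
    (ramifiedDeriv n (HahnSeries.ofPowerSeries ℤ ℂ ((coordSeries y₀ k).subst s))).order =
      (k : ℤ) - n := by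
  have hss := hasSubst_of_order_one hs
  obtain ⟨u, hu⟩ := X_dvd_of_order_one hs
  have hu0 : constantCoeff u ≠ 0 := by
    rw [← coeff_one_X_mul, ← hu]; exact (order_eq_one_iff.1 hs).2
  have e : derivative ℂ ((coordSeries y₀ k).subst s) =
      X ^ (k - 1) * (C (k : ℂ) * u ^ (k - 1) * derivative ℂ s) := by
    rw [derivative_subst hss, derivative_coordSeries, subst_mul hss, subst_pow hss, subst_X hss,
      subst_C']
    have : s ^ (k - 1) = X ^ (k - 1) * u ^ (k - 1) := by rw [hu, mul_pow]
    rw [this]; ring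
  have e2 : (HahnSeries.single (1 - (n : ℤ)) ((n : ℂ)⁻¹) : LaurentSeries ℂ) =
      HahnSeries.single (1 - (n : ℤ)) 1 * HahnSeries.ofPowerSeries ℤ ℂ (C ((n : ℂ)⁻¹)) := by
    rw [HahnSeries.ofPowerSeries_C, HahnSeries.C_apply, HahnSeries.single_mul_single, add_zero,
      one_mul]
  rw [ramifiedDeriv, derivative_coe', e, map_mul, HahnSeries.ofPowerSeries_X_pow, e2, mul_assoc,
    mul_left_comm (HahnSeries.ofPowerSeries ℤ ℂ _), ← mul_assoc, HahnSeries.single_mul_single,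
    ← map_mul, one_mul, order_single_mul]
  · omega
  · have h1 : constantCoeff (derivative ℂ s) ≠ 0 := by
      rw [← coeff_zero_eq_constantCoeff_apply, coeff_derivative]
      simpa using (order_eq_one_iff.1 hs).2
    rw [map_mul, map_mul, map_mul, map_pow, constantCoeff_C, constantCoeff_C]
    have hn' : (n : ℂ) ≠ 0 := by exact_mod_cast hn.ne'
    have hk' : (k : ℂ) ≠ 0 := by exact_mod_cast hk.ne'
    exact mul_ne_zero (inv_ne_zero hn') (mul_ne_zero (mul_ne_zero hk' (pow_ne_zero _ hu0)) h1)

/-! ### The output of the algorithm at one place -/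

/-- Knowing s modulo t^(N+1) means knowing s^k modulo t^(k+N), because s has order one. The
ramification order being n, the two cut-offs coincide. -/
lemma outputTerms_eq_firstTermsOfSolution {y₀ : ℂ} {k n N : ℕ} (hn : 0 < n) (hk : 0 < k)
    (hN : 0 < N) {s shat : PowerSeries ℂ} (hs : s.order = 1) (hclose : X ^ (N + 1) ∣ s - shat)
    (hram : ramificationOrder
      (ramify hn (HahnSeries.ofPowerSeries ℤ ℂ ((coordSeries y₀ k).subst s))) = n) :
    outputTerms N k n (HahnSeries.ofPowerSeries ℤ ℂ (coordSeries y₀ k))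
        (trunc (N + 1) shat : Polynomial ℂ) =
      firstTermsOfSolution N
        (ramify hn (HahnSeries.ofPowerSeries ℤ ℂ ((coordSeries y₀ k).subst s))) := by
  have hnq : (0 : ℚ) < n := by exact_mod_cast hn
  have hc2 : X ^ (N + 1) ∣ s - ((trunc (N + 1) shat : Polynomial ℂ) : PowerSeries ℂ) := by
    have := dvd_add hclose (dvd_sub_trunc shat (N + 1))
    rwa [sub_add_sub_cancel] at this
  have ht := order_one_of_dvd_sub hs (by omega) hc2
  obtain ⟨h0, h1, h2⟩ := coordSeries_subst_leading hs y₀ hk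
  rw [firstTermsOfSolution_ramify hn h0 h1 h2, hram, ← add_div, outputTerms,
    laurentSubst_coe ht]
  have hagree : ∀ j < k + N, coeff j ((coordSeries y₀ k).subst
      ((trunc (N + 1) shat : Polynomial ℂ) : PowerSeries ℂ) : PowerSeries ℂ) =
      coeff j ((coordSeries y₀ k).subst s : PowerSeries ℂ) := by
    have := pow_congr_of_order_one_congr (n := k) hs ht hc2
    rw [X_pow_dvd_iff] at this
    intro j hj
    have h := this j hj
    rw [map_sub, sub_eq_zero] at h
    rw [coordSeries_subst hs, coordSeries_subst ht, map_add, map_add, h]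
  ext q
  rw [HahnSeries.coeff_sum]
  by_cases hq : ∃ j : ℕ, j < k + N ∧ q = (j : ℚ) / n
  · obtain ⟨j, hj, rfl⟩ := hq
    rw [Finset.sum_eq_single j, HahnSeries.coeff_single_same, coeff_ofPowerSeries_nat, hagree j hj,
      HahnSeries.coeff_truncLT_of_lt, ramify_coe_coeff]
    · rw [div_lt_div_iff_of_pos_right hnq]; exact_mod_cast hj
    · intro i _ hij
      rw [HahnSeries.coeff_single_of_ne]
      intro h
      rw [div_left_inj' hnq.ne'] at h
      exact hij (by exact_mod_cast h.symm)
    · intro h; exact absurd (Finset.mem_range.2 hj) h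
  · rw [Finset.sum_eq_zero]
    · rcases lt_or_ge q (((k : ℚ) + N) / n) with hlt | hge
      · rw [HahnSeries.coeff_truncLT_of_lt hlt]
        by_contra hne
        obtain ⟨j, hj⟩ := hasDenominator_ramify hn _ q (Ne.symm hne)
        have hqj := eq_div_of_mul_eq hn hj
        rw [hqj, ramify_coeff] at hne
        rcases lt_or_ge j 0 with hj0 | hj0
        · exact hne (coeff_ofPowerSeries_neg _ hj0).symm
        · lift j to ℕ using hj0
          refine hq ⟨j, ?_, by simpa using hqj⟩
          rw [hqj, div_lt_div_iff_of_pos_right hnq] at hlt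
          exact_mod_cast hlt
      · rw [HahnSeries.coeff_truncLT_of_le hge]
    · intro j hj
      rw [HahnSeries.coeff_single_of_ne]
      intro h
      exact hq ⟨j, Finset.mem_range.1 hj, h⟩

/-- By Bézout; consequently the ramification order divides every denominator. -/
lemma hasDenominator_gcd {y : HahnSeries ℚ ℂ} {a b : ℕ} (ha : HasDenominator y a)
    (hb : HasDenominator y b) : HasDenominator y (Nat.gcd a b) := by
  intro q hq
  obtain ⟨i, hi⟩ := ha q hq
  obtain ⟨j, hj⟩ := hb q hq
  refine ⟨i * Nat.gcdA a b + j * Nat.gcdB a b, ?_⟩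
  have h : ((Nat.gcd a b : ℤ) : ℚ) = ((a * Nat.gcdA a b + b * Nat.gcdB a b : ℤ) : ℚ) := by
    rw [Nat.gcd_eq_gcd_ab]
  push_cast at h ⊢
  rw [h, ← hi, ← hj]; ring

lemma hasDenominator_puiseuxDeriv {y : HahnSeries ℚ ℂ} {n : ℕ} (h : HasDenominator y n) :
    HasDenominator (puiseuxDeriv y) n := by
  intro q hq
  have hq' : y.coeff (q + 1) ≠ 0 := right_ne_zero_of_mul hq
  obtain ⟨j, hj⟩ := h _ hq'
  exact ⟨j - n, by push_cast; rw [← hj]; ring⟩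

lemma dvd_of_hasDenominator {n m c : ℕ} (hn : 0 < n) (hnm : n = m * c) (hc : 0 < c)
    {Z : LaurentSeries ℂ} (h : HasDenominator (ramify hn Z) c) : ∀ j ∈ Z.support, (m : ℤ) ∣ j := by
  intro j hj
  have hj' : Z.coeff j ≠ 0 := hj
  rw [← ramify_coeff hn] at hj'
  obtain ⟨i, hi⟩ := h _ hj'
  refine ⟨i, ?_⟩
  have hnq : (n : ℚ) ≠ 0 := by exact_mod_cast hn.ne'
  have hcq : (c : ℚ) ≠ 0 := by exact_mod_cast hc.ne'
  have hmq : (m : ℚ) ≠ 0 := by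
    rintro h0
    rw [hnm, Nat.cast_mul, h0, zero_mul] at hnq
    exact hnq rfl
  have : (j : ℚ) = m * i := by
    rw [← hi, hnm]; push_cast; field_simp
  exact_mod_cast this

/-- Solutions coming from irreducible parametrizations have the expected ramification order. -/
lemma ramificationOrder_eq_of_irreducible {F : ℂ[X][Y]} {y₀ : ℂ} {p₀ : OnePoint ℂ} {n : ℕ}
    (hn : 0 < n) {Z : PowerSeries ℂ} {A : LaurentSeries ℂ × LaurentSeries ℂ}
    (hA : A ∈ irreducibleParametrizations F y₀ p₀)
    (h : Equivalent A (HahnSeries.ofPowerSeries ℤ ℂ Z,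
      ramifiedDeriv n (HahnSeries.ofPowerSeries ℤ ℂ Z))) :
    ramificationOrder (ramify hn (HahnSeries.ofPowerSeries ℤ ℂ Z)) = n := by
  have hd := hasDenominator_ramify hn (HahnSeries.ofPowerSeries ℤ ℂ Z)
  set y := ramify hn (HahnSeries.ofPowerSeries ℤ ℂ Z) with hy
  obtain ⟨hc, hdc⟩ := ramificationOrder_spec (y := y) ⟨n, hn, hd⟩
  set c := ramificationOrder y with hcd
  have hg := ramificationOrder_le (Nat.gcd_pos_of_pos_left n hc) (hasDenominator_gcd hdc hd)
  have hcn : c ∣ n := by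
    rw [← Nat.gcd_eq_left_iff_dvd]
    exact le_antisymm (Nat.gcd_le_left n hc) hg
  obtain ⟨m, hm⟩ := hcn
  by_contra hne
  have hm1 : 1 < m := by
    rcases Nat.lt_or_ge 1 m with h | h
    · exact h
    · interval_cases m <;> omega
  rw [mul_comm] at hm
  -- A smaller denominator n/m of y is also one of y', so the equivalent pair lies in ℂ((t^m))²,
  -- against irreducibility.
  refine hA.2 ⟨m, hm1, _, h, dvd_of_hasDenominator hn hm hc hdc, dvd_of_hasDenominator hn hm hc ?_⟩
  rw [← puiseuxDeriv_ramify, ← hy]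
  exact hasDenominator_puiseuxDeriv hdc

lemma single_order_mul_powerSeriesPart' (b : LaurentSeries ℂ) :
    b = HahnSeries.single b.order 1 * HahnSeries.ofPowerSeries ℤ ℂ b.powerSeriesPart :=
  (LaurentSeries.single_order_mul_powerSeriesPart b).symm

lemma constantCoeff_trunc {u : PowerSeries ℂ} {N : ℕ} (hN : 0 < N) :
    constantCoeff ((trunc N u : Polynomial ℂ) : PowerSeries ℂ) = constantCoeff u := by
  rw [← coeff_zero_eq_constantCoeff_apply, Polynomial.coeff_coe, coeff_trunc, if_pos hN,
    coeff_zero_eq_constantCoeff_apply]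

/-- The truncation of a nonconstant solution is computed from the place it belongs to. -/
lemma firstTermsOfSolution_mem_output {F : ℂ[X][Y]} {y₀ : ℂ} {p₀ : OnePoint ℂ} {N : ℕ}
    (hN : 0 < N) {R : Set (LaurentSeries ℂ × LaurentSeries ℂ)}
    (hR : IsPlaceRepresentatives F y₀ p₀ R) {y : HahnSeries ℚ ℂ} (hy : y ∈ solutions F y₀ p₀)
    (hc : y ∉ constants) :
    ∃ A ∈ truncateParametrization N '' R, firstTermsOfSolution N y ∈ outputOfTruncation N y₀ A := by
  obtain ⟨hn, hd⟩ := ramificationOrder_spec hy.1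
  obtain ⟨Z, hZy, hZ⟩ := exists_isRamifiedSolution hy hn hd
  set n := ramificationOrder y with hnd
  have hZc : Z ≠ C y₀ := by
    rw [← hZy, ramify_coe_mem_constants_iff, hZ.constantCoeff_eq] at hc
    exact hc
  have hirr := solution_mem_irreducibleParametrizations hn hZ hZc (by rw [hZy])
  obtain ⟨⟨a, b⟩, ⟨hBR, hB⟩, -⟩ := hR.2 _ hirr
  obtain ⟨k, hk, ha⟩ := (hR.1 _ hBR).2
  simp only at ha
  rw [← coe_coordSeries] at ha
  subst ha
  obtain ⟨s, hs, h1, h2⟩ := equivalent_symm hB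
  simp only at h1 h2
  rw [laurentSubst_coe hs] at h1
  have hZs := HahnSeries.ofPowerSeries_injective h1
  have hb : b ≠ 0 := by
    rintro rfl
    rw [laurentSubst_eq_hom hs, map_zero] at h2
    exact ramifiedDeriv_ne_zero hn hZ.constantCoeff_eq hZc h2.symm
  have hord : (n : ℤ) = (k : ℤ) - b.order := by
    rw [← order_laurentSubst hs hb, h2, ← hZs, order_ramifiedDeriv hs y₀ hk hn]; ring
  have hass : AssociatedEquation (HahnSeries.ofPowerSeries ℤ ℂ (coordSeries y₀ k), b) n s := by
    rw [associatedEquation_iff hn hs, h2, hZs]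
  rw [single_order_mul_powerSeriesPart' b] at hass
  -- Passage from b to its truncation: s has a partner solving the truncated equation.
  obtain ⟨shat, hshat, hclose, hass'⟩ := exists_close_associatedEquation hn hk hN hord
    (constantCoeff_powerSeriesPart hb) (dvd_sub_trunc b.powerSeriesPart N) hs hass
  rw [← truncLT_eq_single_mul] at hass'
  refine ⟨_, ⟨_, hBR, rfl⟩, k, n, hn, ?_, ?_, shat, hshat, hass', ?_⟩
  · simp only [truncateParametrization]
    rw [coe_coordSeries, add_sub_cancel_left, HahnSeries.order_single one_ne_zero]
  · simp only [truncateParametrization]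
    rw [truncLT_eq_single_mul, order_single_mul]
    · exact hord
    · rw [constantCoeff_trunc hN]; exact constantCoeff_powerSeriesPart hb
  · simp only [truncateParametrization]
    rw [outputTerms_eq_firstTermsOfSolution hn hk hN hs hclose, hZs, hZy]
    rw [hZs, hZy]

/-- Every output of the algorithm at a place is the truncation of a solution. -/
lemma exists_solution_of_mem_output {F : ℂ[X][Y]} {y₀ : ℂ} {p₀ : OnePoint ℂ} {N : ℕ}
    (hN : 0 < N) {A : LaurentSeries ℂ × LaurentSeries ℂ}
    (hA : A ∈ irreducibleParametrizations F y₀ p₀) (hcl : IsClassical y₀ A)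
    {yhat : HahnSeries ℚ ℂ}
    (h : yhat ∈ outputOfTruncation N y₀ (truncateParametrization N A)) :
    ∃ y ∈ solutions F y₀ p₀, firstTermsOfSolution N y = yhat := by
  obtain ⟨a, b⟩ := A
  obtain ⟨k, hk, ha⟩ := hcl
  simp only at ha
  rw [← coe_coordSeries] at ha
  subst ha
  obtain ⟨k', n, hn, hk', hord, shat, hshat, hass, rfl⟩ := h
  simp only [truncateParametrization] at hk' hord hass ⊢
  rw [coe_coordSeries, add_sub_cancel_left, HahnSeries.order_single one_ne_zero] at hk'
  obtain rfl : k = k' := by exact_mod_cast hk'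
  -- The order of 0 is 0 by convention, so b = 0 is not excluded by the order condition; but then
  -- the candidate y₀ + s^k would have zero derivative.
  have hb : b ≠ 0 := by
    rintro rfl
    rw [map_zero, associatedEquation_iff hn hshat, laurentSubst_eq_hom hshat, map_zero] at hass
    exact ramifiedDeriv_ne_zero hn (coordSeries_subst_leading hshat y₀ hk).1
      (coordSeries_subst_ne_C hshat y₀ hk) hass
  have hu := constantCoeff_powerSeriesPart hb
  have hu' : constantCoeff ((trunc N b.powerSeriesPart : Polynomial ℂ) : PowerSeries ℂ) ≠ 0 := by
    rwa [constantCoeff_trunc hN]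
  rw [truncLT_eq_single_mul, order_single_mul hu'] at hord
  rw [truncLT_eq_single_mul] at hass
  obtain ⟨s, hs, hclose, hass'⟩ := exists_close_associatedEquation hn hk hN hord hu'
    ((dvd_sub_comm).1 (dvd_sub_trunc b.powerSeriesPart N)) hshat hass
  rw [← single_order_mul_powerSeriesPart', associatedEquation_iff hn hs] at hass'
  have hE : Equivalent (HahnSeries.ofPowerSeries ℤ ℂ (coordSeries y₀ k), b)
      (HahnSeries.ofPowerSeries ℤ ℂ ((coordSeries y₀ k).subst s),
        ramifiedDeriv n (HahnSeries.ofPowerSeries ℤ ℂ ((coordSeries y₀ k).subst s))) :=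
    ⟨s, hs, laurentSubst_coe hs _, hass'.symm⟩
  have hram := ramificationOrder_eq_of_irreducible hn hA hE
  have hpar := isParametrization_of_equivalent hA.1 hE
  refine ⟨ramify hn (HahnSeries.ofPowerSeries ℤ ℂ ((coordSeries y₀ k).subst s)), ?_, ?_⟩
  · exact IsRamifiedSolution.mem_solutions hn
      ⟨(coordSeries_subst_leading hs y₀ hk).1, hpar.2.1, hpar.2.2.2⟩
  · exact (outputTerms_eq_firstTermsOfSolution hn hk hN hs ((dvd_sub_comm).1 hclose) hram).symm


/-! ### Simple roots of polynomials over power series -/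

/-- Taylor expansion at f₂ gives (f₁ - f₂)(g'(f₂) + c (f₁ - f₂)) = 0 for some c, and the second
factor has non-zero constant coefficient. -/
lemma eq_of_simple_root {g : Polynomial (PowerSeries ℂ)} {f₁ f₂ : PowerSeries ℂ}
    (h₁ : g.eval f₁ = 0) (h₂ : g.eval f₂ = 0) (h : constantCoeff f₁ = constantCoeff f₂)
    (hd : constantCoeff (g.derivative.eval f₂) ≠ 0) : f₁ = f₂ := by
  obtain ⟨k, hk⟩ := g.binomExpansion f₂ (f₁ - f₂)
  rw [add_sub_cancel, h₁, h₂, zero_add, pow_two, ← mul_assoc, ← add_mul, eq_comm,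
    mul_eq_zero] at hk
  rcases hk with hk | hk
  · have := congrArg constantCoeff hk
    rw [map_add, map_mul, map_sub, h, sub_self, mul_zero, add_zero, map_zero] at this
    exact absurd this hd
  · exact sub_eq_zero.1 hk

lemma constantCoeff_eval_congr (g : Polynomial (PowerSeries ℂ)) {f₁ f₂ : PowerSeries ℂ}
    (h : constantCoeff f₁ = constantCoeff f₂) :
    constantCoeff (g.eval f₁) = constantCoeff (g.eval f₂) := by
  rw [← Polynomial.eval₂_hom, ← Polynomial.eval₂_hom, h]

/-- Successive approximations to a simple root. -/
def rootApprox (g : Polynomial (PowerSeries ℂ)) (q d : ℂ) : ℕ → PowerSeries ℂ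
  | 0 => C q
  | n + 1 => rootApprox g q d n -
      C (coeff (n + 1) (g.eval (rootApprox g q d n)) / d) * X ^ (n + 1)

/-- Newton iteration with the derivative frozen at its constant value d: each step corrects exactly
one coefficient of the value of g. -/
lemma rootApprox_spec {g : Polynomial (PowerSeries ℂ)} {q d : ℂ}
    (h : constantCoeff (g.eval (C q)) = 0) (hd : constantCoeff (g.derivative.eval (C q)) = d)
    (hd0 : d ≠ 0) (n : ℕ) : constantCoeff (rootApprox g q d n) = q ∧
      X ^ (n + 1) ∣ g.eval (rootApprox g q d n) := by
  induction n with
  | zero => simpa [rootApprox, X_dvd_iff] using h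
  | succ n ih =>
    obtain ⟨ih0, w, hw⟩ := ih
    have hdn : constantCoeff (g.derivative.eval (rootApprox g q d n)) = d := by
      exact (constantCoeff_eval_congr _ (by rw [ih0, constantCoeff_C])).trans hd
    refine ⟨by simp [rootApprox, ih0], ?_⟩
    have hcw : coeff (n + 1) (g.eval (rootApprox g q d n)) = constantCoeff w := by
      rw [hw, ← coeff_zero_eq_constantCoeff_apply]
      simpa using coeff_X_pow_mul w (n + 1) 0
    obtain ⟨k, hk⟩ := g.binomExpansion (rootApprox g q d n)
      (-(C (constantCoeff w / d) * X ^ (n + 1)))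
    rw [rootApprox, hcw, sub_eq_add_neg, hk, hw]
    have e : X ^ (n + 1) * w + g.derivative.eval (rootApprox g q d n) *
        -(C (constantCoeff w / d) * X ^ (n + 1)) + k * (-(C (constantCoeff w / d) * X ^ (n + 1))) ^ 2
        = X ^ (n + 1) * (w - g.derivative.eval (rootApprox g q d n) * C (constantCoeff w / d) +
          k * C (constantCoeff w / d) ^ 2 * X ^ (n + 1)) := by ring
    rw [e, pow_succ X (n + 1)]
    refine mul_dvd_mul_left _ (X_dvd_iff.2 ?_)
    simp [hdn, mul_div_cancel₀ _ hd0]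

/-- Hensel's lemma for simple roots of polynomials over `ℂ⟦X⟧`. -/
lemma exists_root_of_simple {g : Polynomial (PowerSeries ℂ)} {q : ℂ}
    (h : constantCoeff (g.eval (C q)) = 0) (hd : constantCoeff (g.derivative.eval (C q)) ≠ 0) :
    ∃ f : PowerSeries ℂ, g.eval f = 0 ∧ constantCoeff f = q := by
  set d := constantCoeff (g.derivative.eval (C q)) with hdd
  have hs := rootApprox_spec h hdd.symm hd
  have hstep : ∀ i j, coeff i (rootApprox g q d (i + j)) = coeff i (rootApprox g q d i) := by
    intro i j
    induction j with
    | zero => rfl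
    | succ j ih =>
      rw [← add_assoc, rootApprox, map_sub, ih, coeff_C_mul, coeff_X_pow, if_neg (by omega),
        mul_zero, sub_zero]
  set f : PowerSeries ℂ := PowerSeries.mk fun n => coeff n (rootApprox g q d n)
  have hf : ∀ n, X ^ (n + 1) ∣ f - rootApprox g q d n := by
    intro n
    rw [X_pow_dvd_iff]
    intro i hi
    obtain ⟨j, rfl⟩ := Nat.exists_eq_add_of_le (Nat.lt_succ_iff.1 hi)
    rw [map_sub, coeff_mk, hstep, sub_self]
  refine ⟨f, eq_of_forall_X_pow_dvd_sub fun n => ?_, ?_⟩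
  · have h1 := ((hf n).trans (Polynomial.sub_dvd_eval_sub f (rootApprox g q d n) g))
    have h2 := dvd_add h1 (hs n).2
    rw [sub_add_cancel] at h2
    rw [sub_zero]
    exact (pow_dvd_pow X n.le_succ).trans h2
  · rw [← coeff_zero_eq_constantCoeff_apply, coeff_mk, coeff_zero_eq_constantCoeff_apply]
    exact (hs 0).1

/-! ### The curve along a power series -/

/-- The polynomial `F(Z, p)` in `p` over `ℂ⟦X⟧`. -/
def curveAlong (F : ℂ[X][Y]) (Z : PowerSeries ℂ) : Polynomial (PowerSeries ℂ) :=
  F.map (Polynomial.aeval Z).toRingHom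

lemma eval_curveAlong (F : ℂ[X][Y]) (Z f : PowerSeries ℂ) :
    (curveAlong F Z).eval f = Polynomial.aevalAeval Z f F := by
  rw [curveAlong, Polynomial.eval_map, aevalAeval_eq_eval₂]

/-- The constant coefficient as an algebra homomorphism. -/
def constantCoeffAlgHom : PowerSeries ℂ →ₐ[ℂ] ℂ :=
  { (constantCoeff : PowerSeries ℂ →+* ℂ) with commutes' := fun r => by simp }

lemma aevalAeval_eq_evalEval (F : ℂ[X][Y]) (a b : ℂ) :
    Polynomial.aevalAeval a b F = F.evalEval a b := by
  rw [Polynomial.coe_aevalAeval_eq_evalEval]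

lemma constantCoeff_eval_curveAlong (F : ℂ[X][Y]) (Z f : PowerSeries ℂ) :
    constantCoeff ((curveAlong F Z).eval f) =
      F.evalEval (constantCoeff Z) (constantCoeff f) := by
  rw [eval_curveAlong, ← aevalAeval_eq_evalEval]
  exact map_aevalAeval constantCoeffAlgHom Z f F

lemma derivative_curveAlong (F : ℂ[X][Y]) (Z : PowerSeries ℂ) :
    (curveAlong F Z).derivative = curveAlong (Polynomial.derivative F) Z := by
  rw [curveAlong, curveAlong, Polynomial.derivative_map]

/-- The inclusion of power series into Laurent series as an algebra homomorphism. -/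
def coeAlgHom : PowerSeries ℂ →ₐ[ℂ] LaurentSeries ℂ :=
  { HahnSeries.ofPowerSeries ℤ ℂ with
    commutes' := fun r => by
      change HahnSeries.ofPowerSeries ℤ ℂ (algebraMap ℂ (PowerSeries ℂ) r) = _
      rw [PowerSeries.algebraMap_apply, Algebra.algebraMap_self_apply, HahnSeries.ofPowerSeries_C,
        algebraMap_hahnSeries] }

lemma aevalAeval_coe (F : ℂ[X][Y]) (Z f : PowerSeries ℂ) :
    Polynomial.aevalAeval (HahnSeries.ofPowerSeries ℤ ℂ Z) (HahnSeries.ofPowerSeries ℤ ℂ f) F =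
      HahnSeries.ofPowerSeries ℤ ℂ ((curveAlong F Z).eval f) := by
  rw [eval_curveAlong]
  exact (map_aevalAeval (coeAlgHom) Z f F).symm

/-! ### Initial values of solutions lie on the curve -/

/-- For finite p₀, take constant coefficients. For p₀ = ∞, if the leading coefficient of F did not
vanish at y₀, then F(Z, p) would have a unit leading coefficient over ℂ⟦t⟧, and the rational root
theorem would place y' in ℂ⟦t⟧, leaving no pole. -/
lemma IsRamifiedSolution.onCurve {F : ℂ[X][Y]} {y₀ : ℂ} {p₀ : OnePoint ℂ} {L : ℕ}
    {Z : PowerSeries ℂ} (h : IsRamifiedSolution F y₀ p₀ L Z) : OnCurve F y₀ p₀ := by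
  set D := ramifiedDeriv L (HahnSeries.ofPowerSeries ℤ ℂ Z) with hD
  have he := h.eval_eq
  rw [← hD] at he
  have hv := h.value_eq
  rw [← hD] at hv
  induction p₀ using OnePoint.rec with
  | coe q =>
    obtain ⟨g, hg, hgq⟩ := exists_coe_of_valueAtZero hv
    rw [← hg, aevalAeval_coe, map_eq_zero_iff _ HahnSeries.ofPowerSeries_injective] at he
    have := constantCoeff_eval_curveAlong F Z g
    rw [he, map_zero, h.constantCoeff_eq, hgq] at this
    exact this.symm
  | infty =>
    rw [valueAtZero_eq_infty_iff] at hv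
    by_contra hlc
    change ¬ F.leadingCoeff.eval y₀ = 0 at hlc
    apply hv
    have hc : constantCoeff (Polynomial.aeval Z F.leadingCoeff) ≠ 0 := by
      have e : constantCoeff (Polynomial.aeval Z F.leadingCoeff) =
          Polynomial.aeval (constantCoeffAlgHom Z) F.leadingCoeff :=
        (Polynomial.aeval_algHom_apply constantCoeffAlgHom Z F.leadingCoeff).symm
      rw [e, Polynomial.aeval_def, Polynomial.eval₂_eq_eval_map]
      have : constantCoeffAlgHom Z = y₀ := h.constantCoeff_eq
      rw [this]
      simpa using hlc
    have hu : IsUnit (Polynomial.aeval Z F.leadingCoeff) := by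
      rw [PowerSeries.isUnit_iff_constantCoeff]; exact isUnit_iff_ne_zero.2 hc
    have hroot : Polynomial.aeval D (curveAlong F Z) = 0 := by
      rw [aevalAeval_eq_eval₂] at he
      rw [curveAlong, Polynomial.aeval_def, Polynomial.eval₂_map]
      rw [← he]
      congr 1
      refine RingHom.ext fun p => ?_
      exact (Polynomial.aeval_algHom_apply coeAlgHom Z p).symm
    have hlead : (curveAlong F Z).leadingCoeff = Polynomial.aeval Z F.leadingCoeff :=
      Polynomial.leadingCoeff_map_of_leadingCoeff_ne_zero _ hu.ne_zero
    have hden := isUnit_of_dvd_unit (den_dvd_of_is_root hroot) (hlead ▸ hu)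
    obtain ⟨g, hg⟩ := IsFractionRing.isInteger_of_isUnit_den hden
    exact ⟨g, hg⟩


lemma onCurve_of_mem_solutions {F : ℂ[X][Y]} {y₀ : ℂ} {p₀ : OnePoint ℂ} {y : HahnSeries ℚ ℂ}
    (hy : y ∈ solutions F y₀ p₀) : OnCurve F y₀ p₀ := by
  obtain ⟨hn, hd⟩ := ramificationOrder_spec hy.1
  obtain ⟨Z, -, hZ⟩ := exists_isRamifiedSolution hy hn hd
  exact hZ.onCurve

/-! ### Constant solutions -/

lemma valueAtZero_C (c : ℂ) : valueAtZero (HahnSeries.C c : HahnSeries ℚ ℂ) = (c : OnePoint ℂ) := by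
  rw [← ramify_C one_pos, valueAtZero_ramify, ← HahnSeries.ofPowerSeries_C, valueAtZero_coe,
    constantCoeff_C]

lemma puiseuxDeriv_C (c : ℂ) : puiseuxDeriv (HahnSeries.C c) = 0 := by
  ext q
  change ((q + 1 : ℚ) : ℂ) * (HahnSeries.C c : HahnSeries ℚ ℂ).coeff (q + 1) = 0
  rcases eq_or_ne (q + 1) 0 with h | h
  · rw [h, Rat.cast_zero, zero_mul]
  · rw [coeff_eq_zero_of_mem_constants (C_mem_constants c) h, mul_zero]

lemma valueAtZero_zero : valueAtZero (0 : HahnSeries ℚ ℂ) = ((0 : ℂ) : OnePoint ℂ) := by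
  rw [← map_zero (HahnSeries.C : ℂ →+* HahnSeries ℚ ℂ), valueAtZero_C]

lemma eq_of_mem_solutions_of_mem_constants {F : ℂ[X][Y]} {y₀ : ℂ} {p₀ : OnePoint ℂ}
    {y : HahnSeries ℚ ℂ} (hy : y ∈ solutions F y₀ p₀) (hc : y ∈ constants) :
    y = HahnSeries.C y₀ ∧ p₀ = ((0 : ℂ) : OnePoint ℂ) := by
  obtain ⟨c, rfl⟩ := hc
  obtain ⟨-, -, h1, h2⟩ := hy
  rw [valueAtZero_C, OnePoint.coe_eq_coe] at h1
  rw [puiseuxDeriv_C, valueAtZero_zero] at h2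
  exact ⟨by rw [h1], h2.symm⟩

lemma C_mem_solutions {F : ℂ[X][Y]} {y₀ : ℂ} (h : F.evalEval y₀ 0 = 0) :
    HahnSeries.C y₀ ∈ solutions F y₀ ((0 : ℂ) : OnePoint ℂ) := by
  refine ⟨⟨1, one_pos, hasDenominator_C y₀⟩, ?_, valueAtZero_C y₀, ?_⟩
  · rw [puiseuxDeriv_C]
    have := map_aevalAeval (Algebra.ofId ℂ (HahnSeries ℚ ℂ)) y₀ 0 F
    rw [aevalAeval_eq_evalEval, h, map_zero, Algebra.ofId_apply,
      algebraMap_hahnSeries] at this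
    exact this.symm
  · rw [puiseuxDeriv_C, valueAtZero_zero]

/-! ### Critical points -/

lemma bijOn_of_isCritical {F : ℂ[X][Y]} (hF : Squarefree F) {y₀ : ℂ} {p₀ : OnePoint ℂ}
    (hcrit : IsCritical F y₀ p₀) {R : Set (LaurentSeries ℂ × LaurentSeries ℂ)}
    (hR : IsPlaceRepresentatives F y₀ p₀ R) :
    Set.BijOn (firstTermsOfSolution (truncOrder F)) (solutions F y₀ p₀)
      (puiseuxSolve F y₀ p₀ R) := by
  have hN : 0 < truncOrder F := Nat.succ_pos _
  refine ⟨?_, ?_, ?_⟩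
  · intro y hy
    by_cases hc : y ∈ constants
    · obtain ⟨rfl, hp⟩ := eq_of_mem_solutions_of_mem_constants hy hc
      rw [firstTermsOfSolution_C hN]
      exact Or.inr (Or.inl ⟨hcrit, hp, rfl⟩)
    · exact Or.inr (Or.inr ⟨hcrit, firstTermsOfSolution_mem_output hN hR hy hc⟩)
  · intro y₁ hy₁ y₂ hy₂ h
    by_cases hc₁ : y₁ ∈ constants <;> by_cases hc₂ : y₂ ∈ constants
    · rw [(eq_of_mem_solutions_of_mem_constants hy₁ hc₁).1,
        (eq_of_mem_solutions_of_mem_constants hy₂ hc₂).1]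
    · obtain ⟨c, rfl⟩ := hc₁
      have h' := firstTermsOfSolution_notMem_constants hy₂ hc₂ hN
      rw [← h, firstTermsOfSolution_C hN] at h'
      exact absurd (C_mem_constants c) h'
    · obtain ⟨c, rfl⟩ := hc₂
      have h' := firstTermsOfSolution_notMem_constants hy₁ hc₁ hN
      rw [h, firstTermsOfSolution_C hN] at h'
      exact absurd (C_mem_constants c) h'
    · exact firstTermsOfSolution_injOn hF (Nat.lt_succ_self _) hy₁ hy₂ hc₁ hc₂ h
  · rintro yhat (⟨-, h, -⟩ | ⟨-, rfl, rfl⟩ | ⟨-, A, ⟨B, hB, rfl⟩, hA⟩)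
    · exact absurd hcrit h
    · exact ⟨_, C_mem_solutions hcrit.1, firstTermsOfSolution_C hN _⟩
    · exact exists_solution_of_mem_output hN (hR.1 B hB).1 (hR.1 B hB).2 hA

/-! ### Regular points -/

/-- Compare coefficients in Z' = L t^(L-1) g, where the power series g = y' has value q at 0. -/
lemma IsRamifiedSolution.leading_term {F : ℂ[X][Y]} {y₀ q : ℂ} {L : ℕ} (hL : 0 < L)
    {Z : PowerSeries ℂ} (h : IsRamifiedSolution F y₀ (q : OnePoint ℂ) L Z) :
    X ^ L ∣ Z - C y₀ ∧ coeff L (Z - C y₀) = q := by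
  obtain ⟨g, hg, hgq⟩ := exists_coe_of_valueAtZero h.value_eq
  have hs := ramifiedDeriv_spec hL Z
  rw [← hg, ← map_mul] at hs
  have hs := HahnSeries.ofPowerSeries_injective hs
  have hco : ∀ j, coeff (j + 1) Z * ((j : ℂ) + 1) = coeff j (C (L : ℂ) * X ^ (L - 1) * g) := by
    intro j; rw [hs, coeff_derivative]
  constructor
  · rw [X_pow_dvd_iff]
    rintro (_ | j) hj
    · rw [coeff_zero_eq_constantCoeff_apply, map_sub, h.constantCoeff_eq, constantCoeff_C, sub_self]
    · rw [coeff_sub_C_of_pos j.succ_pos]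
      have := hco j
      rw [mul_assoc, coeff_C_mul, coeff_X_pow_mul', if_neg (by omega), mul_zero,
        mul_eq_zero] at this
      exact this.resolve_right (by exact_mod_cast j.succ_ne_zero)
  · rw [coeff_sub_C_of_pos hL]
    obtain ⟨j, rfl⟩ := Nat.exists_eq_add_of_lt hL
    rw [zero_add] at *
    have := hco j
    rw [mul_assoc, coeff_C_mul, Nat.add_sub_cancel, coeff_X_pow_mul', if_pos le_rfl, Nat.sub_self,
      coeff_zero_eq_constantCoeff_apply, hgq, mul_comm, Nat.cast_add, Nat.cast_one] at this
    exact mul_left_cancel₀ (by exact_mod_cast j.succ_ne_zero) this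

lemma constantCoeff_coordSeries (y₀ : ℂ) {k : ℕ} (hk : 0 < k) :
    constantCoeff (coordSeries y₀ k) = y₀ := by
  simp [coordSeries, hk.ne']

/-- At a regular point there is at most one solution. -/
lemma IsRamifiedSolution.eq_of_regular {F : ℂ[X][Y]} {y₀ q : ℂ} (hq : q ≠ 0)
    (hd : (Polynomial.derivative F).evalEval y₀ q ≠ 0) {L : ℕ} (hL : 0 < L)
    {Z₁ Z₂ : PowerSeries ℂ} (h₁ : IsRamifiedSolution F y₀ (q : OnePoint ℂ) L Z₁)
    (h₂ : IsRamifiedSolution F y₀ (q : OnePoint ℂ) L Z₂) : Z₁ = Z₂ := by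
  obtain ⟨γ, hγ⟩ := IsAlgClosed.exists_pow_nat_eq q hL
  have hγ0 : γ ≠ 0 := by rintro rfl; rw [zero_pow hL.ne'] at hγ; exact hq hγ.symm
  have key : ∀ Z : PowerSeries ℂ, IsRamifiedSolution F y₀ (q : OnePoint ℂ) L Z →
      ∃ W S f, IsLocalInverse y₀ L L γ Z W S (HahnSeries.ofPowerSeries ℤ ℂ f) ∧
        constantCoeff f = q ∧ (curveAlong F (coordSeries y₀ L)).eval f = 0 := by
    intro Z h
    obtain ⟨hdv, hc⟩ := h.leading_term hL
    -- As q ≠ 0, the order of Z - y₀ is L, so K = L and P is a power series with constant term q: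
    -- the simple root of F(y₀ + τ^L, p).
    obtain ⟨W, S, P, hi⟩ := exists_isLocalInverse (L := L) hL hγ0 hdv (hγ.trans hc.symm)
    obtain ⟨g, hg, hgq⟩ := exists_coe_of_valueAtZero h.value_eq
    have hP := hi.P_eq
    rw [← hg, laurentSubst_coe hi.order_S] at hP
    subst hP
    have hr := hi.root h.eval_eq
    rw [aevalAeval_coe, map_eq_zero_iff _ HahnSeries.ofPowerSeries_injective] at hr
    refine ⟨W, S, _, hi, ?_, hr⟩
    rw [constantCoeff_subst_of_zero, hgq]
    exact (order_eq_one_iff.1 hi.order_S).1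
  obtain ⟨W₁, S₁, f₁, hi₁, hc₁, hr₁⟩ := key Z₁ h₁
  obtain ⟨W₂, S₂, f₂, hi₂, hc₂, hr₂⟩ := key Z₂ h₂
  have : f₁ = f₂ := eq_of_simple_root hr₁ hr₂ (hc₁.trans hc₂.symm) (by
    rw [derivative_curveAlong, constantCoeff_eval_curveAlong, constantCoeff_coordSeries y₀ hL, hc₂]
    exact hd)
  subst this
  exact hi₁.eq_of_P_eq hi₂ hL hL

/-- At a regular point there is a power series solution. -/
lemma exists_isRamifiedSolution_of_regular {F : ℂ[X][Y]} {y₀ q : ℂ} (hq : q ≠ 0)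
    (h0 : F.evalEval y₀ q = 0) (hd : (Polynomial.derivative F).evalEval y₀ q ≠ 0) :
    ∃ Z, IsRamifiedSolution F y₀ (q : OnePoint ℂ) 1 Z := by
  have hcc := constantCoeff_coordSeries y₀ one_pos
  obtain ⟨f, hf, hfq⟩ := exists_root_of_simple (g := curveAlong F (coordSeries y₀ 1)) (q := q)
    (by rw [constantCoeff_eval_curveAlong, hcc, constantCoeff_C, h0])
    (by rwa [derivative_curveAlong, constantCoeff_eval_curveAlong, hcc, constantCoeff_C])
  -- The regular place is (y₀ + t, f) with f(0) = q ≠ 0, hence k = n = 1 and r = 0.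
  obtain ⟨s, hs, he⟩ := exists_associatedEquation (y₀ := y₀) one_pos one_pos (r := 0) (by simp)
    (u := f) (by rwa [hfq])
  rw [associatedEquation_iff one_pos hs, HahnSeries.single_zero_one, one_mul,
    laurentSubst_coe hs] at he
  have hs0 := (order_eq_one_iff.1 hs).1
  refine ⟨(coordSeries y₀ 1).subst s, ?_, ?_, ?_⟩
  · rw [constantCoeff_subst_of_zero hs0, hcc]
  · have := congrArg (laurentSubstHom hs) (aevalAeval_coe F (coordSeries y₀ 1) f)
    rw [hf, map_zero, map_zero, map_aevalAeval, ← laurentSubst_eq_hom, ← laurentSubst_eq_hom,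
      laurentSubst_coe hs, laurentSubst_coe hs, ← he] at this
    exact this
  · rw [he, valueAtZero_coe, constantCoeff_subst_of_zero hs0, hfq]

lemma firstTermsOfSolution_one {F : ℂ[X][Y]} {y₀ q : ℂ} (hq : q ≠ 0) {Z : PowerSeries ℂ}
    (h : IsRamifiedSolution F y₀ (q : OnePoint ℂ) 1 Z) :
    firstTermsOfSolution 1 (ramify one_pos (HahnSeries.ofPowerSeries ℤ ℂ Z)) =
      HahnSeries.C y₀ + HahnSeries.single (1 : ℚ) q := by
  obtain ⟨h1, h2⟩ := h.leading_term one_pos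
  have hp : IsPuiseux (ramify one_pos (HahnSeries.ofPowerSeries ℤ ℂ Z)) :=
    ⟨1, one_pos, hasDenominator_ramify one_pos _⟩
  have hr : ramificationOrder (ramify one_pos (HahnSeries.ofPowerSeries ℤ ℂ Z)) = 1 :=
    le_antisymm (ramificationOrder_le one_pos (hasDenominator_ramify one_pos _))
      (ramificationOrder_spec hp).1
  rw [firstTermsOfSolution_ramify one_pos h.constantCoeff_eq h1 (h2.trans_ne hq) 1, hr]
  rw [coeff_sub_C_of_pos one_pos] at h2
  have hrat : ((1 : ℕ) : ℚ) / ((1 : ℕ) : ℚ) + ((1 : ℕ) : ℚ) / ((1 : ℕ) : ℚ) = 2 := by norm_num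
  rw [hrat]
  ext x
  by_cases hx : ∃ j : ℤ, x * ((1 : ℕ) : ℚ) = j
  · obtain ⟨j, hj⟩ := hx
    rw [Nat.cast_one, mul_one] at hj
    subst hj
    have hco := ramify_coeff one_pos (HahnSeries.ofPowerSeries ℤ ℂ Z) j
    rw [Nat.cast_one, div_one] at hco
    rw [HahnSeries.coeff_add, HahnSeries.C_apply]
    rcases lt_or_ge j 2 with hj2 | hj2
    · rw [HahnSeries.coeff_truncLT_of_lt (by exact_mod_cast hj2), hco]
      rcases lt_or_ge j 0 with hj0 | hj0
      · rw [coeff_ofPowerSeries_neg _ hj0, HahnSeries.coeff_single_of_ne (by exact_mod_cast hj0.ne),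
          HahnSeries.coeff_single_of_ne (by exact_mod_cast (by omega : j ≠ 1)), add_zero]
      · lift j to ℕ using hj0
        rw [coeff_ofPowerSeries_nat]
        have : j = 0 ∨ j = 1 := by omega
        rcases this with rfl | rfl
        · simp [h.constantCoeff_eq]
        · simp [h2]
    · rw [HahnSeries.coeff_truncLT_of_le (by exact_mod_cast hj2),
        HahnSeries.coeff_single_of_ne (by exact_mod_cast (by omega : j ≠ 0)),
          HahnSeries.coeff_single_of_ne (by exact_mod_cast (by omega : j ≠ 1)), add_zero]
  · have hx0 : x ≠ 0 := by rintro rfl; exact hx ⟨0, by simp⟩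
    have hx1 : x ≠ 1 := by rintro rfl; exact hx ⟨1, by simp⟩
    rw [HahnSeries.coeff_add, HahnSeries.C_apply, HahnSeries.coeff_single_of_ne hx0,
      HahnSeries.coeff_single_of_ne hx1, add_zero]
    rcases lt_or_ge x 2 with h' | h'
    · rw [HahnSeries.coeff_truncLT_of_lt h', ramify_coeff_of_not one_pos _ hx]
    · rw [HahnSeries.coeff_truncLT_of_le h']

/-- Off the curve both sets are empty; on it p₀ is finite and non-zero, and both sets have exactly
one element. -/
lemma bijOn_of_not_isCritical {F : ℂ[X][Y]} {y₀ : ℂ} {p₀ : OnePoint ℂ}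
    (hcrit : ¬ IsCritical F y₀ p₀) (R : Set (LaurentSeries ℂ × LaurentSeries ℂ)) :
    Set.BijOn (firstTermsOfSolution 1) (solutions F y₀ p₀) (puiseuxSolve F y₀ p₀ R) := by
  by_cases hon : OnCurve F y₀ p₀
  swap
  · have h1 : solutions F y₀ p₀ = ∅ :=
      Set.eq_empty_of_forall_notMem fun y hy => hon (onCurve_of_mem_solutions hy)
    have h2 : puiseuxSolve F y₀ p₀ R = ∅ := by
      refine Set.eq_empty_of_forall_notMem ?_
      rintro y (⟨h, -⟩ | ⟨h, -⟩ | ⟨h, -⟩)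
      · exact hon h
      · exact hcrit h
      · exact hcrit h
    rw [h1, h2]
    exact Set.bijOn_empty _
  induction p₀ using OnePoint.rec with
  | infty => exact absurd ⟨hon, Or.inl rfl⟩ hcrit
  | coe q =>
    have hq : q ≠ 0 := fun h => hcrit ⟨hon, Or.inr ⟨q, rfl, Or.inl h⟩⟩
    have hd : (Polynomial.derivative F).evalEval y₀ q ≠ 0 :=
      fun h => hcrit ⟨hon, Or.inr ⟨q, rfl, Or.inr h⟩⟩
    obtain ⟨Z, hZ⟩ := exists_isRamifiedSolution_of_regular hq hon hd
    have hsol := hZ.mem_solutions one_pos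
    have hT := firstTermsOfSolution_one hq hZ
    set y := ramify one_pos (HahnSeries.ofPowerSeries ℤ ℂ Z) with hy
    have h1 : solutions F y₀ (q : OnePoint ℂ) = {y} := by
      refine Set.eq_singleton_iff_unique_mem.2 ⟨hsol, fun y' hy' => ?_⟩
      obtain ⟨hn, hnd⟩ := ramificationOrder_spec hy'.1
      obtain ⟨Z₁, hZ₁y, hZ₁⟩ := exists_isRamifiedSolution hy' hn hnd
      have hyd : HasDenominator y (ramificationOrder y') := by
        have := hasDenominator_mul (hasDenominator_ramify one_pos
          (HahnSeries.ofPowerSeries ℤ ℂ Z)) (ramificationOrder y')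
        rwa [one_mul] at this
      -- The power series solution is rewritten with the denominator of its competitor, so that both
      -- share one coordinate t.
      obtain ⟨Z₂, hZ₂y, hZ₂⟩ := exists_isRamifiedSolution hsol hn hyd
      rw [← hZ₁y, ← hZ₂y, hZ₁.eq_of_regular hq hd hn hZ₂]
    have h2 : puiseuxSolve F y₀ (q : OnePoint ℂ) R =
        {HahnSeries.C y₀ + HahnSeries.single (1 : ℚ) q} := by
      refine Set.eq_singleton_iff_unique_mem.2 ⟨Or.inl ⟨hon, hcrit, q, rfl, rfl⟩, ?_⟩
      rintro y (⟨-, -, q', h, rfl⟩ | ⟨h, -⟩ | ⟨h, -⟩)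
      · rw [OnePoint.coe_eq_coe.1 h]
      · exact absurd h hcrit
      · exact absurd h hcrit
    rw [h1, h2, ← hT]
    exact Set.bijOn_singleton.2 rfl

/-! ### Restriction to the non-constant elements and conclusion. -/

lemma bijOn_sdiff {α : Type*} {f : α → α} {s t c : Set α} (h : Set.BijOn f s t)
    (hc : ∀ y ∈ s, f y ∈ c ↔ y ∈ c) : Set.BijOn f (s \ c) (t \ c) := by
  refine ⟨fun y hy => ⟨h.mapsTo hy.1, fun hy' => hy.2 ((hc y hy.1).1 hy')⟩,
    h.injOn.mono Set.sdiff_subset, ?_⟩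
  rintro z ⟨hz, hzc⟩
  obtain ⟨y, hy, rfl⟩ := h.surjOn hz
  exact ⟨y, ⟨hy, fun hyc => hzc ((hc y hy).2 hyc)⟩, rfl⟩

lemma firstTermsOfSolution_mem_constants_iff {F : ℂ[X][Y]} {y₀ : ℂ} {p₀ : OnePoint ℂ}
    {y : HahnSeries ℚ ℂ} (hy : y ∈ solutions F y₀ p₀) {M : ℕ} (hM : 0 < M) :
    firstTermsOfSolution M y ∈ constants ↔ y ∈ constants := by
  constructor
  · intro h
    by_contra hc
    exact firstTermsOfSolution_notMem_constants hy hc hM h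
  · rintro ⟨c, rfl⟩
    rw [firstTermsOfSolution_C hM]
    exact C_mem_constants c

end
end PuiseuxTruncation

theorem mainTheorem5 (F : ℂ[X][Y]) (hF : Squarefree F)
    (hy : ∀ g : Polynomial ℂ, Polynomial.C g ∣ F → IsUnit g)
    (hp : ∀ g : Polynomial ℂ, g.map Polynomial.C ∣ F → IsUnit g)
    (y₀ : ℂ) (p₀ : OnePoint ℂ) :
    (∃ R, IsPlaceRepresentatives F y₀ p₀ R) ∧
    ∀ R, IsPlaceRepresentatives F y₀ p₀ R →
      Set.BijOn (solutionTruncation F y₀ p₀) (solutions F y₀ p₀) (puiseuxSolve F y₀ p₀ R) ∧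
      Set.BijOn (solutionTruncation F y₀ p₀) (solutions F y₀ p₀ \ constants)
        (puiseuxSolve F y₀ p₀ R \ constants) := by
  classical
  refine ⟨PuiseuxTruncation.exists_placeRepresentatives hy y₀ p₀, fun R hR => ?_⟩
  have hM : 0 < if IsCritical F y₀ p₀ then truncOrder F else 1 := by
    split_ifs
    · exact Nat.succ_pos _
    · exact one_pos
  have h : Set.BijOn (solutionTruncation F y₀ p₀) (solutions F y₀ p₀)
      (puiseuxSolve F y₀ p₀ R) := by
    unfold solutionTruncation
    by_cases hcrit : IsCritical F y₀ p₀
    · simp only [if_pos hcrit]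
      exact PuiseuxTruncation.bijOn_of_isCritical hF hcrit hR
    · simp only [if_neg hcrit]
      exact PuiseuxTruncation.bijOn_of_not_isCritical hcrit R
  refine ⟨h, PuiseuxTruncation.bijOn_sdiff h fun y hys => ?_⟩
  unfold solutionTruncation
  convert PuiseuxTruncation.firstTermsOfSolution_mem_constants_iff hys hM
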